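/- Let $1\le p\le n$, let $A$ be a $p\times n$ matrix with entries in $\mathbb Z_{\ge0}$ and columns $\alpha^1,\dots,\alpha^n\in\mathbb Z_{\ge0}^p$, write $|\alpha^k|$ for the sum of the entries of $\alpha^k$ and $\langle\alpha^k,s\rangle=\sum_l\alpha^k_l s_l$. Fix $I=(i_1<\dots<i_p)$ in $\{1,\dots,n\}$ with minor $\Delta_I=\det(\alpha^j)_{j\in I}\neq0$, and a smooth test form with compact support $\varphi=\sum_I\varphi_I\,d\zeta\wedge d\bar\zeta[I]$ of bidegree $(n,n-p)$ on $\mathbb C^n$. Let $\Gamma^I(s,\varphi)$ be the meromorphic continuation to $\mathbb C^p$ of $$\frac{c_I\Delta_I}{(2\pi i)^p}\int_{\mathbb C^n}\varphi_I(\zeta)\bigwedge_{j\in I}\Big(\frac{|\zeta_j|^{2(\langle\alpha^j,s\rangle-1)}}{\zeta_j^{|\alpha^j|-1}}\,d\bar\zeta_j\wedge d\zeta_j\Big)\bigwedge_{k\notin I}\Big(\frac{|\zeta_k|^{2\langle\alpha^k,s\rangle}}{\zeta_k^{|\alpha^k|}}\,d\bar\zeta_k\wedge d\zeta_k\Big),$$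 where $c_I=(-1)^{i_1+\dots+i_p-p(p+1)/2+(n-p+1)(n-p)/2}$; the integral converges absolutely for $\Re s_1,\dots,\Re s_p>1$, and the poles lie on the hyperplanes $\langle\alpha^k,s\rangle=-\nu$ with $\nu=0,1,2,\dots$ for $k\in I$ and $\nu=1,2,\dots$ for $k\notin I$. Put $$K^I=\{x\in\mathbb R^p:\langle\alpha^k,x\rangle\ge0,\ k\in I\},\qquad K^I_0=K^I\cap\{x_1+\dots+x_p\le0\},\qquad M=\operatorname{int}K^I\cap\{x_1<1,\dots,x_p<1\},$$ let $q$ be the codimension of $K_0^I$ in $\mathbb R^p$, and assume $q\ge1$. Then there is a set $J=\{j_1,\dots,j_q\}\subset I$ of cardinality $q$ with $$K_0^I=\{x:\langle\alpha^j,x\rangle=0,\ j\in J;\ \langle\alpha^k,x\rangle\ge0,\ k\in I\setminus J\}.$$ Let $L^q=\{s\in\mathbb C^p:\langle\alpha^j,s\rangle=0,\ j\in J\}$. The composite Leray residue form $\operatorname{res}_{L^q}[\Gamma^I(s,\varphi)\,ds]$ along the hyperplanes $\langle\alpha^{j_1},s\rangle=0,\dots,\langle\alpha^{j_q},s\rangle=0$,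 taken in this order, exists at the points of $L^q$ that lie on no other of the above hyperplanes. Let $\gamma\in M$ and $\gamma^q\in M^q:=\operatorname{rel\,int}(K^I_0\cap\overline M)$ be such that $\langle\alpha^k,\gamma\rangle>-1$ and $\langle\alpha^k,\gamma^q\rangle>-1$ for all $k\notin I$ (for instance, $\gamma\in(0,1)^p$ and $\gamma^q\in M^q$ close to $0$). Then both integrals below converge absolutely, and $$\lim_{\tau\to0+}\frac1{(2\pi i)^p}\int_{\gamma+i\mathbb R^p}\tau^{-|s|}\,\Gamma(|s|+1)\prod_{k=1}^p\Gamma(1-s_k)\,\Gamma^I(s,\varphi)\,ds=\frac1{(2\pi i)^{p-q}}\int_{\gamma^q+i\,\Im L^q}\prod_{k=1}^p\Gamma(1-s_k)\,\operatorname{res}_{L^q}\big[\Gamma^I(s,\varphi)\,ds\big],$$ where $|s|=s_1+\dots+s_p$. Here $i\mathbb R^p$ has its standard orientation and $i\,\Im L^q$ is oriented so that a basis $iv_1,\dots,iv_{p-q}$ is positive if and only if $\det(\alpha^{j_1},\dots,\alpha^{j_q},v_1,\dots,v_{p-q})>0$; if $q=p$, then the integral on the right is the value at the point $\gamma^q=0$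 times the sign of $\det(\alpha^{j_1},\dots,\alpha^{j_q})$. -/

import Mathlib

open Filter Topology MeasureTheory
open scoped ContDiff

noncomputable section

namespace BochnerMartinelli

/-! ### Holomorphic forms on linear subspaces and Leray residues -/

section Residue

variable {V : Type} [NormedAddCommGroup V] [NormedSpace ℂ V]

/-- Differential forms of type `(k, 0)` on the complex linear subspace `W`; holomorphy is a
separate condition. -/
abbrev Form (W : Submodule ℂ V) (k : ℕ) : Type := W → W [⋀^Fin k]→ₗ[ℂ] ℂ

/-- The form has holomorphic coefficients near `a`. -/
def HolomorphicFormAt {W : Submodule ℂ V} {k : ℕ} (η : Form W k) (a : W) : Prop :=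
  ∀ v : Fin k → W, AnalyticAt ℂ (fun z => η z v) a

/-- The exterior product `l ∧ χ` of a linear form and a `k`-form:
`(l ∧ χ)(v₀, …, vₖ) = ∑ᵢ (-1)ⁱ l(vᵢ) χ(v₀, …, v̂ᵢ, …, vₖ)`. -/
def wedgeOne {E : Type} [AddCommGroup E] [Module ℂ E] {k : ℕ}
    (l : E →ₗ[ℂ] ℂ) (χ : E [⋀^Fin k]→ₗ[ℂ] ℂ) : E [⋀^Fin (k + 1)]→ₗ[ℂ] ℂ :=
  AlternatingMap.alternatizeUncurryFin (l.smulRight χ)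

/-- The inclusion of `W ∩ {l = 0}` in `W`. -/
abbrev sliceIncl (W : Submodule ℂ V) (l : V →ₗ[ℂ] ℂ) :
    (W ⊓ LinearMap.ker l : Submodule ℂ V) →ₗ[ℂ] W :=
  Submodule.inclusion inf_le_left

/-- `ρ` is, near the point `a` of the hyperplane `l = 0` of `W`, the Leray residue form of `ψ`:
`ψ = (dl / l) ∧ χ + θ` with `χ`, `θ` regular near `a`, and `ρ` is the restriction of `χ` to the
hyperplane. -/
def IsLerayResidueAt (W : Submodule ℂ V) (l : V →ₗ[ℂ] ℂ) {k : ℕ} (ψ : Form W (k + 1))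
    (ρ : Form (W ⊓ LinearMap.ker l) k) (a : (W ⊓ LinearMap.ker l : Submodule ℂ V)) : Prop :=
  ∃ (χ : Form W k) (θ : Form W (k + 1)),
    HolomorphicFormAt χ (sliceIncl W l a) ∧ HolomorphicFormAt θ (sliceIncl W l a) ∧
    (∀ᶠ z : W in 𝓝 (sliceIncl W l a), l (z : V) ≠ 0 →
      ψ z = (l (z : V))⁻¹ • wedgeOne (l ∘ₗ W.subtype) (χ z) + θ z) ∧
    ∀ᶠ z in 𝓝 a, ρ z = (χ (sliceIncl W l z)).compLinearMap (sliceIncl W l)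

/-- The intersection of `W` with the hyperplanes `f j = 0`, `j` in the list. -/
def interKer {ι : Type} (f : ι → V →ₗ[ℂ] ℂ) : List ι → Submodule ℂ V → Submodule ℂ V
  | [], W => W
  | j :: J, W => interKer f J (W ⊓ LinearMap.ker (f j))

theorem mem_interKer {ι : Type} (f : ι → V →ₗ[ℂ] ℂ) (J : List ι) (W : Submodule ℂ V) (x : V) :
    x ∈ interKer f J W ↔ x ∈ W ∧ ∀ j ∈ J, f j x = 0 := by
  induction J generalizing W with
  | nil => simp [interKer]
  | cons j J ih => simp [interKer, ih, and_assoc]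

/-- `ρ` is the composite residue form `(res_q ∘ ⋯ ∘ res_1)[ψ]` along the hyperplanes `f j = 0`,
with `j` running through the list, over the part of these hyperplanes that lies in `D`. Each
residue form is considered off the hyperplanes that are still to come, along which it may have
poles. -/
def IsCompositeResidue {ι : Type} (f : ι → V →ₗ[ℂ] ℂ) (D : Set V) :
    ∀ (J : List ι) (W : Submodule ℂ V) (m : ℕ),
      Form W (m + J.length) → Form (interKer f J W) m → Prop
  | [], W, _, ψ, ρ => ∀ a : W, (a : V) ∈ D → ρ a = ψ a
  | j :: J, W, m, ψ, ρ =>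
      ∃ σ : Form (W ⊓ LinearMap.ker (f j)) (m + J.length),
        (∀ a : (W ⊓ LinearMap.ker (f j) : Submodule ℂ V), (a : V) ∈ D →
          (∀ i ∈ J, f i (a : V) ≠ 0) → IsLerayResidueAt W (f j) ψ σ a) ∧
        IsCompositeResidue f D J (W ⊓ LinearMap.ker (f j)) m σ ρ

end Residue

/-! ### The Mellin transform of a monomial mapping -/

/-- A test form `φ = ∑_I φ_I dζ ∧ dζ̄[I]` of bidegree `(n, n - p)` on `ℂⁿ`, given by its
coefficients; `I` runs over the increasing sequences `i₁ < ⋯ < i_p`. -/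
structure TestForm (p n : ℕ) where
  coeff : (Fin p ↪o Fin n) → (Fin n → ℂ) → ℂ
  smooth : ∀ I, ContDiff ℝ ∞ (coeff I)
  compactSupport : ∀ I, HasCompactSupport (coeff I)

variable {p n : ℕ}

/-- The linear form `s ↦ ⟨αᵏ, s⟩`, where `αᵏ` is the `k`-th column of `A`. -/
def col (R : Type) [CommRing R] (A : Matrix (Fin p) (Fin n) ℕ) (k : Fin n) :
    (Fin p → R) →ₗ[R] R :=
  ∑ i, (A i k : R) • LinearMap.proj i

/-- The minor `Δ_I`. -/
def minor (A : Matrix (Fin p) (Fin n) ℕ) (I : Fin p ↪o Fin n) : ℤ :=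
  ((A.map (Nat.cast : ℕ → ℤ)).submatrix id I).det

/-- The sum `|αᵏ|` of the entries of the `k`-th column. -/
def colSum (A : Matrix (Fin p) (Fin n) ℕ) (k : Fin n) : ℕ := ∑ i, A i k

/-- The sign `c_I = (-1)^(|I| - (p+1)p/2 + (n-p+1)(n-p)/2)`, where `|I| = i₁ + ⋯ + i_p` for the
numbering of the coordinates from `1`. -/
def cSign (I : Fin p ↪o Fin n) : ℂ :=
  (-1 : ℂ) ^ ((∑ k, (((I k : ℕ) : ℤ) + 1)) - ((p : ℤ) + 1) * p / 2
    + ((n : ℤ) - p + 1) * ((n : ℤ) - p) / 2)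

/-- The coefficient of `⋀ⱼ (dζ̄ⱼ ∧ dζⱼ)` in the integral that defines `Γ^I(s, φ)`. -/
def mellinDensity (A : Matrix (Fin p) (Fin n) ℕ) (I : Fin p ↪o Fin n) (φ : TestForm p n)
    (s : Fin p → ℂ) (ζ : Fin n → ℂ) : ℂ :=
  φ.coeff I ζ
    * (∏ j : Fin p, ((‖ζ (I j)‖ : ℂ) ^ (2 * (col ℂ A (I j) s - 1))
        / ζ (I j) ^ ((colSum A (I j) : ℤ) - 1)))
    * ∏ k ∈ Finset.univ.filter (fun k => k ∉ Set.range I),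
        ((‖ζ k‖ : ℂ) ^ (2 * col ℂ A k s) / ζ k ^ colSum A k)

/-- The integral that defines `Γ^I(s, φ)` where it converges; `dζ̄ⱼ ∧ dζⱼ` is `2i` times the
Lebesgue measure of the plane. -/
def mellinIntegral (A : Matrix (Fin p) (Fin n) ℕ) (I : Fin p ↪o Fin n) (φ : TestForm p n)
    (s : Fin p → ℂ) : ℂ :=
  cSign I * (minor A I : ℂ) / (2 * Real.pi * Complex.I) ^ p
    * ((2 * Complex.I) ^ n * ∫ ζ : Fin n → ℂ, mellinDensity A I φ s ζ)

/-- The polar hyperplanes `⟨αᵏ, s⟩ = -ν` of `Γ^I`, with `ν ≥ 0` for `k ∈ I` and `ν ≥ 1` for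
`k ∉ I`, except the hyperplanes `⟨αʲ, s⟩ = 0` for the members `j` of `I` at the positions in the
list `J`. -/
def polarSet (A : Matrix (Fin p) (Fin n) ℕ) (I : Fin p ↪o Fin n) (J : List (Fin p)) :
    Set (Fin p → ℂ) :=
  {s | (∃ (j : Fin p) (ν : ℕ), (j ∈ J → 1 ≤ ν) ∧ col ℂ A (I j) s = -(ν : ℂ)) ∨
    ∃ (k : Fin n) (ν : ℕ), k ∉ Set.range I ∧ 1 ≤ ν ∧ col ℂ A k s = -(ν : ℂ)}

/-- `G` is the meromorphic continuation of the Mellin integral to all of `ℂᵖ`: it is holomorphic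
off the polar hyperplanes and equals the integral on `{Re s₁ > 1, …, Re s_p > 1}`, where the
integral converges absolutely. -/
def IsMellinContinuation (A : Matrix (Fin p) (Fin n) ℕ) (I : Fin p ↪o Fin n) (φ : TestForm p n)
    (G : (Fin p → ℂ) → ℂ) : Prop :=
  AnalyticOnNhd ℂ G (polarSet A I [])ᶜ ∧
    ∀ s : Fin p → ℂ, (∀ k, 1 < (s k).re) →
      Integrable (mellinDensity A I φ s) ∧ G s = mellinIntegral A I φ s

/-- The function `Γ^I(s, φ)`, continued meromorphically. -/
def mellinGamma (A : Matrix (Fin p) (Fin n) ℕ) (I : Fin p ↪o Fin n) (φ : TestForm p n) :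
    (Fin p → ℂ) → ℂ :=
  Classical.epsilon (IsMellinContinuation A I φ)

/-! ### The Mellin–Barnes integral -/

/-- The point `x + iy` of `ℂᵖ`. -/
def cpoint (x y : Fin p → ℝ) : Fin p → ℂ := fun k => (x k : ℂ) + Complex.I * (y k : ℂ)

/-- The coefficient of `ds₁ ∧ ⋯ ∧ ds_p` in the `p`-fold Mellin–Barnes integral. -/
def barnesIntegrand (A : Matrix (Fin p) (Fin n) ℕ) (I : Fin p ↪o Fin n) (φ : TestForm p n)
    (τ : ℝ) (s : Fin p → ℂ) : ℂ :=
  (τ : ℂ) ^ (-∑ k, s k) * Complex.Gamma ((∑ k, s k) + 1) * (∏ k, Complex.Gamma (1 - s k))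
    * mellinGamma A I φ s

/-- `(2πi)⁻ᵖ ∫_{γ + iℝᵖ} τ^{-|s|} Γ(|s|+1) ∏ Γ(1-s_k) Γ^I(s, φ) ds`, with `ds = iᵖ dy` on
`s = γ + iy`. -/
def barnesIntegral (A : Matrix (Fin p) (Fin n) ℕ) (I : Fin p ↪o Fin n) (φ : TestForm p n)
    (γ : Fin p → ℝ) (τ : ℝ) : ℂ :=
  1 / (2 * Real.pi * Complex.I) ^ p
    * (Complex.I ^ p * ∫ y : Fin p → ℝ, barnesIntegrand A I φ τ (cpoint γ y))

/-! ### The cone and its distinguished face -/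

/-- The cone `K^I`. -/
def cone (A : Matrix (Fin p) (Fin n) ℕ) (I : Fin p ↪o Fin n) : Set (Fin p → ℝ) :=
  {x | ∀ j, 0 ≤ col ℝ A (I j) x}

/-- The intersection `K₀^I` of the cone with the half-space `x₁ + ⋯ + x_p ≤ 0`. -/
def coneZero (A : Matrix (Fin p) (Fin n) ℕ) (I : Fin p ↪o Fin n) : Set (Fin p → ℝ) :=
  cone A I ∩ {x | ∑ k, x k ≤ 0}

/-- The codimension `q` of `K₀^I`. -/
def codimZero (A : Matrix (Fin p) (Fin n) ℕ) (I : Fin p ↪o Fin n) : ℕ :=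
  p - Module.finrank ℝ (Submodule.span ℝ (coneZero A I))

/-- The list `J` enumerates the positions in `I` of a subset of `I` of cardinality `q` such that
`K₀^I = {⟨αʲ, x⟩ = 0 for j ∈ J, ⟨αᵏ, x⟩ ≥ 0 for k ∈ I \ J}`. -/
def IsFaceIndexing (A : Matrix (Fin p) (Fin n) ℕ) (I : Fin p ↪o Fin n) (J : List (Fin p)) :
    Prop :=
  J.Nodup ∧ J.length = codimZero A I ∧
    coneZero A I = {x | (∀ j ∈ J, col ℝ A (I j) x = 0) ∧ ∀ k, k ∉ J → 0 ≤ col ℝ A (I k) x}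

/-- The set `M = int K^I ∩ {x₁ < 1, …, x_p < 1}`. -/
def admissible (A : Matrix (Fin p) (Fin n) ℕ) (I : Fin p ↪o Fin n) : Set (Fin p → ℝ) :=
  interior (cone A I) ∩ {x | ∀ k, x k < 1}

/-- The set `M^q`, the relative interior of `K₀^I ∩ closure M`. -/
def admissibleFace (A : Matrix (Fin p) (Fin n) ℕ) (I : Fin p ↪o Fin n) : Set (Fin p → ℝ) :=
  intrinsicInterior ℝ (coneZero A I ∩ closure (admissible A I))

/-- No polar hyperplane `⟨αᵏ, s⟩ = -ν`, `k ∉ I`, separates `x` from the origin. -/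
def PoleFree (A : Matrix (Fin p) (Fin n) ℕ) (I : Fin p ↪o Fin n) (x : Fin p → ℝ) : Prop :=
  ∀ k : Fin n, k ∉ Set.range I → -1 < col ℝ A k x

/-! ### The residue form and the integral over `γ^q + i Im L^q` -/

/-- The subspace `L^q` of `ℂᵖ` on which `⟨αʲ, s⟩ = 0` for `j` in `J`. -/
abbrev leaf (A : Matrix (Fin p) (Fin n) ℕ) (I : Fin p ↪o Fin n) (J : List (Fin p)) :
    Submodule ℂ (Fin p → ℂ) :=
  interKer (fun j => col ℂ A (I j)) J ⊤

/-- The real subspace `Re L^q = Im L^q` of `ℝᵖ`. -/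
def realLeaf (A : Matrix (Fin p) (Fin n) ℕ) (I : Fin p ↪o Fin n) (J : List (Fin p)) :
    Submodule ℝ (Fin p → ℝ) where
  carrier := {x | ∀ j ∈ J, col ℝ A (I j) x = 0}
  add_mem' hx hy j hj := by rw [map_add, hx j hj, hy j hj, add_zero]
  zero_mem' j _ := map_zero _
  smul_mem' c x hx j hj := by rw [map_smul, hx j hj, smul_zero]

theorem col_cpoint (A : Matrix (Fin p) (Fin n) ℕ) (k : Fin n) (x y : Fin p → ℝ) :
    col ℂ A k (cpoint x y) = (col ℝ A k x : ℂ) + Complex.I * (col ℝ A k y : ℂ) := by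
  simp only [col, cpoint, LinearMap.sum_apply, LinearMap.smul_apply, LinearMap.proj_apply,
    smul_eq_mul, Complex.ofReal_sum, Complex.ofReal_mul, Complex.ofReal_natCast, Finset.mul_sum,
    ← Finset.sum_add_distrib]
  exact Finset.sum_congr rfl fun i _ => by ring

/-- The point `x + iy` of `L^q`. -/
def leafPoint (A : Matrix (Fin p) (Fin n) ℕ) (I : Fin p ↪o Fin n) (J : List (Fin p))
    (x y : realLeaf A I J) : leaf A I J :=
  ⟨cpoint x.1 y.1, by
    rw [mem_interKer]
    refine ⟨Submodule.mem_top, fun j hj => ?_⟩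
    rw [col_cpoint, x.2 j hj, y.2 j hj]
    simp⟩

/-- The form `Γ^I(s, φ) ds₁ ∧ ⋯ ∧ ds_p` on `ℂᵖ`. -/
def mellinForm (A : Matrix (Fin p) (Fin n) ℕ) (I : Fin p ↪o Fin n) (φ : TestForm p n)
    {k : ℕ} (hk : k = p) : Form (⊤ : Submodule ℂ (Fin p → ℂ)) k :=
  fun s => mellinGamma A I φ (s : Fin p → ℂ) •
    ((Matrix.detRowAlternating (n := Fin p) (R := ℂ)).compLinearMap
      (Submodule.subtype ⊤)).domDomCongr (finCongr hk.symm)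

/-- `ρ` is the residue form `res_{L^q}[Γ^I(s, φ) ds]`, a form of degree `m = p - q` on `L^q`,
determined at the points of `L^q` that lie on no other polar hyperplane. -/
def IsMellinResidue (A : Matrix (Fin p) (Fin n) ℕ) (I : Fin p ↪o Fin n) (φ : TestForm p n)
    (J : List (Fin p)) {m : ℕ} (hm : m + J.length = p) (ρ : Form (leaf A I J) m) : Prop :=
  IsCompositeResidue (fun j => col ℂ A (I j)) (polarSet A I J)ᶜ J ⊤ m
    (mellinForm A I φ hm) ρ

/-- The orientation sign of the basis `v` of `i Im L^q`, namely the sign of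
`det(α^{j₁}, …, α^{j_q}, v₁, …, v_m)`. This is the orientation of `i Im L^q` for which
`dλ_{j₁}, …, dλ_{j_q}`, with `λⱼ = ⟨αʲ, s⟩`, followed by a positive frame on `i Im L^q` give the
orientation of `iℝᵖ`. If `m = 0` it is the sign of the point `L^q`. -/
def orientSign (A : Matrix (Fin p) (Fin n) ℕ) (I : Fin p ↪o Fin n) (J : List (Fin p))
    {m : ℕ} (hm : m + J.length = p) (v : Fin m → Fin p → ℝ) : ℝ :=
  Real.sign (Matrix.det (Matrix.of fun i : Fin p =>
    Fin.append (fun a : Fin J.length => fun l : Fin p => (A l (I (J.get a)) : ℝ)) v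
      (Fin.cast ((Nat.add_comm J.length m).trans hm).symm i)))

/-- The pull-back of `∏ Γ(1-s_k) ρ` under `t ↦ γ + i ∑ tₖ vₖ`, as a multiple of
`dt₁ ∧ ⋯ ∧ dt_m`. -/
def leafIntegrand (A : Matrix (Fin p) (Fin n) ℕ) (I : Fin p ↪o Fin n) (J : List (Fin p))
    {m : ℕ} (ρ : Form (leaf A I J) m) (γ : realLeaf A I J) (v : Fin m → realLeaf A I J)
    (t : Fin m → ℝ) : ℂ :=
  (∏ k, Complex.Gamma (1 - (leafPoint A I J γ (∑ a, t a • v a) : Fin p → ℂ) k))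
    * ρ (leafPoint A I J γ (∑ a, t a • v a)) (fun a => leafPoint A I J 0 (v a))

/-- The integral of `∏ Γ(1-s_k) ρ` over the oriented affine space `γ + i Im L^q`, computed in the
linear coordinates given by the basis `v` of `Im L^q`. -/
def leafIntegral (A : Matrix (Fin p) (Fin n) ℕ) (I : Fin p ↪o Fin n) (J : List (Fin p))
    {m : ℕ} (hm : m + J.length = p) (ρ : Form (leaf A I J) m) (γ : realLeaf A I J)
    (v : Fin m → realLeaf A I J) : ℂ :=
  (orientSign A I J hm (fun a => (v a : Fin p → ℝ)) : ℂ)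
    * ∫ t : Fin m → ℝ, leafIntegrand A I J ρ γ v t

end BochnerMartinelli

end

/-! Since the minor is nonzero, the forms `λ_j = ⟨αʲ, s⟩`, `j ∈ I`, are linear coordinates, and `|s|
= ∑ c_j λ_j` with `c_j = sumCoeff A I j`. If some `c_j` were negative, `K₀^I` would span the whole
space; so `q ≥ 1` forces all `c_j ≥ 0`, and then `K₀^I` is the face of the cone on which `λ_j = 0`
whenever `c_j > 0`. Hence `J` is exactly `{j : c_j > 0}` (`IsFaceIndexing.mem_iff`), and `|s| = ∑_{j
∈ J} c_j λ_j` vanishes on `L^q`.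

The continuation of `Γ^I` comes from integration by parts in the variables `ζ̄_k`. The Mellin
integral divided by a product of Gamma functions of the exponents is entire
(`exists_entire_regMellin`), so the poles of `Γ^I` are those of explicit factors `Γ(λ_j)` and
`Γ(⟨αᵏ, s⟩ + 1)`. Multiplication by `∏_{j ∈ J} λ_j` turns `Γ(λ_j)` into `Γ(λ_j + 1)` and yields a
function `mellinReg` that is holomorphic near the tubes in question and bounded over compact sets of
real parts. The factors `Γ(1 - s_k)` supply decay in the imaginary directions.

With `T = -log τ` the integrand becomes `exp(T ∑ c_a λ_a) Φ ∏ λ_a⁻¹`, where `Φ = barnesReg` is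
holomorphic and decays. The limit `T → ∞` (`tendsto_integral_exp_mul`) is found without computing
one residue after another. Where `Re λ > 0`, `exp(Tcλ)/λ` is the integral of `exp(uλ)` over `u ≤
Tc`. Fubini therefore gives the integral of `g(u) = ∫ exp(∑ u_a λ_a) Φ` over the orthant `u_a ≤ T
c_a`. As `Φ` has no poles there, the base point in `g` can be moved: bases at which `Re λ_a` has the
sign opposite to `u_a` give `|g(u)| ≤ C exp(-η ∑ |u_a|)`, hence convergence to the integral of `g`
over `ℝ^q`. At a base on `L^q` the `λ_a` are purely imaginary, and Fourier inversion at the origin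
turns that integral into the integral of `Φ` over `γ^q + i Im L^q`, up to a Jacobian.

On the other side, a form with simple poles has as composite residue its regular factor times the
contraction of `ds` with the basis dual to the `λ_j` (`isCompositeResidue_smul_contract`,
`IsCompositeResidue.eq_smul_contract`). The orientation sign turns the resulting determinant into
the absolute Jacobian (`orientSign_mul_det`), and `Γ(|s| + 1) = 1` on `L^q`. -/

noncomputable section

namespace BochnerMartinelli

/-! ### Analytic dependence of integrals of exponentials -/

/-- An integral of exponentials of continuous linear forms depends analytically on the argument
of these forms. -/
theorem analyticAt_integral_exp {X E : Type*} [MeasurableSpace X] {ν : Measure X}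
    [NormedAddCommGroup E] [NormedSpace ℂ E] {f : X → ℂ} {L : X → E →L[ℂ] ℂ}
    (hf : AEStronglyMeasurable f ν) (hL : AEStronglyMeasurable L ν) {r : ℝ} (hr : 0 < r)
    (hint : Integrable (fun x => ‖f x‖ * Real.exp (r * ‖L x‖)) ν) :
    AnalyticAt ℂ (fun h => ∫ x, f x * Complex.exp (L x h) ∂ν) 0 := by
  -- The degree `k` term of the exponential series, `f(x) (L x)^k / k!`, as a multilinear map; its
  -- integrals over `x` are the coefficients of the power series. Every term is dominated by the
  -- full series `‖f‖ exp(r ‖L‖)`, which gives the radius `r`.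
  set q : ∀ k : ℕ, X → ContinuousMultilinearMap ℂ (fun _ : Fin k => E) ℂ := fun k x =>
    (f x / (k.factorial : ℂ)) • (ContinuousMultilinearMap.mkPiAlgebraFin ℂ k ℂ).compContinuousLinearMap
      (fun _ => L x) with hq
  have hterm : ∀ x (k : ℕ), ‖f x‖ * ((r * ‖L x‖) ^ k / k.factorial)
      ≤ ‖f x‖ * Real.exp (r * ‖L x‖) := fun x k =>
    mul_le_mul_of_nonneg_left (Real.pow_div_factorial_le_exp _ (by positivity) k) (norm_nonneg _)
  have hqn : ∀ k x, ‖q k x‖ * r ^ k ≤ ‖f x‖ * ((r * ‖L x‖) ^ k / k.factorial) := by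
    intro k x
    have h1 : ‖(ContinuousMultilinearMap.mkPiAlgebraFin ℂ k ℂ).compContinuousLinearMap
      (fun _ => L x)‖ ≤ ‖L x‖ ^ k := by
      refine (ContinuousMultilinearMap.norm_compContinuousLinearMap_le _ _).trans ?_
      simp
    rw [hq]
    simp only [norm_smul, norm_div, Complex.norm_natCast]
    rw [mul_pow]
    calc _ ≤ ‖f x‖ / k.factorial * ‖L x‖ ^ k * r ^ k := by gcongr
      _ = _ := by ring
  have hqm : ∀ k, AEStronglyMeasurable (q k) ν := by
    intro k
    refine (hf.mul aestronglyMeasurable_const).smul ?_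
    have hc : Continuous fun l : E →L[ℂ] ℂ =>
        (ContinuousMultilinearMap.mkPiAlgebraFin ℂ k ℂ).compContinuousLinearMap
          (fun _ : Fin k => l) := by
      have := (ContinuousMultilinearMap.compContinuousLinearMapContinuousMultilinear ℂ
        (fun _ : Fin k => E) (fun _ : Fin k => ℂ) ℂ).cont
      exact ((ContinuousLinearMap.apply ℂ _
        (ContinuousMultilinearMap.mkPiAlgebraFin ℂ k ℂ)).continuous.comp this).comp
        (continuous_pi fun _ => continuous_id)
    exact hc.comp_aestronglyMeasurable hL
  have hqi : ∀ k, Integrable (q k) ν := by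
    intro k
    refine (hint.const_mul ((r ^ k)⁻¹)).mono' (hqm k) (.of_forall fun x => ?_)
    rw [← div_eq_inv_mul, le_div_iff₀ (by positivity)]
    exact (hqn k x).trans (hterm x k)
  have happ : ∀ k (y : E), (∫ x, q k x ∂ν) (fun _ => y)
      = ∫ x, f x * ((L x y) ^ k / k.factorial) ∂ν := by
    intro k y
    rw [ContinuousMultilinearMap.integral_apply (hqi k)]
    congr 1
    ext x
    simp [hq]
    ring
  refine ⟨fun k => ∫ x, q k x ∂ν, ENNReal.ofReal r, ?_, by simpa using hr, ?_⟩
  · refine FormalMultilinearSeries.le_radius_of_bound _ (C := ∫ x, ‖f x‖ * Real.exp (r * ‖L x‖) ∂ν)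
      fun k => ?_
    simp only [Real.coe_toNNReal _ hr.le]
    calc ‖∫ x, q k x ∂ν‖ * r ^ k ≤ (∫ x, ‖q k x‖ ∂ν) * r ^ k := by
          gcongr; exact norm_integral_le_integral_norm _
      _ = ∫ x, ‖q k x‖ * r ^ k ∂ν := (integral_mul_const _ _).symm
      _ ≤ _ := integral_mono ((hqi k).norm.mul_const _) hint
          fun x => (hqn k x).trans (hterm x k)
  · intro y hy
    have hy' : ‖y‖ < r := by simpa using hy
    simp only [happ, zero_add]
    refine hasSum_integral_of_dominated_convergence
      (fun k x => ‖f x‖ * ((r * ‖L x‖) ^ k / k.factorial)) ?_ ?_ ?_ ?_ ?_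
    · intro k
      refine hf.mul ((AEStronglyMeasurable.pow ?_ k).mul aestronglyMeasurable_const)
      exact (ContinuousLinearMap.apply ℂ ℂ y).continuous.comp_aestronglyMeasurable hL
    · intro k
      refine .of_forall fun x => ?_
      simp only [norm_mul, norm_div, norm_pow, Complex.norm_natCast]
      have h1 : ‖L x y‖ ≤ r * ‖L x‖ := by
        refine ((L x).le_opNorm y).trans ?_
        rw [mul_comm]
        gcongr
      gcongr
    · exact .of_forall fun x => (Real.summable_pow_div_factorial _).mul_left _
    · convert hint using 2 with x
      rw [tsum_mul_left, Real.exp_eq_exp_ℝ, NormedSpace.exp_eq_tsum_div]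
    · refine .of_forall fun x => ?_
      have := NormedSpace.expSeries_div_hasSum_exp (𝔸 := ℂ) (L x y)
      rw [← Complex.exp_eq_exp_ℂ] at this
      exact this.mul_left _

/-! ### Moving the base of an integral over a tube -/

theorem cpoint_add_smul {p : ℕ} (x y d : Fin p → ℝ) (a b : ℝ) :
    cpoint x y + ((a : ℂ) + b * Complex.I) • (fun k => (d k : ℂ))
      = cpoint (x + a • d) (y + b • d) := by
  ext k
  simp [cpoint]
  ring

theorem continuous_cpoint {p : ℕ} :
    Continuous fun z : (Fin p → ℝ) × (Fin p → ℝ) => cpoint z.1 z.2 := by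
  unfold cpoint
  fun_prop

/-- The integral of a holomorphic function over `x + iℝᵖ` does not depend on `x`. -/
theorem integral_tube_eq {p : ℕ} {F : (Fin p → ℂ) → ℂ} {x d : Fin p → ℝ} {W : (Fin p → ℝ) → ℝ}
    (hW : Integrable W)
    (hF : ∀ σ ∈ Set.Icc (0 : ℝ) 1, ∀ y, DifferentiableAt ℂ F (cpoint (x + σ • d) y))
    (hb : ∀ σ ∈ Set.Icc (0 : ℝ) 1, ∀ y, ‖F (cpoint (x + σ • d) y)‖ ≤ W y) :
    ∫ y, F (cpoint (x + d) y) = ∫ y, F (cpoint x y) := by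
  -- The four sides of a unit square in the complex direction `d` are `x + σ(t) d + i (y + θ(t) d)`
  -- with `(σ, θ) = (t, 0), (t, 1), (1, t), (0, t)`; general `σ`, `θ` treat them together.
  have hcont : ∀ θ : ℝ → ℝ, Continuous θ → ∀ σ : ℝ → ℝ, Continuous σ →
      (∀ t ∈ Set.Icc (0 : ℝ) 1, σ t ∈ Set.Icc (0 : ℝ) 1) →
      ContinuousOn (fun z : (Fin p → ℝ) × ℝ => F (cpoint (x + σ z.2 • d) (z.1 + θ z.2 • d)))
      (Set.univ ×ˢ Set.Icc 0 1) := by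
    intro θ hθ σ hσ hσ' z hz
    have h1 := (hF (σ z.2) (hσ' _ hz.2) (z.1 + θ z.2 • d)).continuousAt
    have h2 : Continuous fun z : (Fin p → ℝ) × ℝ =>
        cpoint (x + σ z.2 • d) (z.1 + θ z.2 • d) :=
      continuous_cpoint.comp (by fun_prop : Continuous fun z : (Fin p → ℝ) × ℝ =>
        (x + σ z.2 • d, z.1 + θ z.2 • d))
    exact (ContinuousAt.comp (f := fun z : (Fin p → ℝ) × ℝ =>
        cpoint (x + σ z.2 • d) (z.1 + θ z.2 • d)) h1 h2.continuousAt).continuousWithinAt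
  have hmeas1 : ∀ σ ∈ Set.Icc (0 : ℝ) 1,
      AEStronglyMeasurable (fun y => F (cpoint (x + σ • d) y)) volume := by
    intro σ hσ
    refine Continuous.aestronglyMeasurable (continuous_iff_continuousAt.2 fun y => ?_)
    exact ContinuousAt.comp (f := fun y => cpoint (x + σ • d) y) (hF σ hσ y).continuousAt
      (continuous_cpoint.comp (by fun_prop : Continuous fun y : Fin p → ℝ =>
        (x + σ • d, y))).continuousAt
  have hi1 : ∀ σ ∈ Set.Icc (0 : ℝ) 1, Integrable (fun y => F (cpoint (x + σ • d) y)) :=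
    fun σ hσ => hW.mono' (hmeas1 σ hσ) (.of_forall (hb σ hσ))
  have hint : ∀ θ : ℝ → ℝ, Continuous θ → ∀ σ : ℝ → ℝ, Continuous σ →
      (∀ t ∈ Set.Icc (0 : ℝ) 1, σ t ∈ Set.Icc (0 : ℝ) 1) →
      Integrable (Function.uncurry fun (y : Fin p → ℝ) (t : ℝ) =>
        F (cpoint (x + σ t • d) (y + θ t • d)))
        (volume.prod (volume.restrict (Set.Ioc 0 1))) := by
    intro θ hθ σ hσ hσ'
    have hm : AEStronglyMeasurable (Function.uncurry fun (y : Fin p → ℝ) (t : ℝ) =>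
        F (cpoint (x + σ t • d) (y + θ t • d)))
        (volume.prod (volume.restrict (Set.Ioc 0 1))) := by
      have h1 : (volume : Measure (Fin p → ℝ)).prod (volume.restrict (Set.Ioc (0 : ℝ) 1))
          = (volume.prod volume).restrict (Set.univ ×ˢ Set.Ioc 0 1) := by
        rw [← Measure.prod_restrict, Measure.restrict_univ]
      rw [h1]
      exact ((hcont θ hθ σ hσ hσ').mono (Set.prod_mono_right Set.Ioc_subset_Icc_self)).aestronglyMeasurable
        (MeasurableSet.univ.prod measurableSet_Ioc)
    rw [integrable_prod_iff' hm]
    have hsub : ∀ᵐ t ∂(volume.restrict (Set.Ioc (0 : ℝ) 1)), t ∈ Set.Icc (0 : ℝ) 1 := by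
      filter_upwards [ae_restrict_mem measurableSet_Ioc] with t ht using ⟨ht.1.le, ht.2⟩
    refine ⟨?_, ?_⟩
    · filter_upwards [hsub] with t ht
      exact (hi1 (σ t) (hσ' t ht)).comp_add_right (θ t • d)
    · refine (integrable_const (∫ y, W y)).mono' hm.norm.prod_swap.integral_prod_right' ?_
      filter_upwards [hsub] with t ht
      rw [Real.norm_of_nonneg (integral_nonneg fun _ => norm_nonneg _)]
      simp only [Function.uncurry_apply_pair]
      rw [integral_add_right_eq_self (fun y => ‖F (cpoint (x + σ t • d) y)‖) (θ t • d)]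
      exact integral_mono (hi1 (σ t) (hσ' t ht)).norm hW (hb _ (hσ' t ht))
  have hswap : ∀ θ : ℝ → ℝ, Continuous θ → ∀ σ : ℝ → ℝ, Continuous σ →
      (∀ t ∈ Set.Icc (0 : ℝ) 1, σ t ∈ Set.Icc (0 : ℝ) 1) →
      Integrable (fun y => ∫ t in (0 : ℝ)..1, F (cpoint (x + σ t • d) (y + θ t • d))) ∧
      ∫ y, ∫ t in (0 : ℝ)..1, F (cpoint (x + σ t • d) (y + θ t • d))
        = ∫ t in (0 : ℝ)..1, ∫ y, F (cpoint (x + σ t • d) y) := by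
    intro θ hθ σ hσ hσ'
    simp only [intervalIntegral.integral_of_le zero_le_one]
    refine ⟨(hint θ hθ σ hσ hσ').integral_prod_left, ?_⟩
    rw [integral_integral_swap (hint θ hθ σ hσ hσ')]
    congr 1
    ext t
    exact integral_add_right_eq_self (fun y => F (cpoint (x + σ t • d) y)) (θ t • d)
  -- Cauchy's theorem on the square, for each fixed `y`. After integration over all `y`, the two
  -- horizontal sides cancel by translation invariance and the vertical sides give the two tube
  -- integrals; no truncation and no limit of rectangles is needed.
  have hrect : ∀ y, (∫ t in (0 : ℝ)..1, F (cpoint (x + t • d) (y + (0 : ℝ) • d)))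
      - (∫ t in (0 : ℝ)..1, F (cpoint (x + t • d) (y + (1 : ℝ) • d)))
      + Complex.I • (∫ t in (0 : ℝ)..1, F (cpoint (x + (1 : ℝ) • d) (y + t • d)))
      - Complex.I • (∫ t in (0 : ℝ)..1, F (cpoint (x + (0 : ℝ) • d) (y + t • d))) = 0 := by
    intro y
    have key := Complex.integral_boundary_rect_eq_zero_of_differentiableOn
      (fun z => F (cpoint x y + z • (fun k => (d k : ℂ)))) 0 (1 + Complex.I) ?_
    · simp only [Complex.zero_re, Complex.zero_im, Complex.add_re, Complex.one_re, Complex.I_re,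
        add_zero, Complex.add_im, Complex.one_im, Complex.I_im, zero_add] at key
      simp only [cpoint_add_smul] at key
      exact key
    · intro z hz
      have hz1 : z.re ∈ Set.Icc (0 : ℝ) 1 := by
        have := hz.1
        simpa [Set.uIcc_of_le] using this
      have h1 := hF z.re hz1 (y + z.im • d)
      rw [← cpoint_add_smul, Complex.re_add_im] at h1
      have h2 : DifferentiableAt ℂ (fun z : ℂ => cpoint x y + z • (fun k => (d k : ℂ))) z := by
        fun_prop
      exact (DifferentiableAt.comp z (g := F) h1 h2).differentiableWithinAt
  have h01 : (0 : ℝ) ∈ Set.Icc (0 : ℝ) 1 := by simp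
  have h11 : (1 : ℝ) ∈ Set.Icc (0 : ℝ) 1 := by simp
  obtain ⟨a1, b1⟩ := hswap (fun _ => 0) continuous_const id continuous_id (fun t ht => ht)
  obtain ⟨a2, b2⟩ := hswap (fun _ => 1) continuous_const id continuous_id (fun t ht => ht)
  obtain ⟨a3, b3⟩ := hswap id continuous_id (fun _ => 1) continuous_const (fun t ht => h11)
  obtain ⟨a4, b4⟩ := hswap id continuous_id (fun _ => 0) continuous_const (fun t ht => h01)
  simp only [id] at a1 b1 a2 b2 a3 b3 a4 b4
  have hsum := integral_sub' ((a1.sub a2).add (a3.smul Complex.I)) (a4.smul Complex.I)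
  rw [integral_add' (a1.sub a2) (a3.smul Complex.I), integral_sub' a1 a2] at hsum
  simp only [Pi.sub_apply, Pi.add_apply, Pi.smul_apply] at hsum
  rw [integral_congr_ae (.of_forall hrect), integral_smul, integral_smul, b1, b2, b3, b4,
    integral_zero, eq_comm] at hsum
  simp only [sub_self, zero_add, intervalIntegral.integral_const, sub_zero, one_smul, zero_smul,
    add_zero, smul_eq_mul, ← mul_sub] at hsum
  exact sub_eq_zero.1 ((mul_eq_zero.1 hsum).resolve_left Complex.I_ne_zero)

/-! ### Fourier inversion and linear coordinates -/

/-- Fourier inversion at the origin of `ℝ^q`. -/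
theorem integral_integral_exp_mul {q : ℕ} {h : (Fin q → ℝ) → ℂ} (hh : Integrable h)
    (hc : ContinuousAt h 0)
    (hg : Integrable fun u : Fin q → ℝ =>
      ∫ r : Fin q → ℝ, Complex.exp (Complex.I * ((∑ a, u a * r a : ℝ) : ℂ)) * h r) :
    ∫ u : Fin q → ℝ, ∫ r : Fin q → ℝ, Complex.exp (Complex.I * ((∑ a, u a * r a : ℝ) : ℂ)) * h r
      = (2 * Real.pi) ^ q * h 0 := by
  set g : (Fin q → ℝ) → ℂ := fun u =>
    ∫ r : Fin q → ℝ, Complex.exp (Complex.I * ((∑ a, u a * r a : ℝ) : ℂ)) * h r with hgdef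
  set f : EuclideanSpace ℝ (Fin q) → ℂ := fun z => h (WithLp.ofLp z) with hfdef
  have hmp := PiLp.volume_preserving_ofLp (Fin q)
  have hme : MeasurableEmbedding (@WithLp.ofLp 2 (Fin q → ℝ)) :=
    (MeasurableEquiv.toLp 2 (Fin q → ℝ)).symm.measurableEmbedding
  -- The library kernel is `exp(-2πi⟨z, ξ⟩)`, hence `u = -2πξ`; this substitution is the source of
  -- the factor `(2π)^q`.
  have hFf : ∀ ξ, FourierTransform.fourier f ξ = g ((-(2 * Real.pi)) • WithLp.ofLp ξ) := by
    intro ξ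
    rw [Real.fourier_eq', hgdef]
    simp only
    rw [← hmp.integral_comp hme]
    congr 1
    ext z
    rw [hfdef, smul_eq_mul]
    congr 2
    rw [mul_comm]
    congr 2
    simp only [PiLp.inner_apply, Pi.smul_apply, Finset.mul_sum]
    refine Finset.sum_congr rfl fun a _ => ?_
    simp
    ring
  have hpi : (-(2 * Real.pi)) ≠ 0 := neg_ne_zero.2 (by positivity)
  have hf : Integrable f := (hmp.integrable_comp_emb hme).2 hh
  have hF : Integrable (FourierTransform.fourier f) := by
    rw [funext hFf]
    exact (hmp.integrable_comp_emb hme).2 (hg.comp_smul hpi)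
  have hcf : ContinuousAt f 0 := by
    refine ContinuousAt.comp (f := fun z : EuclideanSpace ℝ (Fin q) => WithLp.ofLp z) ?_ ?_
    · exact hc
    · exact (PiLp.continuous_ofLp 2 _).continuousAt
  have hinv := hf.fourierInv_fourier_eq hF hcf
  rw [Real.fourierInv_eq'] at hinv
  simp only [inner_zero_right, mul_zero, Complex.ofReal_zero, zero_mul, Complex.exp_zero,
    one_smul, hFf] at hinv
  rw [hmp.integral_comp hme (fun u => g ((-(2 * Real.pi)) • u)),
    Measure.integral_comp_smul] at hinv
  have hf0 : f 0 = h 0 := rfl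
  rw [hf0] at hinv
  rw [← hinv]
  simp only [Module.finrank_fin_fun, abs_inv, abs_pow, abs_neg, Complex.real_smul]
  rw [abs_of_pos (by positivity : 0 < 2 * Real.pi), ← mul_assoc]
  have : ((2 * Real.pi) ^ q * (((2 * Real.pi) ^ q)⁻¹ : ℝ) : ℂ) = 1 := by
    push_cast
    exact mul_inv_cancel₀ (pow_ne_zero _ (by norm_cast; positivity))
  rw [this, one_mul]

theorem measurePreserving_append (q m : ℕ) :
    MeasurePreserving (fun z : (Fin q → ℝ) × (Fin m → ℝ) => Fin.append z.1 z.2)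
      volume volume := by
  have h1 := volume_measurePreserving_sumPiEquivProdPi_symm (fun _ : Fin q ⊕ Fin m => ℝ)
  have h2 := volume_measurePreserving_piCongrLeft (fun _ : Fin (q + m) => ℝ) finSumFinEquiv
  convert h2.comp h1 using 1
  ext z i
  refine Fin.addCases (fun i => ?_) (fun i => ?_) i
  · rw [Fin.append_left]
    have := Equiv.piCongrLeft_sumInl (fun _ => ℝ) finSumFinEquiv z.1 z.2 i
    exact this.symm
  · rw [Fin.append_right]
    have := Equiv.piCongrLeft_sumInr (fun _ => ℝ) finSumFinEquiv z.1 z.2 i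
    exact this.symm

theorem measurableEmbedding_append (q m : ℕ) :
    MeasurableEmbedding (fun z : (Fin q → ℝ) × (Fin m → ℝ) => Fin.append z.1 z.2) := by
  have h := ((MeasurableEquiv.sumPiEquivProdPi (fun _ : Fin q ⊕ Fin m => ℝ)).symm.trans
    (MeasurableEquiv.piCongrLeft (fun _ : Fin (q + m) => ℝ) finSumFinEquiv)).measurableEmbedding
  convert h using 1
  ext z i
  refine Fin.addCases (fun i => ?_) (fun i => ?_) i
  · rw [Fin.append_left]
    have := Equiv.piCongrLeft_sumInl (fun _ => ℝ) finSumFinEquiv z.1 z.2 i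
    exact this.symm
  · rw [Fin.append_right]
    have := Equiv.piCongrLeft_sumInr (fun _ => ℝ) finSumFinEquiv z.1 z.2 i
    exact this.symm

/-- The linear coordinates `(r, t) ↦ ∑ r_a w_a + ∑ t_b v_b` on `ℝᵖ`. -/
def frameMap {p q m : ℕ} (w : Fin q → Fin p → ℝ) (v : Fin m → Fin p → ℝ)
    (z : (Fin q → ℝ) × (Fin m → ℝ)) : Fin p → ℝ :=
  ∑ a, z.1 a • w a + ∑ b, z.2 b • v b

/-- The matrix with the rows `w₁, …, w_q, v₁, …, v_m`. -/
def frameMatrix {R : Type*} {p q m : ℕ} (hp : q + m = p) (w : Fin q → Fin p → R)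
    (v : Fin m → Fin p → R) : Matrix (Fin p) (Fin p) R :=
  Matrix.of fun i => Fin.append w v (Fin.cast hp.symm i)

theorem frameMap_eq {q m : ℕ} (w : Fin q → Fin (q + m) → ℝ) (v : Fin m → Fin (q + m) → ℝ)
    (z : (Fin q → ℝ) × (Fin m → ℝ)) :
    frameMap w v z = Matrix.toLin' (frameMatrix rfl w v).transpose (Fin.append z.1 z.2) := by
  ext k
  simp only [frameMap, frameMatrix, Matrix.toLin'_apply, Matrix.mulVec, dotProduct,
    Matrix.transpose_apply, Matrix.of_apply, Fin.sum_univ_add, Fin.append_left, Fin.append_right,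
    Pi.add_apply, Finset.sum_apply, Pi.smul_apply, smul_eq_mul, Fin.cast_eq_self]
  congr 1 <;> exact Finset.sum_congr rfl fun _ _ => mul_comm _ _

theorem measurableEmbedding_frameMap {p q m : ℕ} (hp : q + m = p) {w : Fin q → Fin p → ℝ}
    {v : Fin m → Fin p → ℝ} (hdet : (frameMatrix hp w v).det ≠ 0) :
    MeasurableEmbedding (frameMap w v) := by
  subst hp
  have hd : (frameMatrix rfl w v).transpose.det ≠ 0 := by rwa [Matrix.det_transpose]
  have hinv : Function.Injective (Matrix.toLin' (frameMatrix rfl w v).transpose) := by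
    intro x y hxy
    rw [Matrix.toLin'_apply, Matrix.toLin'_apply] at hxy
    exact Matrix.mulVec_injective_iff_isUnit.2
      ((Matrix.isUnit_iff_isUnit_det _).2 (isUnit_iff_ne_zero.2 hd)) hxy
  have h1 : MeasurableEmbedding (Matrix.toLin' (frameMatrix rfl w v).transpose) :=
    (LinearMap.continuous_of_finiteDimensional _).measurableEmbedding hinv
  have := h1.comp (measurableEmbedding_append q m)
  convert this using 1
  ext1 z
  exact frameMap_eq w v z

theorem map_frameMap {p q m : ℕ} (hp : q + m = p) {w : Fin q → Fin p → ℝ}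
    {v : Fin m → Fin p → ℝ} (hdet : (frameMatrix hp w v).det ≠ 0) :
    Measure.map (frameMap w v) volume
      = ENNReal.ofReal |(frameMatrix hp w v).det|⁻¹ • volume := by
  subst hp
  have hd : (frameMatrix rfl w v).transpose.det ≠ 0 := by rwa [Matrix.det_transpose]
  have h1 := Real.map_matrix_volume_pi_eq_smul_volume_pi hd
  rw [Matrix.det_transpose, abs_inv] at h1
  rw [← h1, ← (measurePreserving_append q m).map_eq, Measure.map_map
    (LinearMap.continuous_of_finiteDimensional _).measurable
    (measurePreserving_append q m).measurable]
  congr 1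
  ext1 z
  exact frameMap_eq w v z

theorem integral_frameMap {p q m : ℕ} (hp : q + m = p) {w : Fin q → Fin p → ℝ}
    {v : Fin m → Fin p → ℝ} (hdet : (frameMatrix hp w v).det ≠ 0) (f : (Fin p → ℝ) → ℂ) :
    ∫ y, f y = |(frameMatrix hp w v).det| * ∫ z, f (frameMap w v z) := by
  rw [← (measurableEmbedding_frameMap hp hdet).integral_map, map_frameMap hp hdet,
    integral_smul_measure, ENNReal.toReal_ofReal (by positivity), Complex.real_smul, ← mul_assoc,
    ← Complex.ofReal_mul, mul_inv_cancel₀ (abs_ne_zero.2 hdet)]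
  simp

theorem integrable_comp_frameMap {p q m : ℕ} (hp : q + m = p) {w : Fin q → Fin p → ℝ}
    {v : Fin m → Fin p → ℝ} (hdet : (frameMatrix hp w v).det ≠ 0) {f : (Fin p → ℝ) → ℂ}
    (hf : Integrable f) : Integrable fun z => f (frameMap w v z) := by
  refine (measurableEmbedding_frameMap hp hdet).integrable_map_iff.1 ?_
  rw [map_frameMap hp hdet]
  exact hf.smul_measure ENNReal.ofReal_ne_top

/-- The integrable majorant `(1 + ‖y‖)^(-p-1)` on `ℝᵖ`. -/
def decay {p : ℕ} (y : Fin p → ℝ) : ℝ := (1 + ‖y‖) ^ (-((p : ℝ) + 1))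

theorem decay_nonneg {p : ℕ} (y : Fin p → ℝ) : 0 ≤ decay y := by
  unfold decay
  positivity

theorem integrable_decay {p : ℕ} : Integrable (decay (p := p)) :=
  integrable_one_add_norm (by simp)

/-- An injective linear map between finite-dimensional spaces is antilipschitz, so `‖z.2‖ ≤ K
‖frameMap w v z‖`, and the power `-(p + 1)` is integrable over `ℝ^m` because `m ≤ p`. The majorant
does not involve the first `q` coordinates, which makes slice integrals continuous in them. -/
theorem exists_decay_frameMap_le {p q m : ℕ} (hp : q + m = p) {w : Fin q → Fin p → ℝ}
    {v : Fin m → Fin p → ℝ} (hdet : (frameMatrix hp w v).det ≠ 0) :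
    ∃ B : (Fin m → ℝ) → ℝ, Integrable B ∧ ∀ z, decay (frameMap w v z) ≤ B z.2 := by
  let e : ((Fin q → ℝ) × (Fin m → ℝ)) →ₗ[ℝ] (Fin p → ℝ) :=
    { toFun := frameMap w v
      map_add' := fun x y => by
        simp only [frameMap, Prod.fst_add, Prod.snd_add, Pi.add_apply, add_smul,
          Finset.sum_add_distrib]
        abel
      map_smul' := fun c x => by
        simp only [frameMap, Prod.smul_fst, Prod.smul_snd, Pi.smul_apply, smul_assoc, smul_add,
          Finset.smul_sum, RingHom.id_apply] }
  obtain ⟨K, hK, hKe⟩ := e.exists_antilipschitzWith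
    (LinearMap.ker_eq_bot.2 (measurableEmbedding_frameMap hp hdet).injective)
  have hle : ∀ z, ‖z.2‖ ≤ K * ‖frameMap w v z‖ := by
    intro z
    have h1 := hKe.le_mul_dist z 0
    simp only [map_zero, dist_zero_right] at h1
    exact (norm_snd_le z).trans h1
  have hK1 : (0 : ℝ) < 1 + K := by positivity
  refine ⟨fun t => ((1 + K : ℝ)⁻¹) ^ (-((p : ℝ) + 1)) * (1 + ‖t‖) ^ (-((p : ℝ) + 1)),
    (integrable_one_add_norm ?_).const_mul _, fun z => ?_⟩
  · rw [Module.finrank_fin_fun, ← hp]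
    push_cast
    linarith [(Nat.cast_nonneg q : (0 : ℝ) ≤ q)]
  · simp only [decay]
    rw [← Real.mul_rpow (by positivity) (by positivity)]
    refine Real.rpow_le_rpow_of_nonpos (by positivity) ?_ (by linarith [(Nat.cast_nonneg p : (0 : ℝ) ≤ p)])
    rw [inv_mul_le_iff₀ hK1]
    nlinarith [hle z, norm_nonneg (frameMap w v z), K.coe_nonneg]

/-- In the coordinates `(r, t)` of the frame, `l a` is the coordinate `r_a`. The inner integral is
thus, up to the Jacobian, a Fourier integral of `h(r) = ∫ H(r, t) dt`, and inversion at the origin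
returns `h(0)`, the integral of `H` over the common kernel of the `l a`. -/
theorem integral_fourier_slice {p q m : ℕ} (hp : q + m = p) {l : Fin q → (Fin p → ℝ) →ₗ[ℝ] ℝ}
    {w : Fin q → Fin p → ℝ} {v : Fin m → Fin p → ℝ}
    (hdet : (frameMatrix hp w v).det ≠ 0)
    (hlw : ∀ a b, l a (w b) = if a = b then 1 else 0) (hlv : ∀ a b, l a (v b) = 0)
    {H : (Fin p → ℝ) → ℂ} (hH : Continuous H) {C : ℝ} (hb : ∀ y, ‖H y‖ ≤ C * decay y)
    (hg : Integrable fun u : Fin q → ℝ =>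
      ∫ y, Complex.exp (Complex.I * ((∑ a, u a * l a y : ℝ) : ℂ)) * H y) :
    (Integrable fun t : Fin m → ℝ => H (∑ b, t b • v b)) ∧
    ∫ u : Fin q → ℝ, ∫ y, Complex.exp (Complex.I * ((∑ a, u a * l a y : ℝ) : ℂ)) * H y
      = (2 * Real.pi) ^ q * (|(frameMatrix hp w v).det| *
          ∫ t : Fin m → ℝ, H (∑ b, t b • v b)) := by
  obtain ⟨B, hB, hdB⟩ := exists_decay_frameMap_le hp hdet
  have hC : 0 ≤ C := by
    have h0 := (norm_nonneg _).trans (hb 0)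
    have : decay (0 : Fin p → ℝ) = 1 := by simp [decay]
    rwa [this, mul_one] at h0
  have hHi : Integrable H :=
    (integrable_decay.const_mul C).mono' hH.aestronglyMeasurable (.of_forall hb)
  have hfc : Continuous (frameMap w v) := by unfold frameMap; fun_prop
  have hbz : ∀ z, ‖H (frameMap w v z)‖ ≤ C * B z.2 := fun z =>
    (hb _).trans (mul_le_mul_of_nonneg_left (hdB z) hC)
  have hslice : ∀ r, Integrable fun t => H (frameMap w v (r, t)) := fun r =>
    (hB.const_mul C).mono' (hH.comp (hfc.comp (by fun_prop))).aestronglyMeasurable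
      (.of_forall fun t => hbz (r, t))
  set h : (Fin q → ℝ) → ℂ := fun r => ∫ t, H (frameMap w v (r, t)) with hh
  have hprod := integrable_comp_frameMap hp hdet hHi
  have hhi : Integrable h := Integrable.integral_prod_left hprod
  have hhc : Continuous h := by
    refine continuous_of_dominated (bound := fun t => C * B t) (fun r => (hslice r).aestronglyMeasurable)
      (fun r => .of_forall fun t => hbz (r, t)) (hB.const_mul C) (.of_forall fun t => ?_)
    exact hH.comp (hfc.comp (by fun_prop))
  have hl : ∀ a z, l a (frameMap w v z) = z.1 a := by
    intro a z
    simp [frameMap, map_add, map_sum, hlw, hlv]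
  have hgu : ∀ u : Fin q → ℝ, ∫ y, Complex.exp (Complex.I * ((∑ a, u a * l a y : ℝ) : ℂ)) * H y
      = |(frameMatrix hp w v).det| *
        ∫ r : Fin q → ℝ, Complex.exp (Complex.I * ((∑ a, u a * r a : ℝ) : ℂ)) * h r := by
    intro u
    rw [integral_frameMap hp hdet]
    congr 1
    simp only [hl]
    have hi : Integrable (fun z : (Fin q → ℝ) × (Fin m → ℝ) =>
        Complex.exp (Complex.I * ((∑ a, u a * z.1 a : ℝ) : ℂ)) * H (frameMap w v z))
        (volume.prod volume) := by
      refine Integrable.bdd_mul (c := 1) hprod ?_ ?_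
      · exact Continuous.aestronglyMeasurable (by fun_prop)
      · refine .of_forall fun z => ?_
        rw [mul_comm, Complex.norm_exp_ofReal_mul_I]
    rw [Measure.volume_eq_prod, integral_prod _ hi]
    congr 1
    ext r
    simp only [hh, ← integral_const_mul]
  have h0 : ∀ t, frameMap w v (0, t) = ∑ b, t b • v b := fun t => by simp [frameMap]
  refine ⟨by simpa only [h0] using hslice 0, ?_⟩
  have hdetC : ((|(frameMatrix hp w v).det| : ℝ) : ℂ) ≠ 0 := by
    simpa using hdet
  simp only [hgu] at hg ⊢
  rw [integral_const_mul, integral_integral_exp_mul hhi hhc.continuousAt]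
  · rw [hh]
    simp only [h0]
    ring
  · have := hg.const_mul ((|(frameMatrix hp w v).det| : ℝ) : ℂ)⁻¹
    simpa only [inv_mul_cancel_left₀ hdetC] using this

/-! ### Asymptotics of a Barnes integral with simple polar factors -/

section

/-- This is how the polar factors are removed: `exp(zc)/z` is the integral of `exp(zt)` over `t ≤ c`
when `Re z > 0`. -/
theorem integral_prod_indicator_exp {q : ℕ} {z : Fin q → ℂ} (hz : ∀ a, 0 < (z a).re)
    (c : Fin q → ℝ) :
    ∫ u : Fin q → ℝ, ∏ a, (Set.Iic (c a)).indicator (fun t : ℝ => Complex.exp (z a * t)) (u a)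
      = ∏ a, Complex.exp (z a * c a) / z a := by
  rw [integral_fintype_prod_volume_eq_prod (𝕜 := ℂ)
    (fun a => (Set.Iic (c a)).indicator (fun t : ℝ => Complex.exp (z a * t)))]
  refine Finset.prod_congr rfl fun a _ => ?_
  rw [integral_indicator measurableSet_Iic, integral_exp_mul_complex_Iic (hz a)]

theorem integrable_exp_neg_mul_abs {η : ℝ} (hη : 0 < η) :
    Integrable fun t : ℝ => Real.exp (-(η * |t|)) := by
  rw [← integrableOn_univ, ← Set.Iic_union_Ioi (a := (0 : ℝ)), integrableOn_union]
  constructor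
  · refine (integrableOn_exp_mul_Iic hη 0).congr_fun (fun t ht => ?_) measurableSet_Iic
    simp only
    rw [abs_of_nonpos ht]
    ring_nf
  · refine (integrableOn_exp_mul_Ioi (a := -η) (by linarith) 0).congr_fun (fun t ht => ?_)
      measurableSet_Ioi
    simp only
    rw [abs_of_pos ht]
    ring_nf

variable {p q m : ℕ}

theorem continuous_tube {Φ : (Fin p → ℂ) → ℂ} {x : Fin p → ℝ}
    (hd : ∀ y, DifferentiableAt ℂ Φ (cpoint x y)) : Continuous fun y => Φ (cpoint x y) :=
  continuous_iff_continuousAt.2 fun y =>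
    ContinuousAt.comp (f := fun y => cpoint x y) (hd y).continuousAt
      (continuous_cpoint.comp (by fun_prop : Continuous fun y : Fin p → ℝ => (x, y))).continuousAt

/-- The asymptotics of a Barnes integral: `lim_{T → ∞} ∫ e^{T ∑ c_a λ_a} Φ ∏ λ_a⁻¹` over
`γ + iℝᵖ` is an integral of `Φ` over the common zeros of the `λ_a`. -/
theorem tendsto_integral_exp_mul (hp : q + m = p) {l : Fin q → (Fin p → ℝ) →ₗ[ℝ] ℝ}
    {lc : Fin q → (Fin p → ℂ) →ₗ[ℂ] ℂ}
    (hlc : ∀ a x y, lc a (cpoint x y) = (l a x : ℂ) + Complex.I * (l a y : ℂ))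
    {w : Fin q → Fin p → ℝ} {v : Fin m → Fin p → ℝ}
    (hdet : (frameMatrix hp w v).det ≠ 0)
    (hlw : ∀ a b, l a (w b) = if a = b then 1 else 0) (hlv : ∀ a b, l a (v b) = 0)
    {c : Fin q → ℝ} (hc : ∀ a, 0 < c a) {Φ : (Fin p → ℂ) → ℂ} {K : Set (Fin p → ℝ)}
    (hK : Convex ℝ K) {C : ℝ} (hd : ∀ x ∈ K, ∀ y, DifferentiableAt ℂ Φ (cpoint x y))
    (hb : ∀ x ∈ K, ∀ y, ‖Φ (cpoint x y)‖ ≤ C * decay y)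
    {γ x₀ : Fin p → ℝ} (hγ : γ ∈ K) (hγl : ∀ a, 0 < l a γ) (hx₀ : ∀ a, l a x₀ = 0)
    {η : ℝ} (hη : 0 < η) (hbox : ∀ ε : Fin q → ℝ, (∀ a, |ε a| ≤ η) → x₀ + ∑ a, ε a • w a ∈ K) :
    (∀ T : ℝ, Integrable fun y => Complex.exp (T * ∑ a, c a * lc a (cpoint γ y))
        * Φ (cpoint γ y) * ∏ a, (lc a (cpoint γ y))⁻¹) ∧
    (Integrable fun t : Fin m → ℝ => Φ (cpoint x₀ (∑ b, t b • v b))) ∧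
    Tendsto (fun T : ℝ => ∫ y, Complex.exp (T * ∑ a, c a * lc a (cpoint γ y))
        * Φ (cpoint γ y) * ∏ a, (lc a (cpoint γ y))⁻¹) atTop
      (𝓝 ((2 * Real.pi) ^ q * (|(frameMatrix hp w v).det| *
          ∫ t : Fin m → ℝ, Φ (cpoint x₀ (∑ b, t b • v b))))) := by
  have hx₀K : x₀ ∈ K := by simpa using hbox 0 (by simp [hη.le])
  have hre : ∀ a x y, (lc a (cpoint x y)).re = l a x := by
    intro a x y
    rw [hlc]
    simp
  have hlcc : ∀ a, Continuous (lc a) := fun a => LinearMap.continuous_of_finiteDimensional _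
  have hlcd : ∀ a, Differentiable ℂ (lc a) := fun a =>
    (LinearMap.toContinuousLinearMap (lc a)).differentiable
  have hcp : ∀ x : Fin p → ℝ, Continuous fun y => cpoint x y := fun x =>
    continuous_cpoint.comp (by fun_prop : Continuous fun y : Fin p → ℝ => (x, y))
  have hΦi : ∀ x ∈ K, Integrable fun y => Φ (cpoint x y) := fun x hx =>
    (integrable_decay.const_mul C).mono' (continuous_tube (hd x hx)).aestronglyMeasurable
      (.of_forall (hb x hx))
  have hexpnorm : ∀ (u : Fin q → ℝ) x y, ‖Complex.exp (∑ a, u a * lc a (cpoint x y))‖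
      = Real.exp (∑ a, u a * l a x) := by
    intro u x y
    rw [Complex.norm_exp, Complex.re_sum]
    congr 1
    exact Finset.sum_congr rfl fun a _ => by rw [Complex.re_ofReal_mul, hre]
  -- The integrand of `g` has lost the factors `λ_a⁻¹`, so it is holomorphic over all of `K`, on
  -- both sides of the hyperplanes `λ_a = 0`.
  set g : (Fin q → ℝ) → ℂ := fun u =>
    ∫ y, Complex.exp (∑ a, u a * lc a (cpoint γ y)) * Φ (cpoint γ y) with hg
  have hgx : ∀ x ∈ K, ∀ u, g u = ∫ y, Complex.exp (∑ a, u a * lc a (cpoint x y)) * Φ (cpoint x y) := by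
    intro x hx u
    have hseg : ∀ σ ∈ Set.Icc (0 : ℝ) 1, γ + σ • (x - γ) ∈ K := by
      intro σ hσ
      exact hK.add_smul_sub_mem hγ hx hσ
    have hshift := integral_tube_eq (F := fun s => Complex.exp (∑ a, u a * lc a s) * Φ s)
      (x := γ) (d := x - γ)
      (W := fun y => Real.exp (|∑ a, u a * l a γ| + |∑ a, u a * l a (x - γ)|) * (C * decay y))
      ((integrable_decay.const_mul C).const_mul _) ?_ ?_
    · rw [add_sub_cancel] at hshift
      exact hshift.symm
    · intro σ hσ y
      refine DifferentiableAt.mul ?_ (hd _ (hseg σ hσ) y)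
      refine DifferentiableAt.cexp (DifferentiableAt.fun_sum fun a _ => ?_)
      exact (hlcd a).differentiableAt.const_mul _
    · intro σ hσ y
      rw [norm_mul, hexpnorm]
      refine mul_le_mul ?_ (hb _ (hseg σ hσ) y) (norm_nonneg _) (Real.exp_nonneg _)
      refine Real.exp_le_exp.2 ?_
      simp only [map_add, map_smul, smul_eq_mul, mul_add, Finset.sum_add_distrib]
      refine add_le_add (le_abs_self _) ?_
      have : ∑ a, u a * (σ * l a (x - γ)) = σ * ∑ a, u a * l a (x - γ) := by
        rw [Finset.mul_sum]
        exact Finset.sum_congr rfl fun a _ => by ring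
      rw [this]
      refine (le_abs_self _).trans ?_
      rw [abs_mul, abs_of_nonneg hσ.1]
      exact mul_le_of_le_one_left (abs_nonneg _) hσ.2
  have hgb : ∀ u, ‖g u‖ ≤ (∏ a, Real.exp (-(η * |u a|))) * ∫ y : Fin p → ℝ, C * decay y := by
    intro u
    -- A base with `l a x = -η sign(u_a)`: there the exponential has modulus `exp(-η ∑ |u_a|)`.
    set x := x₀ + ∑ a, (-(η * SignType.sign (u a))) • w a with hx
    have hxK : x ∈ K := by
      refine hbox _ fun a => ?_
      rw [abs_neg, abs_mul, abs_of_pos hη]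
      refine mul_le_of_le_one_right hη.le ?_
      rcases lt_trichotomy (u a) 0 with h | h | h <;> simp [h]
    have hlx : ∀ a, l a x = -(η * SignType.sign (u a)) := by
      intro a
      simp [hx, map_add, map_sum, hx₀, hlw]
    rw [hgx x hxK, ← integral_const_mul]
    refine norm_integral_le_of_norm_le ((integrable_decay.const_mul C).const_mul _)
      (.of_forall fun y => ?_)
    rw [norm_mul, hexpnorm, ← Real.exp_sum]
    refine mul_le_mul (le_of_eq ?_) (hb x hxK y) (norm_nonneg _) (Real.exp_nonneg _)
    congr 1
    refine Finset.sum_congr rfl fun a _ => ?_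
    rw [hlx, ← self_mul_sign]
    ring
  have hjc : Continuous fun z : (Fin q → ℝ) × (Fin p → ℝ) =>
      Complex.exp (∑ a, z.1 a * lc a (cpoint γ z.2)) * Φ (cpoint γ z.2) := by
    refine Continuous.mul ?_ ((continuous_tube (hd γ hγ)).comp continuous_snd)
    refine Complex.continuous_exp.comp (continuous_finsetSum _ fun a _ => ?_)
    exact (Complex.continuous_ofReal.comp ((continuous_apply a).comp continuous_fst)).mul
      ((hlcc a).comp ((hcp γ).comp continuous_snd))
  have hgm : AEStronglyMeasurable g volume := by
    have := hjc.aestronglyMeasurable (μ := (volume : Measure (Fin q → ℝ)).prod (volume : Measure (Fin p → ℝ)))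
    exact this.integral_prod_right'
  have hbi : Integrable fun u : Fin q → ℝ =>
      (∏ a, Real.exp (-(η * |u a|))) * ∫ y : Fin p → ℝ, C * decay y :=
    (Integrable.fintype_prod (f := fun _ t => Real.exp (-(η * |t|)))
      fun _ => integrable_exp_neg_mul_abs hη).mul_const _
  have hgi : Integrable g := hbi.mono' hgm (.of_forall hgb)
  -- At the base `x₀` the real parts of the `λ_a` vanish, so `g` is a Fourier integral.
  have hgx0 : ∀ u, g u
      = ∫ y, Complex.exp (Complex.I * ((∑ a, u a * l a y : ℝ) : ℂ)) * Φ (cpoint x₀ y) := by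
    intro u
    rw [hgx x₀ hx₀K]
    congr 1
    ext y
    congr 2
    simp only [hlc, hx₀]
    push_cast
    rw [Finset.mul_sum]
    exact Finset.sum_congr rfl fun a _ => by ring
  have hgi' := hgi
  rw [funext hgx0] at hgi'
  obtain ⟨hti, hlim⟩ := integral_fourier_slice hp hdet hlw hlv (continuous_tube (hd x₀ hx₀K))
    (hb x₀ hx₀K) hgi'
  have hne : ∀ a y, lc a (cpoint γ y) ≠ 0 := by
    intro a y h
    have := hre a γ y
    rw [h, Complex.zero_re] at this
    exact (hγl a).ne this
  have hbnd : ∀ T : ℝ, Integrable fun y => Complex.exp (T * ∑ a, c a * lc a (cpoint γ y))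
        * Φ (cpoint γ y) * ∏ a, (lc a (cpoint γ y))⁻¹ := by
    intro T
    have hcont : Continuous fun y => Complex.exp (T * ∑ a, c a * lc a (cpoint γ y))
        * ∏ a, (lc a (cpoint γ y))⁻¹ := by
      refine Continuous.mul ?_ (continuous_finsetProd _ fun a _ => ?_)
      · refine Complex.continuous_exp.comp (continuous_const.mul
          (continuous_finsetSum _ fun a _ => continuous_const.mul ((hlcc a).comp (hcp γ))))
      · exact ((hlcc a).comp (hcp γ)).inv₀ (hne a)
    have hbd : ∀ y, ‖Complex.exp (T * ∑ a, c a * lc a (cpoint γ y))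
        * ∏ a, (lc a (cpoint γ y))⁻¹‖ ≤ Real.exp (T * ∑ a, c a * l a γ) * ∏ a, (l a γ)⁻¹ := by
      intro y
      rw [norm_mul, norm_prod]
      refine mul_le_mul (le_of_eq ?_) (Finset.prod_le_prod (fun _ _ => norm_nonneg _)
        fun a _ => ?_) (Finset.prod_nonneg fun _ _ => norm_nonneg _) (Real.exp_nonneg _)
      · rw [Complex.norm_exp, Complex.re_ofReal_mul, Complex.re_sum]
        simp only [Complex.re_ofReal_mul, hre]
      · rw [norm_inv]
        refine inv_anti₀ (hγl a) ?_
        rw [← hre a γ y]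
        exact Complex.re_le_norm _
    refine ((hΦi γ hγ).bdd_mul hcont.aestronglyMeasurable (.of_forall hbd)).congr
      (.of_forall fun y => ?_)
    simp only
    ring
  refine ⟨hbnd, hti, ?_⟩
  rw [← hlim, ← integral_congr_ae (.of_forall hgx0)]
  -- Fubini, with `exp(T c_a λ_a)/λ_a` written as an integral over `u_a ≤ T c_a`. Absolute
  -- convergence holds because `l a γ > 0`, which makes `exp(u_a l a γ)` integrable towards `-∞`.
  have hT : ∀ T : ℝ, ∫ y, Complex.exp (T * ∑ a, c a * lc a (cpoint γ y))
        * Φ (cpoint γ y) * ∏ a, (lc a (cpoint γ y))⁻¹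
      = ∫ u, (Set.univ.pi fun a => Set.Iic (T * c a)).indicator g u := by
    intro T
    set S : Set (Fin q → ℝ) := Set.univ.pi fun a => Set.Iic (T * c a) with hS
    have hSm : MeasurableSet S := MeasurableSet.univ_pi fun a => measurableSet_Iic
    have hprod : ∀ (z : Fin q → ℂ) (u : Fin q → ℝ),
        ∏ a, (Set.Iic (T * c a)).indicator (fun t : ℝ => Complex.exp (z a * t)) (u a)
          = S.indicator (fun u => Complex.exp (∑ a, u a * z a)) u := by
      intro z u
      by_cases hu : u ∈ S
      · rw [Set.indicator_of_mem hu, Complex.exp_sum]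
        refine Finset.prod_congr rfl fun a _ => ?_
        rw [Set.indicator_of_mem (hu a (Set.mem_univ a)), mul_comm]
      · rw [Set.indicator_of_notMem hu]
        simp only [hS, Set.mem_univ_pi, not_forall] at hu
        obtain ⟨a, ha⟩ := hu
        exact Finset.prod_eq_zero (Finset.mem_univ a) (Set.indicator_of_notMem ha _)
    have hy : ∀ y, Complex.exp (T * ∑ a, c a * lc a (cpoint γ y))
        * Φ (cpoint γ y) * ∏ a, (lc a (cpoint γ y))⁻¹
        = ∫ u, S.indicator (fun u => Complex.exp (∑ a, u a * lc a (cpoint γ y))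
          * Φ (cpoint γ y)) u := by
      intro y
      have h1 := integral_prod_indicator_exp (z := fun a => lc a (cpoint γ y))
        (fun a => by rw [hre]; exact hγl a) (fun a => T * c a)
      simp only [hprod] at h1
      have h2 : ∀ u, S.indicator (fun u => Complex.exp (∑ a, u a * lc a (cpoint γ y))
          * Φ (cpoint γ y)) u
          = S.indicator (fun u => Complex.exp (∑ a, u a * lc a (cpoint γ y))) u
            * Φ (cpoint γ y) := by
        intro u
        by_cases hu : u ∈ S <;> simp [hu]
      simp only [h2]
      rw [integral_mul_const, h1]
      simp only [div_eq_mul_inv]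
      rw [Finset.prod_mul_distrib, ← Complex.exp_sum, Finset.mul_sum]
      have h3 : ∑ a, (T : ℂ) * (c a * lc a (cpoint γ y))
          = ∑ a, lc a (cpoint γ y) * ((T * c a : ℝ) : ℂ) :=
        Finset.sum_congr rfl fun a _ => by push_cast; ring
      rw [h3]
      ring
    simp only [hy]
    have hSi : Integrable (S.indicator fun u : Fin q → ℝ => Complex.exp (∑ a, u a * (l a γ : ℂ))) := by
      have := Integrable.fintype_prod (ι := Fin q) (𝕜 := ℂ) (f := fun a =>
        (Set.Iic (T * c a)).indicator (fun t : ℝ => Complex.exp ((l a γ : ℂ) * t)))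
        (μ := fun _ => (volume : Measure ℝ))
        (fun a => (integrableOn_exp_mul_complex_Iic (by simpa using hγl a) _).integrable_indicator
          measurableSet_Iic)
      refine this.congr (.of_forall fun u => ?_)
      exact hprod (fun a => (l a γ : ℂ)) u
    have hint : Integrable (Function.uncurry fun (y : Fin p → ℝ) (u : Fin q → ℝ) =>
        S.indicator (fun u => Complex.exp (∑ a, u a * lc a (cpoint γ y)) * Φ (cpoint γ y)) u)
        (volume.prod volume) := by
      refine ((hΦi γ hγ).norm.mul_prod hSi.norm).mono' ?_ (.of_forall fun z => ?_)
      · have : (Function.uncurry fun (y : Fin p → ℝ) (u : Fin q → ℝ) =>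
          S.indicator (fun u => Complex.exp (∑ a, u a * lc a (cpoint γ y)) * Φ (cpoint γ y)) u)
            = (Prod.snd ⁻¹' S).indicator (fun z : (Fin p → ℝ) × (Fin q → ℝ) =>
              Complex.exp (∑ a, z.2 a * lc a (cpoint γ z.1)) * Φ (cpoint γ z.1)) := by
          ext z
          by_cases hz : z.2 ∈ S <;> simp [Function.uncurry, hz, Set.indicator]
        rw [this]
        exact (hjc.comp continuous_swap).aestronglyMeasurable.indicator (measurable_snd hSm)
      · by_cases hz : z.2 ∈ S
        · simp only [Function.uncurry, Set.indicator_of_mem hz, norm_mul, hexpnorm]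
          rw [mul_comm, Complex.norm_exp, Complex.re_sum]
          refine le_of_eq ?_
          congr 2
          refine Finset.sum_congr rfl fun a _ => ?_
          rw [Complex.re_ofReal_mul, Complex.ofReal_re]
        · simp [Function.uncurry, Set.indicator_of_notMem hz]
    rw [integral_integral_swap hint]
    congr 1
    ext u
    by_cases hu : u ∈ S <;> simp [hu, hg]
  simp only [hT]
  refine tendsto_integral_filter_of_dominated_convergence _
    (.of_forall fun T => hgm.indicator (MeasurableSet.univ_pi fun a => measurableSet_Iic))
    (.of_forall fun T => .of_forall fun u => (norm_indicator_le_norm_self _ _).trans (hgb u)) hbi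
    (.of_forall fun u => ?_)
  -- The orthants exhaust `ℝ^q` because all `c a` are positive.
  have hev : ∀ᶠ T : ℝ in atTop, u ∈ Set.univ.pi fun a => Set.Iic (T * c a) := by
    simp only [Set.mem_univ_pi, Set.mem_Iic]
    refine eventually_all.2 fun a => ?_
    filter_upwards [eventually_ge_atTop (u a / c a)] with T hT
    rwa [div_le_iff₀ (hc a)] at hT
  refine tendsto_const_nhds.congr' ?_
  filter_upwards [hev] with T hT
  rw [Set.indicator_of_mem hT]

end

/-! ### Mellin integrals of monomials in their domain of convergence -/

section

/-- The kernel `|ζ|^{2(μ-1)} ζ^{-b}`. -/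
def monoKernel (b : ℤ) (μ ζ : ℂ) : ℂ := (‖ζ‖ : ℂ) ^ (2 * (μ - 1)) / ζ ^ b

/-- The integral of `φ(ζ) ∏ |ζ_k|^{2(μ_k-1)} ζ_k^{-b_k}` over `ℂⁿ`. -/
def polyMellin {n : ℕ} (φ : (Fin n → ℂ) → ℂ) (b : Fin n → ℤ) (μ : Fin n → ℂ) : ℂ :=
  ∫ ζ : Fin n → ℂ, φ ζ * ∏ k, monoKernel (b k) (μ k) (ζ k)

theorem norm_monoKernel (b : ℤ) (μ : ℂ) {ζ : ℂ} (hζ : ζ ≠ 0) :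
    ‖monoKernel b μ ζ‖ = ‖ζ‖ ^ (2 * μ.re - 2 - b) := by
  have h : 0 < ‖ζ‖ := norm_pos_iff.2 hζ
  rw [monoKernel, norm_div, norm_zpow, Complex.norm_cpow_eq_rpow_re_of_pos h,
    Real.rpow_sub h, Real.rpow_intCast]
  congr 2
  simp
  ring

/-- An integrable majorant of the powers `|ζ|^e`, `e₁ ≤ e ≤ e₂`, on the disc of radius `R`. -/
def powEnvelope (R e₁ e₂ : ℝ) (ζ : ℂ) : ℝ :=
  (Metric.ball (0 : ℂ) R).indicator (fun ζ => ‖ζ‖ ^ e₁ + ‖ζ‖ ^ e₂) ζ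

theorem powEnvelope_nonneg (R e₁ e₂ : ℝ) (ζ : ℂ) : 0 ≤ powEnvelope R e₁ e₂ ζ :=
  Set.indicator_nonneg (fun _ _ => by positivity) _

theorem integrableOn_ball_norm_rpow (R : ℝ) {e : ℝ} (he : -2 < e) :
    IntegrableOn (fun ζ : ℂ => ‖ζ‖ ^ e) (Metric.ball 0 R) := by
  rw [integrableOn_fun_norm_addHaar volume (f := fun r : ℝ => r ^ e), Complex.finrank_real_complex]
  rcases le_or_gt R 0 with hR | hR
  · simp [Set.Ioo_eq_empty (not_lt.2 hR)]
  refine ((intervalIntegral.integrableOn_Ioo_rpow_iff (s := e + 1) hR).2 (by linarith)).congr_fun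
    (fun y hy => ?_) measurableSet_Ioo
  simp only [Nat.add_one_sub_one, pow_one, smul_eq_mul]
  rw [Real.rpow_add hy.1, Real.rpow_one, mul_comm]

theorem integrable_powEnvelope (R : ℝ) {e₁ e₂ : ℝ} (h₁ : -2 < e₁) (h₂ : -2 < e₂) :
    Integrable (powEnvelope R e₁ e₂) := by
  unfold powEnvelope
  rw [integrable_indicator_iff Metric.isOpen_ball.measurableSet]
  exact (integrableOn_ball_norm_rpow R h₁).add (integrableOn_ball_norm_rpow R h₂)

theorem rpow_le_rpow_add_rpow {r e e₁ e₂ : ℝ} (hr : 0 < r) (h₁ : e₁ ≤ e) (h₂ : e ≤ e₂) :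
    r ^ e ≤ r ^ e₁ + r ^ e₂ := by
  rcases le_total 1 r with h | h
  · exact (Real.rpow_le_rpow_of_exponent_le h h₂).trans
      (le_add_of_nonneg_left (Real.rpow_nonneg hr.le _))
  · exact (Real.rpow_le_rpow_of_exponent_ge hr h h₁).trans
      (le_add_of_nonneg_right (Real.rpow_nonneg hr.le _))

variable {n : ℕ}

theorem exists_norm_le_support_subset {φ : (Fin n → ℂ) → ℂ} (hφ : Continuous φ)
    (hs : HasCompactSupport φ) :
    ∃ C R : ℝ, 0 ≤ C ∧ ∀ ζ, ‖φ ζ‖ ≤ C ∧ (φ ζ ≠ 0 → ∀ k, ‖ζ k‖ < R) := by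
  obtain ⟨C, hC⟩ := hs.exists_bound_of_continuous hφ
  obtain ⟨R, hR⟩ := hs.isBounded.exists_norm_le
  refine ⟨C, R + 1, (norm_nonneg _).trans (hC 0), fun ζ => ⟨hC ζ, fun h k => ?_⟩⟩
  exact ((norm_le_pi_norm ζ k).trans (hR ζ (subset_tsupport _ h))).trans_lt (by linarith)

theorem ae_forall_ne_zero : ∀ᵐ ζ : Fin n → ℂ, ∀ k, ζ k ≠ 0 :=
  ae_all_iff.2 fun k => Measure.ae_eval_ne _ k 0

theorem mul_prod_le_prod_powEnvelope {φ : (Fin n → ℂ) → ℂ} {C R : ℝ} {ζ : Fin n → ℂ}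
    (hφ : ‖φ ζ‖ ≤ C ∧ (φ ζ ≠ 0 → ∀ k, ‖ζ k‖ < R)) {e₁ e₂ : Fin n → ℝ} {a : Fin n → ℝ}
    (h0 : ∀ k, 0 ≤ a k) (ha : ∀ k, a k ≤ ‖ζ k‖ ^ e₁ k + ‖ζ k‖ ^ e₂ k) :
    ‖φ ζ‖ * ∏ k, a k ≤ C * ∏ k, powEnvelope R (e₁ k) (e₂ k) (ζ k) := by
  by_cases hζ : φ ζ = 0
  · rw [hζ, norm_zero, zero_mul]
    exact mul_nonneg ((norm_nonneg _).trans hφ.1)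
      (Finset.prod_nonneg fun k _ => powEnvelope_nonneg _ _ _ _)
  · refine mul_le_mul hφ.1 (Finset.prod_le_prod (fun k _ => h0 k) fun k _ => ?_)
      (Finset.prod_nonneg fun k _ => h0 k) ((norm_nonneg _).trans hφ.1)
    rw [powEnvelope, Set.indicator_of_mem (by simpa using hφ.2 hζ k)]
    exact ha k

theorem integrable_prod_powEnvelope (R : ℝ) {e₁ e₂ : Fin n → ℝ} (h₁ : ∀ k, -2 < e₁ k)
    (h₂ : ∀ k, -2 < e₂ k) :
    Integrable fun ζ : Fin n → ℂ => ∏ k, powEnvelope R (e₁ k) (e₂ k) (ζ k) :=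
  Integrable.fintype_prod (f := fun k => powEnvelope R (e₁ k) (e₂ k))
    fun k => integrable_powEnvelope R (h₁ k) (h₂ k)

theorem measurable_monoKernel (b : ℤ) (μ : ℂ) : Measurable (monoKernel b μ) := by
  unfold monoKernel
  have h : Measurable fun ζ : ℂ => ζ ^ b := by
    rcases b with b | b
    · simpa using (measurable_id (α := ℂ)).pow_const b
    · simp only [zpow_negSucc]
      exact ((measurable_id (α := ℂ)).pow_const (b + 1)).inv
  exact ((Complex.measurable_ofReal.comp measurable_norm).pow_const _).div h

theorem aestronglyMeasurable_mul_prod_monoKernel {φ : (Fin n → ℂ) → ℂ} (hφ : Continuous φ)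
    (b : Fin n → ℤ) (μ : Fin n → ℂ) :
    AEStronglyMeasurable (fun ζ => φ ζ * ∏ k, monoKernel (b k) (μ k) (ζ k)) volume :=
  hφ.aestronglyMeasurable.mul (Finset.measurable_prod _ fun k _ =>
    (measurable_monoKernel (b k) (μ k)).comp (measurable_pi_apply k)).aestronglyMeasurable

/-- Each kernel has modulus `|ζ|^(2 Re μ - 2 - b)`, and a power of `|ζ|` is integrable near the
origin of the plane if its exponent exceeds `-2`; this is the hypothesis on `μ`. -/
theorem integrable_polyMellin {φ : (Fin n → ℂ) → ℂ} (hφ : Continuous φ)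
    (hs : HasCompactSupport φ) {b : Fin n → ℤ} {μ : Fin n → ℂ} (hμ : ∀ k, b k < 2 * (μ k).re) :
    Integrable fun ζ => φ ζ * ∏ k, monoKernel (b k) (μ k) (ζ k) := by
  obtain ⟨C, R, -, hCR⟩ := exists_norm_le_support_subset hφ hs
  have he : ∀ k, -2 < 2 * (μ k).re - 2 - b k := fun k => by linarith [hμ k]
  refine ((integrable_prod_powEnvelope R he he).const_mul C).mono'
    (aestronglyMeasurable_mul_prod_monoKernel hφ b μ) ?_
  filter_upwards [ae_forall_ne_zero] with ζ hζ
  rw [norm_mul, norm_prod]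
  refine mul_prod_le_prod_powEnvelope (hCR ζ) (fun _ => norm_nonneg _) fun k => ?_
  rw [norm_monoKernel _ _ (hζ k)]
  exact le_add_of_nonneg_left (by positivity)

/-- The integral is bounded as long as the real parts of the exponents stay in a compact part of
the domain of convergence. -/
theorem exists_norm_polyMellin_le {φ : (Fin n → ℂ) → ℂ} (hφ : Continuous φ)
    (hs : HasCompactSupport φ) {b : Fin n → ℤ} {x₁ x₂ : Fin n → ℝ} (h₁ : ∀ k, b k < 2 * x₁ k)
    (h₂ : ∀ k, b k < 2 * x₂ k) :
    ∃ B : ℝ, 0 ≤ B ∧ ∀ μ : Fin n → ℂ, (∀ k, x₁ k ≤ (μ k).re ∧ (μ k).re ≤ x₂ k) →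
      ‖polyMellin φ b μ‖ ≤ B := by
  obtain ⟨C, R, hC, hCR⟩ := exists_norm_le_support_subset hφ hs
  have he₁ : ∀ k, -2 < 2 * x₁ k - 2 - b k := fun k => by linarith [h₁ k]
  have he₂ : ∀ k, -2 < 2 * x₂ k - 2 - b k := fun k => by linarith [h₂ k]
  refine ⟨∫ ζ : Fin n → ℂ, C * ∏ k, powEnvelope R (2 * x₁ k - 2 - b k) (2 * x₂ k - 2 - b k) (ζ k),
    integral_nonneg fun ζ => mul_nonneg hC
      (Finset.prod_nonneg fun k _ => powEnvelope_nonneg _ _ _ _), fun μ hμ => ?_⟩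
  refine norm_integral_le_of_norm_le ((integrable_prod_powEnvelope R he₁ he₂).const_mul C) ?_
  filter_upwards [ae_forall_ne_zero] with ζ hζ
  rw [norm_mul, norm_prod]
  refine mul_prod_le_prod_powEnvelope (hCR ζ) (fun _ => norm_nonneg _) fun k => ?_
  rw [norm_monoKernel _ _ (hζ k)]
  exact rpow_le_rpow_add_rpow (norm_pos_iff.2 (hζ k)) (by linarith [(hμ k).1])
    (by linarith [(hμ k).2])

/-- Off the origin the exponent enters through `exp(2h log |ζ|)`, the exponential of a linear form
in `h`; this brings the integral under `analyticAt_integral_exp`. -/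
theorem monoKernel_add (b : ℤ) (μ h : ℂ) {ζ : ℂ} (hζ : ζ ≠ 0) :
    monoKernel b (μ + h) ζ
      = monoKernel b μ ζ * Complex.exp (((2 * Real.log ‖ζ‖ : ℝ) : ℂ) * h) := by
  have h0 : (‖ζ‖ : ℂ) ≠ 0 := by simpa using hζ
  rw [monoKernel, monoKernel, div_mul_eq_mul_div]
  congr 1
  rw [Complex.cpow_def_of_ne_zero h0, Complex.cpow_def_of_ne_zero h0, ← Complex.exp_add,
    ← Complex.ofReal_log (norm_nonneg _)]
  congr 1
  push_cast
  ring

theorem exp_abs_log_le {r t : ℝ} (hr : 0 < r) :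
    Real.exp (t * |Real.log r|) ≤ r ^ (-t) + r ^ t := by
  rw [Real.rpow_def_of_pos hr, Real.rpow_def_of_pos hr]
  rcases abs_cases (Real.log r) with ⟨h, _⟩ | ⟨h, _⟩ <;> rw [h]
  · rw [mul_comm]
    exact le_add_of_nonneg_left (Real.exp_nonneg _)
  · have : t * -Real.log r = Real.log r * -t := by ring
    rw [this]
    exact le_add_of_nonneg_right (Real.exp_nonneg _)

theorem analyticAt_polyMellin {φ : (Fin n → ℂ) → ℂ} (hφ : Continuous φ)
    (hs : HasCompactSupport φ) {b : Fin n → ℤ} {μ : Fin n → ℂ} (hμ : ∀ k, b k < 2 * (μ k).re) :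
    AnalyticAt ℂ (polyMellin φ b) μ := by
  obtain ⟨C, R, -, hCR⟩ := exists_norm_le_support_subset hφ hs
  -- `r` is a common slack in the strict inequalities: the powers of `|ζ_k|` may change by `±r` and
  -- stay integrable. The radius used below is `r / 2`, since `L` contains `2 log |ζ_k|`.
  obtain ⟨r, hr, hrμ⟩ := Pi.exists_forall_pos_add_lt hμ
  set L : (Fin n → ℂ) → (Fin n → ℂ) →L[ℂ] ℂ := fun ζ =>
    ∑ k, ((2 * Real.log ‖ζ k‖ : ℝ) : ℂ) • ContinuousLinearMap.proj k with hL
  have hLm : AEStronglyMeasurable L volume := by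
    refine Finset.aestronglyMeasurable_fun_sum _ fun k _ => ?_
    refine AEStronglyMeasurable.smul_const (Measurable.aestronglyMeasurable ?_) _
    exact Complex.measurable_ofReal.comp ((Real.measurable_log.comp
      (measurable_norm.comp (measurable_pi_apply k))).const_mul 2)
  have hLn : ∀ ζ, ‖L ζ‖ ≤ ∑ k, 2 * |Real.log ‖ζ k‖| := by
    intro ζ
    refine (norm_sum_le _ _).trans (Finset.sum_le_sum fun k _ => ?_)
    rw [norm_smul, Complex.norm_real, Real.norm_eq_abs, abs_mul, abs_two]
    refine mul_le_of_le_one_right (by positivity) ?_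
    refine ContinuousLinearMap.opNorm_le_bound _ zero_le_one fun x => ?_
    rw [one_mul]
    exact norm_le_pi_norm x k
  have key := analyticAt_integral_exp (ν := volume)
    (f := fun ζ => φ ζ * ∏ k, monoKernel (b k) (μ k) (ζ k)) (L := L) (r := r / 2)
    (aestronglyMeasurable_mul_prod_monoKernel hφ b μ) hLm (by positivity) ?_
  · have heq : polyMellin φ b = (fun h => ∫ ζ, (φ ζ * ∏ k, monoKernel (b k) (μ k) (ζ k))
        * Complex.exp (L ζ h)) ∘ fun z => z - μ := by
      ext z
      simp only [polyMellin, Function.comp]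
      refine integral_congr_ae ?_
      filter_upwards [ae_forall_ne_zero] with ζ hζ
      have h1 : ∀ k, monoKernel (b k) (z k) (ζ k) = monoKernel (b k) (μ k) (ζ k)
          * Complex.exp (((2 * Real.log ‖ζ k‖ : ℝ) : ℂ) * (z k - μ k)) := by
        intro k
        rw [← monoKernel_add _ _ _ (hζ k), add_sub_cancel]
      simp only [h1, Finset.prod_mul_distrib]
      rw [← Complex.exp_sum, mul_assoc]
      simp [hL]
    rw [heq]
    refine AnalyticAt.comp_of_eq key (by fun_prop) (sub_self μ)
  · refine ((integrable_prod_powEnvelope R (e₁ := fun k => 2 * (μ k).re - 2 - b k - r)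
      (e₂ := fun k => 2 * (μ k).re - 2 - b k + r) (fun k => by linarith [hrμ k])
      (fun k => by linarith [hrμ k])).const_mul C).mono' ?_ ?_
    · exact (aestronglyMeasurable_mul_prod_monoKernel hφ b μ).norm.mul
        (Real.continuous_exp.comp_aestronglyMeasurable (hLm.norm.const_mul _))
    · filter_upwards [ae_forall_ne_zero] with ζ hζ
      rw [Real.norm_of_nonneg (by positivity), norm_mul, norm_prod, mul_assoc]
      have h1 : Real.exp (r / 2 * ‖L ζ‖) ≤ ∏ k, Real.exp (r * |Real.log ‖ζ k‖|) := by
        rw [← Real.exp_sum, Real.exp_le_exp]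
        calc r / 2 * ‖L ζ‖ ≤ r / 2 * ∑ k, 2 * |Real.log ‖ζ k‖| := by gcongr; exact hLn ζ
          _ = _ := by
            rw [Finset.mul_sum]
            exact Finset.sum_congr rfl fun k _ => by ring
      refine (mul_le_mul_of_nonneg_left (mul_le_mul_of_nonneg_left h1
        (Finset.prod_nonneg fun _ _ => norm_nonneg _)) (norm_nonneg _)).trans ?_
      rw [← Finset.prod_mul_distrib]
      refine mul_prod_le_prod_powEnvelope (hCR ζ)
        (fun k => mul_nonneg (norm_nonneg _) (Real.exp_nonneg _)) fun k => ?_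
      have hp := norm_pos_iff.2 (hζ k)
      rw [norm_monoKernel _ _ (hζ k), sub_eq_add_neg _ r, Real.rpow_add hp,
        Real.rpow_add hp _ r, ← mul_add]
      exact mul_le_mul_of_nonneg_left (exp_abs_log_le hp) (by positivity)

end

/-! ### Integration by parts against the antiholomorphic derivative -/

section

theorem norm_cpow_two_mul (z : ℂ) {μ : ℂ} (hμ : μ ≠ 0) :
    (‖z‖ : ℂ) ^ (2 * μ) = ((Complex.normSq z : ℝ) : ℂ) ^ μ := by
  rcases eq_or_ne z 0 with rfl | hz
  · simp [Complex.zero_cpow, hμ]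
  · have h0 : (‖z‖ : ℂ) ≠ 0 := by simpa using hz
    have h1 : ((Complex.normSq z : ℝ) : ℂ) ≠ 0 := by simpa using hz
    rw [Complex.cpow_def_of_ne_zero h0, Complex.cpow_def_of_ne_zero h1,
      ← Complex.ofReal_log (norm_nonneg _), ← Complex.ofReal_log (Complex.normSq_nonneg _),
      Complex.normSq_eq_norm_sq, Real.log_pow]
    push_cast
    ring_nf

/-- Formally the kernel is `ζ^(μ-b-1) ζ̄^μ`, and the derivative in the direction `v` is `v ∂ + v̄
∂̄`. The computation replaces the power of `|ζ|` by a power of `|ζ|²`, which is a polynomial in the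
real coordinates. -/
theorem hasDerivAt_monoKernel_line_of_ne {b : ℤ} {μ ζ : ℂ} (v : ℂ) (hμ : μ ≠ 0) (hμ1 : μ ≠ 1)
    (hζ : ζ ≠ 0) :
    HasDerivAt (fun t : ℝ => monoKernel (b + 1) (μ + 1) (ζ + t * v))
      ((μ - b - 1) * v * monoKernel (b + 2) (μ + 1) ζ
        + μ * (starRingEnd ℂ) v * monoKernel b μ ζ) 0 := by
  have hN : HasDerivAt (fun t : ℝ => Complex.normSq (ζ + t * v))
      (2 * (ζ.re * v.re + ζ.im * v.im)) 0 := by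
    have h1 : HasDerivAt (fun t : ℝ => ζ.re + t * v.re) v.re 0 := by
      simpa using ((hasDerivAt_id (0 : ℝ)).mul_const v.re).const_add ζ.re
    have h2 : HasDerivAt (fun t : ℝ => ζ.im + t * v.im) v.im 0 := by
      simpa using ((hasDerivAt_id (0 : ℝ)).mul_const v.im).const_add ζ.im
    have h3 := (h1.mul h1).add (h2.mul h2)
    have he : (fun t : ℝ => Complex.normSq (ζ + t * v)) = fun t : ℝ =>
        (ζ.re + t * v.re) * (ζ.re + t * v.re) + (ζ.im + t * v.im) * (ζ.im + t * v.im) := by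
      ext t
      simp [Complex.normSq_apply]
    rw [he]
    refine h3.congr_deriv ?_
    simp
    ring
  have hN0 : Complex.normSq (ζ + (0 : ℝ) * v) = Complex.normSq ζ := by simp
  have hNne : Complex.normSq ζ ≠ 0 := by simpa using hζ
  have hpow : HasDerivAt (fun t : ℝ => ((Complex.normSq (ζ + t * v) : ℝ) : ℂ) ^ μ)
      ((2 * (ζ.re * v.re + ζ.im * v.im) : ℝ) * (μ * (Complex.normSq ζ : ℂ) ^ (μ - 1))) 0 := by
    have h1 := hasDerivAt_ofReal_cpow_const (r := μ) hNne hμ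
    rw [← hN0] at h1
    have h2 := HasDerivAt.scomp (0 : ℝ) h1 hN
    rw [hN0] at h2
    simp only [Complex.real_smul] at h2
    exact h2
  have hz : HasDerivAt (fun t : ℝ => (ζ + t * v) ^ (-(b + 1)))
      (v * ((-(b + 1) : ℤ) * ζ ^ (-(b + 1) - 1))) 0 := by
    have h1 : HasDerivAt (fun t : ℝ => ζ + (t : ℂ) * v) v 0 := by
      have := (((hasDerivAt_id (0 : ℝ)).ofReal_comp).mul_const v).const_add ζ
      simpa using this
    have h2 : HasDerivAt (fun z : ℂ => z ^ (-(b + 1))) ((-(b + 1) : ℤ) * ζ ^ (-(b + 1) - 1))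
        (ζ + ((0 : ℝ) : ℂ) * v) := by
      have : ζ + ((0 : ℝ) : ℂ) * v = ζ := by simp
      rw [this]
      exact hasDerivAt_zpow _ _ (Or.inl hζ)
    exact HasDerivAt.scomp (0 : ℝ) h2 h1
  have hprod := hpow.mul hz
  have hμ2 : μ - 1 ≠ 0 := sub_ne_zero.2 hμ1
  refine (hprod.congr_of_eventuallyEq (.of_forall fun t => ?_)).congr_deriv ?_
  · simp only [monoKernel, add_sub_cancel_right, Pi.mul_apply]
    rw [norm_cpow_two_mul _ hμ, zpow_neg, div_eq_mul_inv]
  · simp only [monoKernel, add_sub_cancel_right]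
    rw [norm_cpow_two_mul _ hμ, norm_cpow_two_mul _ hμ2]
    have hsq : ((Complex.normSq ζ : ℝ) : ℂ) = ζ * (starRingEnd ℂ) ζ := (Complex.mul_conj ζ).symm
    have hP : ((Complex.normSq ζ : ℝ) : ℂ) ^ μ
        = ζ * (starRingEnd ℂ) ζ * ((Complex.normSq ζ : ℝ) : ℂ) ^ (μ - 1) := by
      rw [← hsq]
      conv_lhs => rw [← add_sub_cancel 1 μ]
      rw [Complex.cpow_add _ _ (by simpa using hζ), Complex.cpow_one]
    have hre : ((2 * (ζ.re * v.re + ζ.im * v.im) : ℝ) : ℂ)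
        = (starRingEnd ℂ) ζ * v + ζ * (starRingEnd ℂ) v := by
      apply Complex.ext <;> simp <;> ring
    have hz1 : ζ ^ (-(b + 1)) = (ζ ^ b)⁻¹ * ζ⁻¹ := by
      rw [zpow_neg, zpow_add₀ hζ, zpow_one, mul_inv]
    have hz2 : ζ ^ (-(b + 1) - 1) = (ζ ^ b)⁻¹ * ζ⁻¹ * ζ⁻¹ := by
      rw [zpow_sub₀ hζ, hz1, zpow_one, div_eq_mul_inv]
    have hz3 : ζ ^ (b + 2) = ζ ^ b * ζ * ζ := by
      rw [zpow_add₀ hζ, zpow_ofNat]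
      ring
    have hz4 : ((0 : ℝ) : ℂ) * v = 0 := by simp
    rw [hz4, add_zero, hP, hre, hz1, hz2, hz3]
    have hZ : ζ ^ b ≠ 0 := zpow_ne_zero _ hζ
    push_cast
    field_simp
    ring

/-- At the origin the kernel is `O(|ζ|²)`, because its exponent `2 Re μ - b - 1` exceeds `2`; the
derivative there is zero, and the formula holds at every point of the plane. -/
theorem hasDerivAt_monoKernel_line {b : ℤ} {μ : ℂ} (hμ : b + 3 < 2 * μ.re) (hμ1 : 1 < μ.re)
    (ζ v : ℂ) :
    HasDerivAt (fun t : ℝ => monoKernel (b + 1) (μ + 1) (ζ + t * v))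
      ((μ - b - 1) * v * monoKernel (b + 2) (μ + 1) ζ
        + μ * (starRingEnd ℂ) v * monoKernel b μ ζ) 0 := by
  have h0 : μ ≠ 0 := by rintro rfl; simp at hμ1; linarith
  have h1 : μ ≠ 1 := by rintro rfl; simp at hμ1
  rcases eq_or_ne ζ 0 with rfl | hζ
  · have hk : ∀ b, monoKernel b (μ + 1) 0 = 0 := fun b => by
      simp [monoKernel, Complex.zero_cpow, h0]
    have hk0 : monoKernel b μ 0 = 0 := by
      simp [monoKernel, Complex.zero_cpow, sub_ne_zero.2 h1]
    rw [hk, hk0, mul_zero, mul_zero, add_zero]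
    have hO : (fun t : ℝ => monoKernel (b + 1) (μ + 1) (0 + t * v))
        =O[𝓝 0] fun t : ℝ => ‖t - 0‖ ^ 2 := by
      refine Asymptotics.IsBigO.of_bound (‖v‖ ^ 2) ?_
      have hcont : Tendsto (fun t : ℝ => ‖(t : ℂ) * v‖) (𝓝 0) (𝓝 0) := by
        have : Continuous fun t : ℝ => ‖(t : ℂ) * v‖ := by fun_prop
        simpa using this.tendsto 0
      filter_upwards [hcont.eventually (gt_mem_nhds one_pos)] with t ht
      rw [zero_add, sub_zero, norm_pow, norm_norm, ← mul_pow, mul_comm ‖v‖]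
      rcases eq_or_ne ((t : ℂ) * v) 0 with h | h
      · rw [h, hk, norm_zero]
        positivity
      · rw [norm_monoKernel _ _ h, ← Real.rpow_natCast]
        have hn : ‖t‖ * ‖v‖ = ‖(t : ℂ) * v‖ := by simp
        rw [hn]
        refine Real.rpow_le_rpow_of_exponent_ge (norm_pos_iff.2 h) ht.le ?_
        push_cast
        simp
        linarith
    have := (hO.hasFDerivAt one_lt_two).hasDerivAt
    simpa using this
  · exact hasDerivAt_monoKernel_line_of_ne v h0 h1 hζ

variable {n : ℕ}

/-- The Wirtinger derivative `∂/∂ζ̄_k`. -/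
def dbar (k : Fin n) (φ : (Fin n → ℂ) → ℂ) (ζ : Fin n → ℂ) : ℂ :=
  1 / 2 * (fderiv ℝ φ ζ (Pi.single k 1) + Complex.I * fderiv ℝ φ ζ (Pi.single k Complex.I))

theorem contDiff_fderiv_apply_const {φ : (Fin n → ℂ) → ℂ} (hφ : ContDiff ℝ ∞ φ) (v : Fin n → ℂ) :
    ContDiff ℝ ∞ fun ζ => fderiv ℝ φ ζ v :=
  (hφ.fderiv_right (m := ∞) (by simp)).clm_apply contDiff_const

theorem hasCompactSupport_fderiv_apply_const {φ : (Fin n → ℂ) → ℂ} (hs : HasCompactSupport φ)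
    (v : Fin n → ℂ) : HasCompactSupport fun ζ => fderiv ℝ φ ζ v :=
  hs.fderiv_apply (𝕜 := ℝ) v

theorem contDiff_dbar {φ : (Fin n → ℂ) → ℂ} (hφ : ContDiff ℝ ∞ φ) (k : Fin n) :
    ContDiff ℝ ∞ (dbar k φ) :=
  contDiff_const.mul ((contDiff_fderiv_apply_const hφ _).add
    (contDiff_const.mul (contDiff_fderiv_apply_const hφ _)))

theorem hasCompactSupport_dbar {φ : (Fin n → ℂ) → ℂ} (hs : HasCompactSupport φ) (k : Fin n) :
    HasCompactSupport (dbar k φ) :=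
  HasCompactSupport.mul_left (f := fun _ => (1 / 2 : ℂ))
    ((hasCompactSupport_fderiv_apply_const hs _).add
      (HasCompactSupport.mul_left (f := fun _ => Complex.I)
        (hasCompactSupport_fderiv_apply_const hs _)))

theorem prod_erase_mul_monoKernel (k : Fin n) {b b' : Fin n → ℤ} {μ μ' ζ : Fin n → ℂ}
    (hb : ∀ i, i ≠ k → b i = b' i) (hμ : ∀ i, i ≠ k → μ i = μ' i) :
    (∏ i ∈ Finset.univ.erase k, monoKernel (b i) (μ i) (ζ i)) * monoKernel (b' k) (μ' k) (ζ k)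
      = ∏ i, monoKernel (b' i) (μ' i) (ζ i) := by
  rw [← Finset.prod_erase_mul _ _ (Finset.mem_univ k)]
  congr 1
  refine Finset.prod_congr rfl fun i hi => ?_
  rw [hb i (Finset.ne_of_mem_erase hi), hμ i (Finset.ne_of_mem_erase hi)]

/-- Integration by parts in `ζ_k`, where the boundary term at `ζ_k = 0` is harmless. -/
theorem mul_polyMellin_eq_of_lt {φ : (Fin n → ℂ) → ℂ} (hφ : ContDiff ℝ ∞ φ)
    (hs : HasCompactSupport φ) {b : Fin n → ℤ} {μ : Fin n → ℂ} (hμ : ∀ k, b k < 2 * (μ k).re)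
    (k : Fin n) (hk : b k + 3 < 2 * (μ k).re) (hk1 : 1 < (μ k).re) :
    μ k * polyMellin φ b μ
      = -polyMellin (dbar k φ) (b + Pi.single k 1) (μ + Pi.single k 1) := by
  set Q : (Fin n → ℂ) → ℂ := fun ζ =>
    ∏ i ∈ Finset.univ.erase k, monoKernel (b i) (μ i) (ζ i) with hQ
  have hb1 : ∀ i, i ≠ k → b i = (b + Pi.single k 1 : Fin n → ℤ) i := fun i hi => by simp [hi]
  have hb2 : ∀ i, i ≠ k → b i = (b + Pi.single k 2 : Fin n → ℤ) i := fun i hi => by simp [hi]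
  have hμ1 : ∀ i, i ≠ k → μ i = (μ + Pi.single k 1 : Fin n → ℂ) i := fun i hi => by simp [hi]
  have hbk1 : (b + Pi.single k 1 : Fin n → ℤ) k = b k + 1 := by simp
  have hbk2 : (b + Pi.single k 2 : Fin n → ℤ) k = b k + 2 := by simp
  have hμk1 : (μ + Pi.single k 1 : Fin n → ℂ) k = μ k + 1 := by simp
  have e0 : ∀ ζ, Q ζ * monoKernel (b k) (μ k) (ζ k) = ∏ i, monoKernel (b i) (μ i) (ζ i) :=
    fun ζ => prod_erase_mul_monoKernel k (fun _ _ => rfl) (fun _ _ => rfl)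
  have e1 : ∀ ζ, Q ζ * monoKernel (b k + 1) (μ k + 1) (ζ k)
      = ∏ i, monoKernel ((b + Pi.single k 1 : Fin n → ℤ) i) ((μ + Pi.single k 1 : Fin n → ℂ) i) (ζ i) := by
    intro ζ
    rw [← hbk1, ← hμk1]
    exact prod_erase_mul_monoKernel k hb1 hμ1
  have e2 : ∀ ζ, Q ζ * monoKernel (b k + 2) (μ k + 1) (ζ k)
      = ∏ i, monoKernel ((b + Pi.single k 2 : Fin n → ℤ) i) ((μ + Pi.single k 1 : Fin n → ℂ) i) (ζ i) := by
    intro ζ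
    rw [← hbk2, ← hμk1]
    exact prod_erase_mul_monoKernel k hb2 hμ1
  have hμ1' : ∀ i, ((b + Pi.single k 1 : Fin n → ℤ) i : ℤ) < 2 * ((μ + Pi.single k 1 : Fin n → ℂ) i).re := by
    intro i
    rcases eq_or_ne i k with rfl | hi
    · rw [hbk1, hμk1]
      push_cast
      simp
      linarith [hμ i]
    · rw [← hb1 i hi, ← hμ1 i hi]
      exact hμ i
  have hμ2' : ∀ i, ((b + Pi.single k 2 : Fin n → ℤ) i : ℤ) < 2 * ((μ + Pi.single k 1 : Fin n → ℂ) i).re := by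
    intro i
    rcases eq_or_ne i k with rfl | hi
    · rw [hbk2, hμk1]
      push_cast
      simp
      linarith [hμ i]
    · rw [← hb2 i hi, ← hμ1 i hi]
      exact hμ i
  have i0 : Integrable fun ζ => φ ζ * Q ζ * monoKernel (b k) (μ k) (ζ k) := by
    simpa only [mul_assoc, e0] using integrable_polyMellin hφ.continuous hs hμ
  have i1 : Integrable fun ζ => φ ζ * Q ζ * monoKernel (b k + 1) (μ k + 1) (ζ k) := by
    simpa only [mul_assoc, e1] using integrable_polyMellin hφ.continuous hs hμ1'
  have i2 : Integrable fun ζ => φ ζ * Q ζ * monoKernel (b k + 2) (μ k + 1) (ζ k) := by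
    simpa only [mul_assoc, e2] using integrable_polyMellin hφ.continuous hs hμ2'
  have i3 : ∀ v, Integrable fun ζ =>
      fderiv ℝ φ ζ v * Q ζ * monoKernel (b k + 1) (μ k + 1) (ζ k) := fun v => by
    simpa only [mul_assoc, e1] using integrable_polyMellin
      (contDiff_fderiv_apply_const hφ v).continuous
      (hasCompactSupport_fderiv_apply_const hs v) hμ1'
  -- Integration by parts along the real direction `c e_k`. The other kernels are constant along it,
  -- so only `φ` and the `k`-th kernel are differentiated.
  have hibp : ∀ c : ℂ,
      (μ k - b k - 1) * c * (∫ ζ, φ ζ * Q ζ * monoKernel (b k + 2) (μ k + 1) (ζ k))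
        + μ k * (starRingEnd ℂ) c * (∫ ζ, φ ζ * Q ζ * monoKernel (b k) (μ k) (ζ k))
        = -∫ ζ, fderiv ℝ φ ζ (Pi.single k c) * Q ζ * monoKernel (b k + 1) (μ k + 1) (ζ k) := by
    intro c
    have hlin := (i2.const_mul ((μ k - b k - 1) * c)).add
      (i0.const_mul (μ k * (starRingEnd ℂ) c))
    have hadd := integral_add (i2.const_mul ((μ k - b k - 1) * c))
      (i0.const_mul (μ k * (starRingEnd ℂ) c))
    rw [integral_const_mul, integral_const_mul] at hadd
    rw [← hadd]
    have key := integral_bilinear_hasLineDerivAt_right_eq_neg_left_of_integrable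
      (μ := (volume : Measure (Fin n → ℂ))) (B := ContinuousLinearMap.mul ℝ ℂ)
      (v := Pi.single k c) (f := fun ζ => φ ζ * Q ζ)
      (f' := fun ζ => fderiv ℝ φ ζ (Pi.single k c) * Q ζ)
      (g := fun ζ => monoKernel (b k + 1) (μ k + 1) (ζ k))
      (g' := fun ζ => (μ k - b k - 1) * c * monoKernel (b k + 2) (μ k + 1) (ζ k)
        + μ k * (starRingEnd ℂ) c * monoKernel (b k) (μ k) (ζ k)) ?_ ?_ ?_ ?_ ?_
    · simp only [ContinuousLinearMap.mul_apply'] at key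
      rw [← key]
      congr 1
      ext ζ
      ring
    · simpa only [ContinuousLinearMap.mul_apply'] using i3 _
    · simp only [ContinuousLinearMap.mul_apply']
      refine hlin.congr (.of_forall fun ζ => ?_)
      simp only [Pi.add_apply]
      ring
    · simpa only [ContinuousLinearMap.mul_apply'] using i1
    · intro ζ _
      have hQc : ∀ t : ℝ, Q (ζ + t • (Pi.single k c : Fin n → ℂ)) = Q ζ := by
        intro t
        refine Finset.prod_congr rfl fun i hi => ?_
        simp [Finset.ne_of_mem_erase hi]
      have h1 := ((hφ.differentiable (by simp)).differentiableAt (x := ζ)).hasFDerivAt.hasLineDerivAt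
        (Pi.single k c)
      unfold HasLineDerivAt at h1 ⊢
      simp only [hQc]
      exact h1.mul_const (Q ζ)
    · intro ζ _
      have := hasDerivAt_monoKernel_line hk hk1 (ζ k) c
      unfold HasLineDerivAt
      simpa using this
  have h1 := hibp 1
  have hI := hibp Complex.I
  have hT : polyMellin φ b μ = ∫ ζ, φ ζ * Q ζ * monoKernel (b k) (μ k) (ζ k) := by
    simp only [polyMellin, mul_assoc, e0]
  have hD : polyMellin (dbar k φ) (b + Pi.single k 1) (μ + Pi.single k 1)
      = 1 / 2 * ((∫ ζ, fderiv ℝ φ ζ (Pi.single k 1) * Q ζ * monoKernel (b k + 1) (μ k + 1) (ζ k))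
        + Complex.I * ∫ ζ, fderiv ℝ φ ζ (Pi.single k Complex.I) * Q ζ
          * monoKernel (b k + 1) (μ k + 1) (ζ k)) := by
    rw [← integral_const_mul Complex.I, ← integral_add (i3 _) ((i3 _).const_mul _),
      ← integral_const_mul]
    simp only [polyMellin, ← e1, dbar]
    congr 1
    ext ζ
    ring
  rw [hT, hD]
  simp only [map_one, Complex.conj_I] at h1 hI
  -- Half of the identity for `c = 1` plus `i` times that for `c = i`: the `∂` terms cancel since `1
  -- + i·i = 0`, and the `∂̄` terms add up since `1 + i·ī = 2`.
  linear_combination (1 / 2 : ℂ) * h1 + (1 / 2 : ℂ) * Complex.I * hI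
    + (1 / 2 : ℂ) * (-(μ k - b k - 1) * (∫ ζ, φ ζ * Q ζ * monoKernel (b k + 2) (μ k + 1) (ζ k))
      + μ k * (∫ ζ, φ ζ * Q ζ * monoKernel (b k) (μ k) (ζ k))) * Complex.I_sq

theorem isPreconnected_re_gt (b : Fin n → ℤ) :
    IsPreconnected {μ : Fin n → ℂ | ∀ k, b k < 2 * (μ k).re} := by
  suffices h : Convex ℝ {μ : Fin n → ℂ | ∀ k, b k < 2 * (μ k).re} from h.isPreconnected
  intro x hx y hy s t hs ht hst k
  have h1 := hx k
  have h2 := hy k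
  simp only [Pi.add_apply, Pi.smul_apply, Complex.add_re, Complex.smul_re, smul_eq_mul]
  have h3 : (b k : ℝ) = s * b k + t * b k := by rw [← add_mul, hst, one_mul]
  rw [h3]
  rcases hs.eq_or_lt with rfl | hs'
  · have : t = 1 := by linarith
    subst this
    linarith
  · nlinarith [mul_lt_mul_of_pos_left h1 hs', mul_le_mul_of_nonneg_left h2.le ht]

/-- Both sides are analytic on the convex domain of convergence and agree where the real parts are
large, so the identity theorem removes the extra assumptions of `mul_polyMellin_eq_of_lt`. -/
theorem mul_polyMellin_eq {φ : (Fin n → ℂ) → ℂ} (hφ : ContDiff ℝ ∞ φ)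
    (hs : HasCompactSupport φ) {b : Fin n → ℤ} {μ : Fin n → ℂ} (hμ : ∀ k, b k < 2 * (μ k).re)
    (k : Fin n) :
    μ k * polyMellin φ b μ
      = -polyMellin (dbar k φ) (b + Pi.single k 1) (μ + Pi.single k 1) := by
  set U : Set (Fin n → ℂ) := {μ | ∀ k, b k < 2 * (μ k).re} with hU
  have hL : AnalyticOnNhd ℂ (fun μ : Fin n → ℂ => μ k * polyMellin φ b μ) U := fun z hz =>
    ((ContinuousLinearMap.proj (R := ℂ) (φ := fun _ : Fin n => ℂ) k).analyticAt z).mul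
      (analyticAt_polyMellin hφ.continuous hs hz)
  have hR : AnalyticOnNhd ℂ (fun μ : Fin n → ℂ =>
      -polyMellin (dbar k φ) (b + Pi.single k 1) (μ + Pi.single k 1)) U := by
    intro z hz
    refine AnalyticAt.neg (AnalyticAt.comp (f := fun μ : Fin n → ℂ => μ + Pi.single k 1)
      (analyticAt_polyMellin (contDiff_dbar hφ k).continuous (hasCompactSupport_dbar hs k) ?_)
      (by fun_prop))
    intro i
    rcases eq_or_ne i k with rfl | hi
    · have := hz i
      simp
      linarith
    · simpa [hi] using hz i
  -- The shift by `5` gives room for both `b i + 3 < 2 Re z_i` and `1 < Re z_k` near `z₀`.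
  set z₀ : Fin n → ℂ := fun i => ((|(b i : ℝ)| + 5 : ℝ) : ℂ) with hz₀
  have hz₀U : z₀ ∈ U := by
    intro i
    simp only [hz₀, Complex.ofReal_re]
    linarith [le_abs_self (b i : ℝ), abs_nonneg (b i : ℝ)]
  refine hL.eqOn_of_preconnected_of_eventuallyEq hR (isPreconnected_re_gt b) hz₀U ?_ hμ
  have hopen : ∀ᶠ z : Fin n → ℂ in 𝓝 z₀,
      (∀ i, b i + 3 < 2 * (z i).re) ∧ 1 < (z k).re := by
    refine (eventually_all.2 fun i => ?_).and ?_
    · have hc : Continuous fun z : Fin n → ℂ => 2 * (z i).re :=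
        continuous_const.mul (Complex.continuous_re.comp (continuous_apply i))
      refine hc.continuousAt.eventually (lt_mem_nhds ?_)
      simp only [hz₀, Complex.ofReal_re]
      linarith [le_abs_self (b i : ℝ), abs_nonneg (b i : ℝ)]
    · have hc : Continuous fun z : Fin n → ℂ => (z k).re :=
        Complex.continuous_re.comp (continuous_apply k)
      refine hc.continuousAt.eventually (lt_mem_nhds ?_)
      simp only [hz₀, Complex.ofReal_re]
      linarith [abs_nonneg (b k : ℝ)]
  filter_upwards [hopen] with z hz
  exact mul_polyMellin_eq_of_lt hφ hs (fun i => by linarith [hz.1 i]) k (hz.1 k) hz.2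

end

/-! ### Entire continuation after division by Gamma factors -/

section

variable {n : ℕ}

/-- The integral `polyMellin φ b μ` divided by `∏ Γ(μ_k)`. -/
def regMellin (φ : (Fin n → ℂ) → ℂ) (b : Fin n → ℤ) (μ : Fin n → ℂ) : ℂ :=
  polyMellin φ b μ * ∏ k, (Complex.Gamma (μ k))⁻¹

/-- There are no exceptional points: `Complex.Gamma` takes the value `0` at its poles, so its
inverse is the entire function `1/Γ`. -/
theorem inv_Gamma_eq (z : ℂ) :
    (Complex.Gamma z)⁻¹ = z * (Complex.Gamma (z + 1))⁻¹ := by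
  simpa using Complex.one_div_Gamma_eq_self_mul_one_div_Gamma_add_one z

theorem lt_two_mul_re_add_single {b : Fin n → ℤ} {μ : Fin n → ℂ} (hμ : ∀ k, b k < 2 * (μ k).re)
    (k i : Fin n) :
    ((b + Pi.single k 1 : Fin n → ℤ) i : ℝ) < 2 * ((μ + Pi.single k 1 : Fin n → ℂ) i).re := by
  rcases eq_or_ne i k with rfl | hi
  · simp
    linarith [hμ i]
  · simpa [hi] using hμ i

/-- This is the reason for the division by Gamma functions: the factor `μ_k` from integration by
parts is absorbed by `1/Γ(μ_k) = μ_k/Γ(μ_k + 1)`, so the recursion never divides by `μ_k`. -/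
theorem regMellin_eq_neg {φ : (Fin n → ℂ) → ℂ} (hφ : ContDiff ℝ ∞ φ)
    (hs : HasCompactSupport φ) {b : Fin n → ℤ} {μ : Fin n → ℂ} (hμ : ∀ k, b k < 2 * (μ k).re)
    (k : Fin n) :
    regMellin φ b μ = -regMellin (dbar k φ) (b + Pi.single k 1) (μ + Pi.single k 1) := by
  have h1 : ∏ i, (Complex.Gamma (μ i))⁻¹
      = μ k * ∏ i, (Complex.Gamma ((μ + Pi.single k 1 : Fin n → ℂ) i))⁻¹ := by
    have h2 := Finset.mul_prod_erase Finset.univ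
      (fun i => (Complex.Gamma ((μ + Pi.single k 1 : Fin n → ℂ) i))⁻¹) (Finset.mem_univ k)
    have h3 := Finset.mul_prod_erase Finset.univ
      (fun i => (Complex.Gamma (μ i))⁻¹) (Finset.mem_univ k)
    rw [← h2, ← h3, ← mul_assoc, inv_Gamma_eq (μ k)]
    congr 1
    · simp
    · refine Finset.prod_congr rfl fun i hi => ?_
      simp [Finset.ne_of_mem_erase hi]
  rw [regMellin, h1, ← mul_assoc, mul_comm _ (μ k), mul_polyMellin_eq hφ hs hμ k, regMellin,
    neg_mul]

/-- The iterated Wirtinger derivative along a list of coordinates. -/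
def dbarList (l : List (Fin n)) (φ : (Fin n → ℂ) → ℂ) : (Fin n → ℂ) → ℂ :=
  l.foldl (fun ψ k => dbar k ψ) φ

theorem dbarList_regular {φ : (Fin n → ℂ) → ℂ} (hφ : ContDiff ℝ ∞ φ)
    (hs : HasCompactSupport φ) (l : List (Fin n)) :
    ContDiff ℝ ∞ (dbarList l φ) ∧ HasCompactSupport (dbarList l φ) := by
  induction l generalizing φ with
  | nil => exact ⟨hφ, hs⟩
  | cons k l ih => exact ih (contDiff_dbar hφ k) (hasCompactSupport_dbar hs k)

theorem regMellin_dbarList {φ : (Fin n → ℂ) → ℂ} (hφ : ContDiff ℝ ∞ φ)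
    (hs : HasCompactSupport φ) {b : Fin n → ℤ} {μ : Fin n → ℂ} (hμ : ∀ k, b k < 2 * (μ k).re)
    (l : List (Fin n)) :
    regMellin φ b μ = (-1) ^ l.length * regMellin (dbarList l φ)
      (b + (l.map fun k => (Pi.single k 1 : Fin n → ℤ)).sum)
      (μ + (l.map fun k => (Pi.single k 1 : Fin n → ℂ)).sum) := by
  induction l generalizing φ b μ with
  | nil => simp [dbarList]
  | cons k l ih =>
    rw [regMellin_eq_neg hφ hs hμ k, ih (contDiff_dbar hφ k) (hasCompactSupport_dbar hs k)
      (lt_two_mul_re_add_single hμ k)]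
    simp only [List.map_cons, List.sum_cons, List.length_cons, add_assoc, pow_succ, dbarList,
      List.foldl_cons]
    ring

/-- The derivative `∂ⁿ/∂ζ̄₁ ⋯ ∂ζ̄ₙ`. -/
def dbarAll (φ : (Fin n → ℂ) → ℂ) : (Fin n → ℂ) → ℂ := dbarList (List.finRange n) φ

theorem regMellin_dbarAll {φ : (Fin n → ℂ) → ℂ} (hφ : ContDiff ℝ ∞ φ)
    (hs : HasCompactSupport φ) {b : Fin n → ℤ} {μ : Fin n → ℂ} (hμ : ∀ k, b k < 2 * (μ k).re) :
    regMellin φ b μ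
      = (-1) ^ n * regMellin (dbarAll φ) (fun k => b k + 1) (fun k => μ k + 1) := by
  rw [regMellin_dbarList hφ hs hμ (List.finRange n), List.length_finRange, ← Fin.sum_univ_def,
    ← Fin.sum_univ_def, dbarAll]
  congr 2
  · ext k
    have := congrFun (Finset.univ_sum_single (fun _ : Fin n => (1 : ℤ))) k
    simp only [Pi.add_apply, this]
  · ext k
    have := congrFun (Finset.univ_sum_single (fun _ : Fin n => (1 : ℂ))) k
    simp only [Pi.add_apply, this]

theorem dbarAll_iterate_regular {φ : (Fin n → ℂ) → ℂ} (hφ : ContDiff ℝ ∞ φ)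
    (hs : HasCompactSupport φ) (N : ℕ) :
    ContDiff ℝ ∞ (dbarAll^[N] φ) ∧ HasCompactSupport (dbarAll^[N] φ) := by
  induction N with
  | zero => exact ⟨hφ, hs⟩
  | succ N ih =>
    rw [Function.iterate_succ_apply']
    exact dbarList_regular ih.1 ih.2 _

/-- The expression for the continuation of `regMellin φ b` after `N` integrations by parts in
each variable. -/
def regMellinStep (φ : (Fin n → ℂ) → ℂ) (b : Fin n → ℤ) (N : ℕ) (μ : Fin n → ℂ) : ℂ :=
  (-1) ^ (n * N) * regMellin (dbarAll^[N] φ) (fun k => b k + N) (fun k => μ k + N)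

/-- A round of integrations by parts raises `b_k` by `1` but `2 Re μ_k` by `2`. After `N` rounds the
convergence condition is `b_k < 2 Re μ_k + N`, and these domains exhaust `ℂⁿ`. -/
theorem regMellinStep_succ {φ : (Fin n → ℂ) → ℂ} (hφ : ContDiff ℝ ∞ φ)
    (hs : HasCompactSupport φ) {b : Fin n → ℤ} {N : ℕ} {μ : Fin n → ℂ}
    (hμ : ∀ k, b k < 2 * (μ k).re + N) :
    regMellinStep φ b N μ = regMellinStep φ b (N + 1) μ := by
  obtain ⟨h1, h2⟩ := dbarAll_iterate_regular hφ hs N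
  rw [regMellinStep, regMellin_dbarAll h1 h2, regMellinStep, Function.iterate_succ_apply',
    ← mul_assoc, ← pow_add, mul_add, mul_one]
  · congr 2
    · ext k
      push_cast
      ring
    · ext k
      push_cast
      ring
  · intro k
    push_cast
    simp
    linarith [hμ k]

theorem regMellinStep_eq {φ : (Fin n → ℂ) → ℂ} (hφ : ContDiff ℝ ∞ φ)
    (hs : HasCompactSupport φ) {b : Fin n → ℤ} {N N' : ℕ} {μ : Fin n → ℂ}
    (hμ : ∀ k, b k < 2 * (μ k).re + N) (hμ' : ∀ k, b k < 2 * (μ k).re + N') :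
    regMellinStep φ b N μ = regMellinStep φ b N' μ := by
  wlog h : N ≤ N' generalizing N N'
  · exact (this hμ' hμ (le_of_not_ge h)).symm
  induction N', h using Nat.le_induction with
  | base => rfl
  | succ N' hN ih =>
    have h1 : ∀ k, b k < 2 * (μ k).re + N' := fun k =>
      (hμ k).trans_le (by gcongr)
    rw [ih h1, regMellinStep_succ hφ hs h1]

theorem analyticAt_inv_Gamma (z : ℂ) : AnalyticAt ℂ (fun s => (Complex.Gamma s)⁻¹) z :=
  Complex.differentiable_one_div_Gamma.analyticAt z

theorem analyticAt_coord (k : Fin n) (μ : Fin n → ℂ) : AnalyticAt ℂ (fun z : Fin n → ℂ => z k) μ :=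
  (ContinuousLinearMap.proj (R := ℂ) (φ := fun _ : Fin n => ℂ) k).analyticAt μ

theorem analyticAt_regMellin {φ : (Fin n → ℂ) → ℂ} (hφ : Continuous φ)
    (hs : HasCompactSupport φ) {b : Fin n → ℤ} {μ : Fin n → ℂ} (hμ : ∀ k, b k < 2 * (μ k).re) :
    AnalyticAt ℂ (regMellin φ b) μ := by
  refine (analyticAt_polyMellin hφ hs hμ).mul ?_
  refine Finset.analyticAt_fun_prod _ fun k _ => ?_
  exact (analyticAt_inv_Gamma (μ k)).comp (f := fun z : Fin n → ℂ => z k) (analyticAt_coord k μ)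

theorem analyticAt_regMellinStep {φ : (Fin n → ℂ) → ℂ} (hφ : ContDiff ℝ ∞ φ)
    (hs : HasCompactSupport φ) {b : Fin n → ℤ} {N : ℕ} {μ : Fin n → ℂ}
    (hμ : ∀ k, b k < 2 * (μ k).re + N) : AnalyticAt ℂ (regMellinStep φ b N) μ := by
  obtain ⟨h1, h2⟩ := dbarAll_iterate_regular hφ hs N
  refine analyticAt_const.mul (AnalyticAt.comp (f := fun z : Fin n → ℂ => fun k => z k + (N : ℂ))
    (analyticAt_regMellin h1.continuous h2 ?_) ?_)
  · intro k
    push_cast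
    simp
    linarith [hμ k]
  · exact analyticAt_id.add analyticAt_const

/-- The quotient of the integral by `∏ Γ(μ_k)` extends to an entire function. -/
theorem exists_entire_regMellin {φ : (Fin n → ℂ) → ℂ} (hφ : ContDiff ℝ ∞ φ)
    (hs : HasCompactSupport φ) (b : Fin n → ℤ) :
    ∃ E : (Fin n → ℂ) → ℂ, (∀ μ, AnalyticAt ℂ E μ) ∧
      ∀ (N : ℕ) (μ : Fin n → ℂ), (∀ k, b k < 2 * (μ k).re + N) → E μ = regMellinStep φ b N μ := by
  have hex : ∀ μ : Fin n → ℂ, ∃ N : ℕ, ∀ k, (b k : ℝ) < 2 * (μ k).re + N := by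
    intro μ
    obtain ⟨N, hN⟩ := exists_nat_gt (∑ k, |(b k : ℝ) - 2 * (μ k).re|)
    refine ⟨N, fun k => ?_⟩
    have h1 := Finset.single_le_sum (f := fun k => |(b k : ℝ) - 2 * (μ k).re|)
      (fun _ _ => abs_nonneg _) (Finset.mem_univ k)
    linarith [le_abs_self ((b k : ℝ) - 2 * (μ k).re)]
  choose N hN using hex
  have hE : ∀ (M : ℕ) (μ : Fin n → ℂ), (∀ k, b k < 2 * (μ k).re + M) →
      regMellinStep φ b (N μ) μ = regMellinStep φ b M μ :=
    fun M μ hM => regMellinStep_eq hφ hs (hN μ) hM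
  refine ⟨fun μ => regMellinStep φ b (N μ) μ, fun μ => ?_, hE⟩
  refine (analyticAt_regMellinStep hφ hs (hN μ)).congr ?_
  -- The number of rounds chosen at `μ` also works nearby, so locally the patched function is a
  -- single analytic expression.
  have hopen : ∀ᶠ z : Fin n → ℂ in 𝓝 μ, ∀ k, (b k : ℝ) < 2 * (z k).re + N μ := by
    refine eventually_all.2 fun k => ?_
    have hc : Continuous fun z : Fin n → ℂ => 2 * (z k).re + N μ :=
      (continuous_const.mul (Complex.continuous_re.comp (continuous_apply k))).add
        continuous_const
    exact hc.continuousAt.eventually (lt_mem_nhds (hN μ k))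
  filter_upwards [hopen] with z hz
  exact (hE _ z hz).symm

/-- The quotient is the product of `1/(z + j)` for `j < N`, and `|z + j| ≥ Re z ≥ c`. -/
theorem norm_Gamma_mul_inv_Gamma_add_le {c : ℝ} (hc : 0 < c) (N : ℕ) {z : ℂ} (hz : c ≤ z.re) :
    ‖Complex.Gamma z * (Complex.Gamma (z + N))⁻¹‖ ≤ c⁻¹ ^ N := by
  induction N with
  | zero =>
    have : Complex.Gamma z ≠ 0 := Complex.Gamma_ne_zero_of_re_pos (hc.trans_le hz)
    simp [this]
  | succ N ih =>
    have h1 : c ≤ (z + N).re := by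
      simp
      linarith [(Nat.cast_nonneg N : (0 : ℝ) ≤ N)]
    have h0 : z + N ≠ 0 := by
      intro h
      rw [h, Complex.zero_re] at h1
      linarith
    have h2 : (Complex.Gamma (z + (N + 1 : ℕ)))⁻¹
        = (z + N)⁻¹ * (Complex.Gamma (z + N))⁻¹ := by
      rw [inv_Gamma_eq (z + N), inv_mul_cancel_left₀ h0]
      push_cast
      ring_nf
    rw [h2, mul_left_comm, norm_mul, pow_succ']
    refine mul_le_mul ?_ ih (norm_nonneg _) (by positivity)
    rw [norm_inv]
    exact inv_anti₀ hc (h1.trans (Complex.re_le_norm _))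

/-- After `N` rounds the function `E` carries factors `1/Γ(μ_k + N)`. For `N ≥ d_k` the quotients
`Γ(μ_k + d_k)/Γ(μ_k + N)` are bounded, and so is the convergent integral. Hence multiplication by
the Gamma factors costs no growth in the imaginary directions; the shifts `d_k` allow real parts
beyond the first poles. -/
theorem exists_norm_Gamma_mul_regMellin_le {φ : (Fin n → ℂ) → ℂ} (hφ : ContDiff ℝ ∞ φ)
    (hs : HasCompactSupport φ) {b : Fin n → ℤ} {E : (Fin n → ℂ) → ℂ}
    (hE : ∀ (N : ℕ) (μ : Fin n → ℂ), (∀ k, b k < 2 * (μ k).re + N) → E μ = regMellinStep φ b N μ)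
    (d : Fin n → ℕ) {x₁ x₂ : Fin n → ℝ} (hx : ∀ k, x₁ k ≤ x₂ k) (hd : ∀ k, 0 < x₁ k + d k) :
    ∃ B : ℝ, 0 ≤ B ∧ ∀ μ : Fin n → ℂ, (∀ k, x₁ k ≤ (μ k).re ∧ (μ k).re ≤ x₂ k) →
      ‖(∏ k, Complex.Gamma (μ k + d k)) * E μ‖ ≤ B := by
  obtain ⟨N, hN⟩ := exists_nat_gt (∑ k, (|(b k : ℝ) - 2 * x₁ k| + d k))
  have hN' : ∀ k, |(b k : ℝ) - 2 * x₁ k| + d k < N := fun k =>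
    (Finset.single_le_sum (f := fun k => |(b k : ℝ) - 2 * x₁ k| + d k)
      (fun _ _ => by positivity) (Finset.mem_univ k)).trans_lt hN
  have hb : ∀ k, (b k : ℝ) < 2 * x₁ k + N := fun k => by
    have := hN' k
    have h2 := le_abs_self ((b k : ℝ) - 2 * x₁ k)
    have h3 : (0 : ℝ) ≤ d k := Nat.cast_nonneg _
    linarith
  have hdN : ∀ k, d k ≤ N := fun k => by
    have := hN' k
    have h2 := abs_nonneg ((b k : ℝ) - 2 * x₁ k)
    have h3 : (d k : ℝ) < N := by linarith
    exact_mod_cast h3.le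
  obtain ⟨h1, h2⟩ := dbarAll_iterate_regular hφ hs N
  obtain ⟨B, hB, hBμ⟩ := exists_norm_polyMellin_le h1.continuous h2 (b := fun k => b k + N)
    (x₁ := fun k => x₁ k + N) (x₂ := fun k => x₂ k + N)
    (fun k => by push_cast; linarith [hb k]) (fun k => by push_cast; linarith [hb k, hx k])
  refine ⟨B * ∏ k, (x₁ k + d k)⁻¹ ^ (N - d k), mul_nonneg hB
    (Finset.prod_nonneg fun k _ => pow_nonneg (inv_nonneg.2 (hd k).le) _), fun μ hμ => ?_⟩
  rw [hE N μ fun k => by linarith [hb k, (hμ k).1], regMellinStep, regMellin]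
  have hre : (∏ k, Complex.Gamma (μ k + d k)) * ((-1) ^ (n * N) *
      (polyMellin (dbarAll^[N] φ) (fun k => b k + N) (fun k => μ k + N)
        * ∏ k, (Complex.Gamma (μ k + N))⁻¹))
      = (-1) ^ (n * N) * (polyMellin (dbarAll^[N] φ) (fun k => b k + N) (fun k => μ k + N)
        * ∏ k, (Complex.Gamma (μ k + d k) * (Complex.Gamma (μ k + N))⁻¹)) := by
    rw [Finset.prod_mul_distrib]
    ring
  rw [hre, norm_mul, norm_pow, norm_neg, norm_one, one_pow, one_mul, norm_mul, norm_prod]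
  refine mul_le_mul (hBμ _ fun k => ?_) (Finset.prod_le_prod (fun _ _ => norm_nonneg _)
    fun k _ => ?_) (Finset.prod_nonneg fun _ _ => norm_nonneg _) hB
  · simp
    exact hμ k
  · have h3 : μ k + N = μ k + d k + ((N - d k : ℕ) : ℂ) := by
      rw [Nat.cast_sub (hdN k)]
      ring
    rw [h3]
    refine norm_Gamma_mul_inv_Gamma_add_le (hd k) _ ?_
    simp
    exact (hμ k).1

end

/-! ### The continuation of the Mellin transform and its polar set -/

section

variable {p n : ℕ}

open Classical in
/-- The exponents `μ_k` for which the Mellin density is a product of kernels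
`|ζ_k|^{2(μ_k-1)} ζ_k^{-b_k}`. -/
def mellinExp (A : Matrix (Fin p) (Fin n) ℕ) (I : Fin p ↪o Fin n) (s : Fin p → ℂ) (k : Fin n) : ℂ :=
  col ℂ A k s + if k ∈ Set.range I then 0 else 1

open Classical in
/-- The exponents `b_k` for which the Mellin density is a product of kernels
`|ζ_k|^{2(μ_k-1)} ζ_k^{-b_k}`. -/
def mellinOrder (A : Matrix (Fin p) (Fin n) ℕ) (I : Fin p ↪o Fin n) (k : Fin n) : ℤ :=
  if k ∈ Set.range I then (colSum A k : ℤ) - 1 else colSum A k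

open Classical in
/-- The indicator function of the members of `I` at the positions in the list `J`. -/
def listShift (I : Fin p ↪o Fin n) (J : List (Fin p)) (k : Fin n) : ℕ :=
  if ∃ j ∈ J, I j = k then 1 else 0

theorem mellinExp_apply (A : Matrix (Fin p) (Fin n) ℕ) (I : Fin p ↪o Fin n) (s : Fin p → ℂ)
    (j : Fin p) : mellinExp A I s (I j) = col ℂ A (I j) s := by
  simp [mellinExp]

theorem mellinExp_of_notMem (A : Matrix (Fin p) (Fin n) ℕ) (I : Fin p ↪o Fin n) (s : Fin p → ℂ)
    {k : Fin n} (hk : k ∉ Set.range I) : mellinExp A I s k = col ℂ A k s + 1 := by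
  rw [mellinExp, if_neg hk]

theorem listShift_apply (I : Fin p ↪o Fin n) (J : List (Fin p)) (j : Fin p) :
    listShift I J (I j) = if j ∈ J then 1 else 0 := by
  simp [listShift]

theorem listShift_of_notMem (I : Fin p ↪o Fin n) (J : List (Fin p)) {k : Fin n}
    (hk : k ∉ Set.range I) : listShift I J k = 0 := by
  rw [listShift, if_neg]
  rintro ⟨j, -, rfl⟩
  exact hk ⟨j, rfl⟩

theorem prod_eq_prod_mul_prod_filter (I : Fin p ↪o Fin n) (f : Fin n → ℂ)
    [DecidablePred fun k : Fin n => k ∉ Set.range I] :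
    ∏ k, f k = (∏ j, f (I j)) * ∏ k ∈ Finset.univ.filter (fun k => k ∉ Set.range I), f k := by
  classical
  rw [← Finset.prod_filter_not_mul_prod_filter Finset.univ (fun k => k ∉ Set.range I)]
  congr 1
  have h := Finset.prod_map Finset.univ I.toEmbedding f
  simp only [RelEmbedding.coe_toEmbedding] at h
  rw [← h]
  congr 1
  ext k
  simp

theorem mellinDensity_eq (A : Matrix (Fin p) (Fin n) ℕ) (I : Fin p ↪o Fin n) (φ : TestForm p n)
    (s : Fin p → ℂ) (ζ : Fin n → ℂ) :
    mellinDensity A I φ s ζ = φ.coeff I ζ *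
      ∏ k, monoKernel (mellinOrder A I k) (mellinExp A I s k) (ζ k) := by
  rw [prod_eq_prod_mul_prod_filter I, mellinDensity, mul_assoc]
  congr 2
  · refine Finset.prod_congr rfl fun j _ => ?_
    rw [monoKernel, mellinExp_apply, mellinOrder, if_pos ⟨j, rfl⟩]
  · refine Finset.prod_congr rfl fun k hk => ?_
    have hk' : k ∉ Set.range I := by simpa using hk
    rw [monoKernel, mellinExp_of_notMem A I s hk', mellinOrder, if_neg hk', add_sub_cancel_right,
      zpow_natCast]

/-- The entire function of the exponents that gives the continuation of the Mellin transform. -/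
def entireMellin (A : Matrix (Fin p) (Fin n) ℕ) (I : Fin p ↪o Fin n) (φ : TestForm p n) :
    (Fin n → ℂ) → ℂ :=
  Classical.choose (exists_entire_regMellin (φ.smooth I) (φ.compactSupport I) (mellinOrder A I))

theorem analyticAt_entireMellin (A : Matrix (Fin p) (Fin n) ℕ) (I : Fin p ↪o Fin n)
    (φ : TestForm p n) (μ : Fin n → ℂ) : AnalyticAt ℂ (entireMellin A I φ) μ :=
  (Classical.choose_spec (exists_entire_regMellin (φ.smooth I) (φ.compactSupport I)
    (mellinOrder A I))).1 μ

theorem entireMellin_eq (A : Matrix (Fin p) (Fin n) ℕ) (I : Fin p ↪o Fin n)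
    (φ : TestForm p n) (N : ℕ) (μ : Fin n → ℂ)
    (hμ : ∀ k, mellinOrder A I k < 2 * (μ k).re + N) :
    entireMellin A I φ μ = regMellinStep (φ.coeff I) (mellinOrder A I) N μ :=
  (Classical.choose_spec (exists_entire_regMellin (φ.smooth I) (φ.compactSupport I)
    (mellinOrder A I))).2 N μ hμ

/-- The constant factor of the Mellin transform. -/
def mellinConst (A : Matrix (Fin p) (Fin n) ℕ) (I : Fin p ↪o Fin n) : ℂ :=
  cSign I * (minor A I : ℂ) / (2 * Real.pi * Complex.I) ^ p * (2 * Complex.I) ^ n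

/-- The continuation of the Mellin transform, multiplied by the linear forms `⟨αʲ, s⟩` for the
members of `I` at the positions in `J`. -/
def mellinReg (A : Matrix (Fin p) (Fin n) ℕ) (I : Fin p ↪o Fin n) (φ : TestForm p n)
    (J : List (Fin p)) (s : Fin p → ℂ) : ℂ :=
  mellinConst A I * ((∏ k, Complex.Gamma (mellinExp A I s k + listShift I J k))
    * entireMellin A I φ (mellinExp A I s))

theorem Gamma_eq_zero_iff_nat (z : ℂ) : Complex.Gamma z = 0 ↔ ∃ ν : ℕ, z = -(ν : ℂ) :=
  Complex.Gamma_eq_zero_iff z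

/-- `Complex.Gamma` vanishes exactly at the poles, so a polar hyperplane is the zero set of a Gamma
factor in this convention. The exponent shift by `1` off `I` makes `ν` start at `1`; `listShift`
does the same for the members of `J`. -/
theorem mem_polarSet_iff (A : Matrix (Fin p) (Fin n) ℕ) (I : Fin p ↪o Fin n) (J : List (Fin p))
    (s : Fin p → ℂ) :
    s ∈ polarSet A I J ↔ ∃ k, Complex.Gamma (mellinExp A I s k + listShift I J k) = 0 := by
  simp only [Gamma_eq_zero_iff_nat]
  constructor
  · rintro (⟨j, ν, hj, h⟩ | ⟨k, ν, hk, hν, h⟩)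
    · refine ⟨I j, ?_⟩
      rw [mellinExp_apply, listShift_apply, h]
      split_ifs with hJ
      · obtain ⟨ν, rfl⟩ := Nat.exists_eq_add_of_le' (hj hJ)
        exact ⟨ν, by push_cast; ring⟩
      · exact ⟨ν, by simp⟩
    · obtain ⟨ν, rfl⟩ := Nat.exists_eq_add_of_le' hν
      refine ⟨k, ν, ?_⟩
      rw [mellinExp_of_notMem A I s hk, listShift_of_notMem I J hk, h]
      push_cast
      ring
  · rintro ⟨k, ν, h⟩
    by_cases hk : k ∈ Set.range I
    · obtain ⟨j, rfl⟩ := hk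
      rw [mellinExp_apply, listShift_apply] at h
      left
      split_ifs at h with hJ
      · exact ⟨j, ν + 1, fun _ => by simp, by push_cast at h ⊢; linear_combination h⟩
      · exact ⟨j, ν, fun h => absurd h hJ, by simpa using h⟩
    · rw [mellinExp_of_notMem A I s hk, listShift_of_notMem I J hk] at h
      exact Or.inr ⟨k, ν + 1, hk, by simp, by push_cast at h ⊢; linear_combination h⟩

theorem analyticAt_col (A : Matrix (Fin p) (Fin n) ℕ) (k : Fin n) (s : Fin p → ℂ) :
    AnalyticAt ℂ (fun s => col ℂ A k s) s :=
  (LinearMap.toContinuousLinearMap (col ℂ A k)).analyticAt s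

theorem analyticAt_mellinExp (A : Matrix (Fin p) (Fin n) ℕ) (I : Fin p ↪o Fin n) (k : Fin n)
    (s : Fin p → ℂ) : AnalyticAt ℂ (fun s => mellinExp A I s k) s :=
  (analyticAt_col A k s).add analyticAt_const

theorem isClosed_polarSet (A : Matrix (Fin p) (Fin n) ℕ) (I : Fin p ↪o Fin n)
    (J : List (Fin p)) : IsClosed (polarSet A I J) := by
  have h : polarSet A I J = ⋃ k, {s : Fin p → ℂ |
      (Complex.Gamma (mellinExp A I s k + listShift I J k))⁻¹ = 0} := by
    ext s
    simp [mem_polarSet_iff]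
  rw [h]
  refine isClosed_iUnion_of_finite fun k => isClosed_eq ?_ continuous_const
  have h1 : Continuous fun z : ℂ => (Complex.Gamma z)⁻¹ :=
    Complex.differentiable_one_div_Gamma.continuous
  refine h1.comp (Continuous.add ?_ continuous_const)
  exact continuous_iff_continuousAt.2 fun s => (analyticAt_mellinExp A I k s).continuousAt

theorem analyticAt_Gamma_of_ne_zero {z : ℂ} (hz : Complex.Gamma z ≠ 0) :
    AnalyticAt ℂ Complex.Gamma z := by
  refine ((analyticAt_inv_Gamma z).inv (inv_ne_zero hz)).congr (.of_forall fun s => ?_)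
  simp

theorem analyticAt_mellinReg (A : Matrix (Fin p) (Fin n) ℕ) (I : Fin p ↪o Fin n)
    (φ : TestForm p n) (J : List (Fin p)) {s : Fin p → ℂ} (hs : s ∉ polarSet A I J) :
    AnalyticAt ℂ (mellinReg A I φ J) s := by
  rw [mem_polarSet_iff] at hs
  push Not at hs
  refine analyticAt_const.mul (AnalyticAt.mul ?_ ?_)
  · refine Finset.analyticAt_fun_prod _ fun k _ => ?_
    exact AnalyticAt.comp (f := fun s => mellinExp A I s k + listShift I J k)
      (analyticAt_Gamma_of_ne_zero (hs k)) ((analyticAt_mellinExp A I k s).add analyticAt_const)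
  · refine AnalyticAt.comp (f := fun s => mellinExp A I s) (analyticAt_entireMellin A I φ _) ?_
    rw [analyticAt_pi_iff]
    exact fun k => analyticAt_mellinExp A I k s

/-- The functional equation `Γ(λ + 1) = λ Γ(λ)` for the factor of `j`; all other factors agree. It
fails at `λ = 0` with the convention `Γ(0) = 0`, hence the restriction on `s`. -/
theorem mellinReg_cons (A : Matrix (Fin p) (Fin n) ℕ) (I : Fin p ↪o Fin n)
    (φ : TestForm p n) {J : List (Fin p)} {j : Fin p} (hj : j ∉ J) {s : Fin p → ℂ}
    (hs : col ℂ A (I j) s ≠ 0) :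
    mellinReg A I φ (j :: J) s = col ℂ A (I j) s * mellinReg A I φ J s := by
  have h2 := Finset.mul_prod_erase Finset.univ
    (fun k => Complex.Gamma (mellinExp A I s k + listShift I (j :: J) k)) (Finset.mem_univ (I j))
  have h3 := Finset.mul_prod_erase Finset.univ
    (fun k => Complex.Gamma (mellinExp A I s k + listShift I J k)) (Finset.mem_univ (I j))
  have h4 : ∏ k ∈ Finset.univ.erase (I j),
      Complex.Gamma (mellinExp A I s k + listShift I (j :: J) k)
      = ∏ k ∈ Finset.univ.erase (I j), Complex.Gamma (mellinExp A I s k + listShift I J k) := by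
    refine Finset.prod_congr rfl fun k hk => ?_
    have : listShift I (j :: J) k = listShift I J k := by
      simp [listShift, (Finset.ne_of_mem_erase hk).symm]
    rw [this]
  have h5 : Complex.Gamma (mellinExp A I s (I j) + listShift I (j :: J) (I j))
      = col ℂ A (I j) s * Complex.Gamma (mellinExp A I s (I j) + listShift I J (I j)) := by
    rw [mellinExp_apply, listShift_apply, listShift_apply]
    simp only [List.mem_cons, true_or, if_true, if_neg hj, Nat.cast_one, Nat.cast_zero, add_zero]
    exact Complex.Gamma_add_one _ hs
  rw [mellinReg, mellinReg, ← h2, ← h3, h4, h5]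
  ring

theorem mellinReg_nil_eq (A : Matrix (Fin p) (Fin n) ℕ) (I : Fin p ↪o Fin n)
    (φ : TestForm p n) {J : List (Fin p)} (hJ : J.Nodup) {s : Fin p → ℂ}
    (hs : ∀ j ∈ J, col ℂ A (I j) s ≠ 0) :
    mellinReg A I φ [] s
      = mellinReg A I φ J s * (J.map fun j => (col ℂ A (I j) s)⁻¹).prod := by
  induction J with
  | nil => simp
  | cons j J ih =>
    rw [List.nodup_cons] at hJ
    have hj : col ℂ A (I j) s ≠ 0 := hs j (by simp)
    rw [ih hJ.2 fun i hi => hs i (by simp [hi]), mellinReg_cons A I φ hJ.1 hj, List.map_cons,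
      List.prod_cons]
    field_simp

theorem notMem_polarSet_nil (A : Matrix (Fin p) (Fin n) ℕ) (I : Fin p ↪o Fin n)
    {J : List (Fin p)} {s : Fin p → ℂ} (h : s ∉ polarSet A I J)
    (hs : ∀ j ∈ J, col ℂ A (I j) s ≠ 0) : s ∉ polarSet A I [] := by
  rintro (⟨j, ν, -, hν⟩ | h')
  · refine h (Or.inl ⟨j, ν, fun hj => ?_, hν⟩)
    rcases Nat.eq_zero_or_pos ν with rfl | h0
    · exact absurd (by simpa using hν) (hs j hj)
    · exact h0
  · exact h (Or.inr h')

theorem re_col (A : Matrix (Fin p) (Fin n) ℕ) (k : Fin n) (s : Fin p → ℂ) :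
    (col ℂ A k s).re = col ℝ A k fun i => (s i).re := by
  simp [col]

theorem colSum_le_col (A : Matrix (Fin p) (Fin n) ℕ) (k : Fin n) {x : Fin p → ℝ}
    (hx : ∀ i, 1 < x i) : (colSum A k : ℝ) ≤ col ℝ A k x := by
  simp only [colSum, col, LinearMap.sum_apply, LinearMap.smul_apply, LinearMap.proj_apply,
    smul_eq_mul, Nat.cast_sum]
  exact Finset.sum_le_sum fun i _ => le_mul_of_one_le_right (Nat.cast_nonneg _) (hx i).le

theorem colSum_pos {A : Matrix (Fin p) (Fin n) ℕ} {I : Fin p ↪o Fin n} (hΔ : minor A I ≠ 0)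
    (j : Fin p) : 0 < colSum A (I j) := by
  rw [Nat.pos_iff_ne_zero]
  intro h
  refine hΔ (Matrix.det_eq_zero_of_column_eq_zero j fun i => ?_)
  have := (Finset.sum_eq_zero_iff.1 h) i (Finset.mem_univ i)
  simp [this]

/-- For `Re s_i > 1` the real part of `⟨αᵏ, s⟩` is at least `|αᵏ|`. On `I` this has to be positive,
which holds because a nonzero minor has no zero column; off `I` the shift by `1` suffices. -/
theorem mellinExp_re_pos {A : Matrix (Fin p) (Fin n) ℕ} {I : Fin p ↪o Fin n}
    (hΔ : minor A I ≠ 0) {s : Fin p → ℂ} (hs : ∀ k, 1 < (s k).re) (k : Fin n) :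
    0 < (mellinExp A I s k).re ∧ mellinOrder A I k < 2 * (mellinExp A I s k).re := by
  have h := colSum_le_col A k (x := fun i => (s i).re) hs
  rw [← re_col] at h
  have h0 : (0 : ℝ) ≤ colSum A k := Nat.cast_nonneg _
  by_cases hk : k ∈ Set.range I
  · obtain ⟨j, rfl⟩ := hk
    have h1 : (1 : ℝ) ≤ colSum A (I j) := by exact_mod_cast colSum_pos hΔ j
    rw [mellinExp_apply, mellinOrder, if_pos ⟨j, rfl⟩]
    push_cast
    constructor <;> linarith
  · rw [mellinExp_of_notMem A I s hk, mellinOrder, if_neg hk]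
    push_cast
    simp only [Complex.add_re, Complex.one_re]
    constructor <;> linarith

theorem isMellinContinuation_mellinReg {A : Matrix (Fin p) (Fin n) ℕ} {I : Fin p ↪o Fin n}
    (hΔ : minor A I ≠ 0) (φ : TestForm p n) :
    IsMellinContinuation A I φ (mellinReg A I φ []) := by
  refine ⟨fun s hs => analyticAt_mellinReg A I φ [] hs, fun s hs => ?_⟩
  have hpos := mellinExp_re_pos hΔ hs
  have heq : mellinDensity A I φ s = fun ζ => φ.coeff I ζ *
      ∏ k, monoKernel (mellinOrder A I k) (mellinExp A I s k) (ζ k) :=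
    funext fun ζ => mellinDensity_eq A I φ s ζ
  refine ⟨?_, ?_⟩
  · rw [heq]
    exact integrable_polyMellin (φ.smooth I).continuous (φ.compactSupport I) fun k => (hpos k).2
  · have h1 : (∏ k, Complex.Gamma (mellinExp A I s k))
        * ∏ k, (Complex.Gamma (mellinExp A I s k))⁻¹ = 1 := by
      rw [← Finset.prod_mul_distrib]
      exact Finset.prod_eq_one fun k _ =>
        mul_inv_cancel₀ (Complex.Gamma_ne_zero_of_re_pos (hpos k).1)
    rw [mellinReg, entireMellin_eq A I φ 0 _ fun k => by simpa using (hpos k).2, regMellinStep,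
      mellinIntegral, heq, mellinConst, regMellin]
    simp only [listShift, List.not_mem_nil, false_and, exists_false, if_false, Nat.cast_zero,
      add_zero, mul_zero, pow_zero, one_mul, Function.iterate_zero, id]
    rw [mul_assoc _ ((2 * Complex.I) ^ n), polyMellin]
    linear_combination (cSign I * (minor A I : ℂ) / (2 * Real.pi * Complex.I) ^ p
      * ((2 * Complex.I) ^ n * ∫ ζ : Fin n → ℂ, φ.coeff I ζ *
      ∏ k, monoKernel (mellinOrder A I k) (mellinExp A I s k) (ζ k))) * h1

theorem isMellinContinuation_mellinGamma {A : Matrix (Fin p) (Fin n) ℕ} {I : Fin p ↪o Fin n}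
    (hΔ : minor A I ≠ 0) (φ : TestForm p n) :
    IsMellinContinuation A I φ (mellinGamma A I φ) :=
  Classical.epsilon_spec ⟨_, isMellinContinuation_mellinReg hΔ φ⟩

/-- The complex line through two points of the complement lies in none of the hyperplanes, so it
meets each in at most one point and their union in a countable set; the plane minus a countable set
is connected. -/
theorem isPreconnected_compl_polarSet (A : Matrix (Fin p) (Fin n) ℕ) (I : Fin p ↪o Fin n)
    (J : List (Fin p)) : IsPreconnected (polarSet A I J)ᶜ := by
  refine isPreconnected_of_forall_pair fun s hs t ht => ?_
  set f : ℂ → Fin p → ℂ := fun z => s + z • (t - s) with hf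
  have hfk : ∀ k z, mellinExp A I (f z) k = mellinExp A I s k + z * col ℂ A k (t - s) := by
    intro k z
    simp only [mellinExp, hf, map_add, map_smul, smul_eq_mul]
    ring
  have hB : (f ⁻¹' polarSet A I J).Countable := by
    have : f ⁻¹' polarSet A I J = ⋃ k : Fin n, ⋃ ν : ℕ,
        {z | mellinExp A I s k + z * col ℂ A k (t - s) + listShift I J k = -(ν : ℂ)} := by
      ext z
      simp [mem_polarSet_iff, Gamma_eq_zero_iff_nat, hfk]
    rw [this]
    refine Set.countable_iUnion fun k => Set.countable_iUnion fun ν => ?_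
    refine Set.Subsingleton.countable fun z hz z' hz' => ?_
    simp only [Set.mem_ofPred_eq] at hz hz'
    have h0 : col ℂ A k (t - s) ≠ 0 := by
      intro h
      rw [h, mul_zero, add_zero] at hz
      refine hs ((mem_polarSet_iff A I J s).2 ⟨k, (Gamma_eq_zero_iff_nat _).2 ⟨ν, hz⟩⟩)
    have h1 : (z - z') * col ℂ A k (t - s) = 0 := by linear_combination hz - hz'
    exact sub_eq_zero.1 ((mul_eq_zero.1 h1).resolve_right h0)
  refine ⟨f '' (f ⁻¹' polarSet A I J)ᶜ, ?_, ⟨0, ?_, ?_⟩, ⟨1, ?_, ?_⟩, ?_⟩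
  · rintro _ ⟨z, hz, rfl⟩
    exact hz
  · simpa [hf] using hs
  · simp [hf]
  · simpa [hf] using ht
  · simp [hf]
  · have h1 := Set.Countable.isPathConnected_compl_of_one_lt_rank (E := ℂ)
      (by rw [Complex.rank_real_complex]; norm_num) hB
    exact h1.isConnected.isPreconnected.image f (by fun_prop)

/-- `mellinGamma` is an arbitrary choice of continuation. Two continuations agree near `(2, …, 2)`,
hence on the connected complement of the polar set. -/
theorem mellinGamma_eq {A : Matrix (Fin p) (Fin n) ℕ} {I : Fin p ↪o Fin n}
    (hΔ : minor A I ≠ 0) (φ : TestForm p n) {s : Fin p → ℂ} (hs : s ∉ polarSet A I []) :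
    mellinGamma A I φ s = mellinReg A I φ [] s := by
  obtain ⟨h1, h2⟩ := isMellinContinuation_mellinGamma hΔ φ
  obtain ⟨h3, h4⟩ := isMellinContinuation_mellinReg hΔ φ
  have hz₀ : (fun _ => 2 : Fin p → ℂ) ∈ (polarSet A I [])ᶜ := by
    rw [Set.mem_compl_iff, mem_polarSet_iff]
    rintro ⟨k, hk⟩
    refine Complex.Gamma_ne_zero_of_re_pos ?_ hk
    have := (mellinExp_re_pos hΔ (s := fun _ => 2) (fun _ => by simp) k).1
    simpa [listShift] using this
  refine h1.eqOn_of_preconnected_of_eventuallyEq h3 (isPreconnected_compl_polarSet A I []) hz₀ ?_ hs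
  have hopen : ∀ᶠ z : Fin p → ℂ in 𝓝 (fun _ => 2), ∀ k, 1 < (z k).re := by
    refine eventually_all.2 fun k => ?_
    have hc : Continuous fun z : Fin p → ℂ => (z k).re :=
      Complex.continuous_re.comp (continuous_apply k)
    exact hc.continuousAt.eventually (lt_mem_nhds (by simp))
  filter_upwards [hopen] with z hz
  rw [(h2 z hz).2, (h4 z hz).2]

end

/-! ### Existence and uniqueness of Leray residues along simple poles -/

section

section Linear

variable {E : Type} [AddCommGroup E] [Module ℂ E]

theorem wedgeOne_apply {k : ℕ} (l : E →ₗ[ℂ] ℂ) (χ : E [⋀^Fin k]→ₗ[ℂ] ℂ) (v : Fin (k + 1) → E) :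
    wedgeOne l χ v = ∑ i : Fin (k + 1), (-1) ^ (i : ℕ) * (l (v i) * χ (i.removeNth v)) := by
  simp [wedgeOne, AlternatingMap.alternatizeUncurryFin_apply, LinearMap.smulRight_apply]

theorem wedgeOne_smul {k : ℕ} (l : E →ₗ[ℂ] ℂ) (c : ℂ) (χ : E [⋀^Fin k]→ₗ[ℂ] ℂ) :
    wedgeOne l (c • χ) = c • wedgeOne l χ := by
  ext v
  simp only [wedgeOne_apply, AlternatingMap.smul_apply, smul_eq_mul, Finset.mul_sum]
  exact Finset.sum_congr rfl fun i _ => by ring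

theorem wedgeOne_cons_of_forall_eq_zero {k : ℕ} {l : E →ₗ[ℂ] ℂ} (χ : E [⋀^Fin k]→ₗ[ℂ] ℂ) {w : E}
    (hw : l w = 1) {u : Fin k → E} (hu : ∀ i, l (u i) = 0) :
    wedgeOne l χ (Fin.cons w u) = χ u := by
  rw [wedgeOne_apply, Fin.sum_univ_succ, Finset.sum_eq_zero fun i _ => by
    rw [Fin.cons_succ, hu]; ring]
  simp [hw]

/-- On a space of dimension `k + 1`, a `(k + 1)`-form `ξ` is `l ∧ ι_w ξ` if `l(w) = 1`. -/
theorem wedgeOne_curryLeft [FiniteDimensional ℂ E] {k : ℕ} (hk : Module.finrank ℂ E = k + 1)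
    {l : E →ₗ[ℂ] ℂ} (ξ : E [⋀^Fin (k + 1)]→ₗ[ℂ] ℂ) {w : E} (hw : l w = 1) :
    wedgeOne l (ξ.curryLeft w) = ξ := by
  ext u
  -- A form of degree `k + 2` on a space of dimension `k + 1` vanishes. Its value on `(w, u)` is
  -- `ξ(u)` minus the value of `l ∧ ι_w ξ` on `u`.
  have h0 : wedgeOne l ξ (Fin.cons w u : Fin (k + 1 + 1) → E) = 0 := by
    refine AlternatingMap.map_linearDependent _ _ fun h => ?_
    have := h.fintype_card_le_finrank
    rw [hk, Fintype.card_fin] at this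
    omega
  rw [wedgeOne_apply, Fin.sum_univ_succ] at h0
  rw [wedgeOne_apply]
  have h1 : ∀ i : Fin (k + 1), (-1 : ℂ) ^ ((i.succ : Fin (k + 1 + 1)) : ℕ)
      * (l ((Fin.cons w u : Fin (k + 1 + 1) → E) i.succ)
        * ξ (i.succ.removeNth (Fin.cons w u : Fin (k + 1 + 1) → E)))
      = -((-1) ^ (i : ℕ) * (l (u i) * (ξ.curryLeft w) (i.removeNth u))) := by
    intro i
    have h2 : i.succ.removeNth (Fin.cons w u : Fin (k + 1 + 1) → E)
        = Matrix.vecCons w (i.removeNth u) := Fin.cons_comp_succ_succAbove w u i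
    rw [Fin.cons_succ, h2, Fin.val_succ, pow_succ, AlternatingMap.curryLeft_apply_apply]
    ring
  simp only [h1, Finset.sum_neg_distrib, Fin.cons_zero, hw, Fin.removeNth_zero, Fin.tail_cons,
    Fin.val_zero, pow_zero, one_mul] at h0
  linear_combination -h0

end Linear

variable {V : Type} [NormedAddCommGroup V] [NormedSpace ℂ V]

theorem finrank_inf_ker [FiniteDimensional ℂ V] {W : Submodule ℂ V} {l : V →ₗ[ℂ] ℂ} {w : V}
    (hw : w ∈ W) (hl : l w = 1) :
    Module.finrank ℂ (W ⊓ LinearMap.ker l : Submodule ℂ V) + 1 = Module.finrank ℂ W := by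
  have h1 := LinearMap.finrank_range_add_finrank_ker (l ∘ₗ W.subtype)
  have h2 : LinearMap.range (l ∘ₗ W.subtype) = ⊤ := by
    rw [LinearMap.range_eq_top]
    intro c
    exact ⟨c • ⟨w, hw⟩, by simp [hl]⟩
  rw [h2, finrank_top, Module.finrank_self] at h1
  have h3 : LinearMap.ker (l ∘ₗ W.subtype) = Submodule.comap W.subtype (LinearMap.ker l) := by
    rw [LinearMap.ker_comp]
  rw [h3, ← Submodule.finrank_map_subtype_eq, Submodule.map_comap_subtype] at h1
  omega

/-- The contraction of a form with the vectors `w j`, `j` running through the list. -/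
def contract {ι : Type} (w : ι → V) :
    ∀ (J : List ι) (m : ℕ), V [⋀^Fin (m + J.length)]→ₗ[ℂ] ℂ → V [⋀^Fin m]→ₗ[ℂ] ℂ
  | [], _, ξ => ξ
  | j :: J, m, ξ => contract w J m (AlternatingMap.curryLeft (n := m + J.length) ξ (w j))

/-- `IsLerayResidueAt` determines the residue form at the point. -/
theorem IsLerayResidueAt.eq_smul {W : Submodule ℂ V} {l : V →ₗ[ℂ] ℂ} {k : ℕ}
    {ψ : Form W (k + 1)} {ρ : Form (W ⊓ LinearMap.ker l) k}
    {a : (W ⊓ LinearMap.ker l : Submodule ℂ V)} (h : IsLerayResidueAt W l ψ ρ a) {w : V}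
    (hw : w ∈ W) (hlw : l w = 1) {g : V → ℂ} (hg : ContinuousAt g a)
    {ξ : V [⋀^Fin (k + 1)]→ₗ[ℂ] ℂ}
    (hψ : ∀ᶠ z : W in 𝓝 (sliceIncl W l a), l (z : V) ≠ 0 →
      ψ z = (g z * (l (z : V))⁻¹) • ξ.compLinearMap W.subtype) :
    ρ a = g a • (ξ.curryLeft w).compLinearMap (Submodule.subtype _) := by
  obtain ⟨χ, θ, hχ, hθ, hev, hρ⟩ := h
  rw [hρ.self_of_nhds]
  ext u
  simp only [AlternatingMap.compLinearMap_apply, AlternatingMap.smul_apply, smul_eq_mul]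
  set b := sliceIncl W l a with hb
  set wW : W := ⟨w, hw⟩ with hwW
  set u' : Fin k → W := fun i => sliceIncl W l (u i) with hu'
  have hlu : ∀ i, (l ∘ₗ W.subtype) (u' i) = 0 := fun i => by
    have := (u i).2.2
    simpa [hu'] using this
  have hla : l (b : V) = 0 := by
    have := a.2.2
    simpa [hb] using this
  -- Along `b + t w` the form `l` has the value `t`. Evaluation on `(w, u)`, multiplication by `t`
  -- and `t → 0` eliminate `θ` and leave `χ(u)`, so the residue does not depend on the
  -- decomposition.
  have hpath : Continuous fun t : ℂ => b + t • wW := by fun_prop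
  have hp0 : b + (0 : ℂ) • wW = b := by simp
  have htend : Tendsto (fun t : ℂ => b + t • wW) (𝓝[≠] 0) (𝓝 b) := by
    have := hpath.tendsto 0
    rw [hp0] at this
    exact this.mono_left nhdsWithin_le_nhds
  have hlt : ∀ t : ℂ, l ((b + t • wW : W) : V) = t := by
    intro t
    simp [hla, hwW, hlw]
  have hcomp : ∀ (η : W → ℂ), ContinuousAt η b →
      Tendsto (fun t : ℂ => η (b + t • wW)) (𝓝[≠] 0) (𝓝 (η b)) :=
    fun η hη => Tendsto.comp (x := 𝓝[≠] 0) hη htend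
  have hL : Tendsto (fun t : ℂ => g ((b + t • wW : W) : V)
      * ξ (Matrix.vecCons w fun i => ((u' i : W) : V))) (𝓝[≠] 0)
      (𝓝 (g a * ξ (Matrix.vecCons w fun i => ((u' i : W) : V)))) := by
    refine Tendsto.mul_const _ (hcomp (fun z : W => g z) ?_)
    exact ContinuousAt.comp (f := fun z : W => (z : V)) hg continuous_subtype_val.continuousAt
  have hR : Tendsto (fun t : ℂ => χ (b + t • wW) u'
      + t * θ (b + t • wW) (Fin.cons wW u')) (𝓝[≠] 0) (𝓝 (χ b u' + 0 * θ b (Fin.cons wW u'))) := by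
    refine (hcomp (fun z => χ z u') (hχ u').continuousAt).add
      (Tendsto.mul (tendsto_id.mono_left nhdsWithin_le_nhds) ?_)
    exact hcomp (fun z => θ z (Fin.cons wW u')) (hθ (Fin.cons wW u')).continuousAt
  rw [zero_mul, add_zero] at hR
  refine tendsto_nhds_unique hR (hL.congr' ?_)
  filter_upwards [htend.eventually hev, htend.eventually hψ, self_mem_nhdsWithin] with t h1 h2 ht
  have ht0 : t ≠ 0 := ht
  have h3 := (h2 (by rw [hlt]; exact ht0)).symm.trans (h1 (by rw [hlt]; exact ht0))
  rw [hlt] at h3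
  have h4 := congrArg (fun η : W [⋀^Fin (k + 1)]→ₗ[ℂ] ℂ => η (Fin.cons wW u')) h3
  simp only [AlternatingMap.smul_apply, AlternatingMap.add_apply, smul_eq_mul,
    AlternatingMap.compLinearMap_apply] at h4
  rw [wedgeOne_cons_of_forall_eq_zero _ (by simp [hwW, hlw]) hlu] at h4
  have h5 : (fun i => W.subtype ((Fin.cons wW u' : Fin (k + 1) → W) i))
      = Matrix.vecCons w fun i => ((u' i : W) : V) := by
    ext i
    refine Fin.cases ?_ (fun i => ?_) i
    · simp [hwW]
    · simp
  rw [h5] at h4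
  field_simp at h4
  linear_combination h4

theorem analyticAt_list_prod_inv {ι : Type} {F : Type*} [NormedAddCommGroup F] [NormedSpace ℂ F]
    {f : ι → F → ℂ} {J : List ι} {a : F} (hf : ∀ j ∈ J, AnalyticAt ℂ (f j) a)
    (h0 : ∀ j ∈ J, f j a ≠ 0) : AnalyticAt ℂ (fun z => (J.map fun j => (f j z)⁻¹).prod) a := by
  induction J with
  | nil => simpa using analyticAt_const
  | cons j J ih =>
    simp only [List.map_cons, List.prod_cons]
    exact ((hf j (by simp)).inv (h0 j (by simp))).mul
      (ih (fun i hi => hf i (by simp [hi])) fun i hi => h0 i (by simp [hi]))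

theorem analyticAt_comp_subtype {W : Submodule ℂ V} {g : V → ℂ} {a : W}
    (hg : AnalyticAt ℂ g (a : V)) : AnalyticAt ℂ (fun z : W => g z) a :=
  AnalyticAt.comp (f := fun z : W => (z : V)) hg (W.subtypeL.analyticAt a)

variable [FiniteDimensional ℂ V]

theorem analyticAt_linearMap (l : V →ₗ[ℂ] ℂ) (a : V) : AnalyticAt ℂ (fun z => l z) a :=
  (LinearMap.toContinuousLinearMap l).analyticAt a

theorem eventually_forall_ne_zero {ι : Type} (f : ι → V →ₗ[ℂ] ℂ) {D : Set V} (hD : IsOpen D)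
    {J : List ι} {W : Submodule ℂ V} {a : W} (ha : (a : V) ∈ D) (h0 : ∀ j ∈ J, f j (a : V) ≠ 0) :
    ∀ᶠ z : W in 𝓝 a, (z : V) ∈ D ∧ ∀ j ∈ J, f j (z : V) ≠ 0 := by
  have h1 : ∀ᶠ z : W in 𝓝 a, (z : V) ∈ D :=
    continuous_subtype_val.continuousAt.eventually (hD.mem_nhds ha)
  refine h1.and ?_
  induction J with
  | nil => simp
  | cons j J ih =>
    have h2 : ∀ᶠ z : W in 𝓝 a, f j (z : V) ≠ 0 :=
      (analyticAt_comp_subtype (analyticAt_linearMap (f j) (a : V))).continuousAt.eventually_ne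
        (h0 j (by simp))
    filter_upwards [h2, ih fun i hi => h0 i (by simp [hi])] with z hz1 hz2
    simpa using ⟨hz1, hz2⟩

section Composite

variable {ι : Type} [DecidableEq ι] {f : ι → V →ₗ[ℂ] ℂ} {w : ι → V} {D : Set V} {g : V → ℂ}

/-- A form with simple poles along the hyperplanes has a composite residue. -/
theorem isCompositeResidue_smul_contract (hD : IsOpen D) (hg : ∀ z ∈ D, AnalyticAt ℂ g z)
    {J : List ι} {W : Submodule ℂ V} {m : ℕ} {ψ : Form W (m + J.length)} (hJ : J.Nodup)
    (hwW : ∀ j ∈ J, w j ∈ W) (hfw : ∀ i ∈ J, ∀ j ∈ J, f i (w j) = if i = j then 1 else 0)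
    (hrank : Module.finrank ℂ W = m + J.length) {ξ : V [⋀^Fin (m + J.length)]→ₗ[ℂ] ℂ}
    (hψ : ∀ z : W, (z : V) ∈ D → (∀ j ∈ J, f j (z : V) ≠ 0) →
      ψ z = (g z * (J.map fun j => (f j (z : V))⁻¹).prod) • ξ.compLinearMap W.subtype) :
    IsCompositeResidue f D J W m ψ
      (fun z => g z • (contract w J m ξ).compLinearMap (interKer f J W).subtype) := by
  induction J generalizing W with
  | nil =>
    intro a ha
    rw [hψ a ha (by simp)]
    simp only [List.map_nil, List.prod_nil, mul_one]
    rfl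
  | cons j J ih =>
    rw [List.nodup_cons] at hJ
    have hjw : f j (w j) = 1 := by simpa using hfw j (by simp) j (by simp)
    set ξ' : V [⋀^Fin (m + J.length)]→ₗ[ℂ] ℂ :=
      AlternatingMap.curryLeft (n := m + J.length) ξ (w j) with hξ'
    refine ⟨fun z => (g z * (J.map fun i => (f i (z : V))⁻¹).prod) •
      ξ'.compLinearMap (Submodule.subtype _), fun a ha h0 => ?_, ?_⟩
    -- The formula for the residue makes sense on all of `W` and serves as `χ`; then `θ = 0`,
    -- because `l ∧ ι_w ξ = ξ` on a space whose dimension is the degree of `ξ`.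
    · refine ⟨fun z => (g z * (J.map fun i => (f i (z : V))⁻¹).prod) •
        ξ'.compLinearMap W.subtype, fun _ => 0, ?_, ?_, ?_, ?_⟩
      · intro v
        simp only [AlternatingMap.smul_apply, smul_eq_mul]
        refine AnalyticAt.mul (AnalyticAt.mul ?_ ?_) analyticAt_const
        · exact analyticAt_comp_subtype (a := sliceIncl W (f j) a) (hg _ ha)
        · exact analyticAt_list_prod_inv (f := fun i (z : W) => f i (z : V))
            (fun i _ => analyticAt_comp_subtype (analyticAt_linearMap (f i) _)) h0
      · intro v
        exact analyticAt_const
      · filter_upwards [eventually_forall_ne_zero f hD (a := sliceIncl W (f j) a) ha h0]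
          with z hz hlz
        rw [hψ z hz.1 (by simpa using ⟨hlz, hz.2⟩), wedgeOne_smul, add_zero, smul_smul]
        have h1 := wedgeOne_curryLeft (k := m + J.length) hrank (l := f j ∘ₗ W.subtype)
          (ξ.compLinearMap W.subtype) (w := ⟨w j, hwW j (by simp)⟩) (by simpa using hjw)
        have h2 : AlternatingMap.curryLeft (n := m + J.length) (ξ.compLinearMap W.subtype)
            ⟨w j, hwW j (by simp)⟩ = ξ'.compLinearMap W.subtype := by
          ext u
          simp only [AlternatingMap.curryLeft_apply_apply, AlternatingMap.compLinearMap_apply, hξ']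
          congr 1
          ext i
          refine Fin.cases ?_ (fun i => ?_) i <;> simp
        rw [← h2, h1, List.map_cons, List.prod_cons]
        congr 1
        ring
      · exact .of_forall fun z => rfl
    · refine ih (W := W ⊓ LinearMap.ker (f j)) hJ.2 (fun i hi => ⟨hwW i (by simp [hi]), ?_⟩)
        (fun i hi k hk => hfw i (by simp [hi]) k (by simp [hk])) ?_ fun z _ _ => rfl
      · rw [SetLike.mem_coe, LinearMap.mem_ker, hfw j (by simp) i (by simp [hi]), if_neg]
        rintro rfl
        exact hJ.1 hi
      · have := finrank_inf_ker (hwW j (by simp)) hjw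
        rw [hrank, List.length_cons] at this
        omega

/-- The composite residue of a form with simple poles is determined. -/
theorem IsCompositeResidue.eq_smul_contract (hD : IsOpen D) (hg : ∀ z ∈ D, AnalyticAt ℂ g z)
    {J : List ι} {W : Submodule ℂ V} {m : ℕ} {ψ : Form W (m + J.length)}
    {ρ : Form (interKer f J W) m} (hJ : J.Nodup)
    (hwW : ∀ j ∈ J, w j ∈ W) (hfw : ∀ i ∈ J, ∀ j ∈ J, f i (w j) = if i = j then 1 else 0)
    {ξ : V [⋀^Fin (m + J.length)]→ₗ[ℂ] ℂ}
    (hψ : ∀ z : W, (z : V) ∈ D → (∀ j ∈ J, f j (z : V) ≠ 0) →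
      ψ z = (g z * (J.map fun j => (f j (z : V))⁻¹).prod) • ξ.compLinearMap W.subtype)
    (h : IsCompositeResidue f D J W m ψ ρ) (a : interKer f J W) (ha : (a : V) ∈ D) :
    ρ a = g a • (contract w J m ξ).compLinearMap (interKer f J W).subtype := by
  induction J generalizing W with
  | nil =>
    have h' : ∀ a : W, (a : V) ∈ D → ρ a = ψ a := h
    rw [h' a ha, hψ a ha (by simp)]
    simp only [List.map_nil, List.prod_nil, mul_one]
    rfl
  | cons j J ih =>
    rw [List.nodup_cons] at hJ
    have hjw : f j (w j) = 1 := by simpa using hfw j (by simp) j (by simp)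
    obtain ⟨σ, hσ, hrest⟩ := h
    refine ih (W := W ⊓ LinearMap.ker (f j)) hJ.2 (fun i hi => ⟨hwW i (by simp [hi]), ?_⟩)
      (fun i hi k hk => hfw i (by simp [hi]) k (by simp [hk])) ?_ hrest a ha
    · rw [SetLike.mem_coe, LinearMap.mem_ker, hfw j (by simp) i (by simp [hi]), if_neg]
      rintro rfl
      exact hJ.1 hi
    -- Uniqueness of one residue gives `σ` the same shape with one polar factor fewer, so the
    -- induction hypothesis applies to it.
    · intro z hz h0
      refine (hσ z hz h0).eq_smul (hwW j (by simp)) hjw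
        (g := fun z => g z * (J.map fun i => (f i z)⁻¹).prod) ?_ ?_
      · exact ((hg _ hz).mul (analyticAt_list_prod_inv (f := fun i z => f i z)
          (fun i _ => analyticAt_linearMap (f i) _) h0)).continuousAt
      · filter_upwards [eventually_forall_ne_zero f hD (a := sliceIncl W (f j) z) hz h0]
          with y hy hly
        rw [hψ y hy.1 (by simpa using ⟨hly, hy.2⟩), List.map_cons, List.prod_cons]
        congr 1
        ring

end Composite

end

/-! ### The cone, the dual basis and the distinguished face -/

section

variable {p n : ℕ}

/-- The matrix of the linear forms `⟨αʲ, x⟩`, `j ∈ I`. -/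
def colMatrix (A : Matrix (Fin p) (Fin n) ℕ) (I : Fin p ↪o Fin n) : Matrix (Fin p) (Fin p) ℝ :=
  Matrix.of fun j l => (A l (I j) : ℝ)

/-- The basis of `ℝᵖ` dual to the linear forms `⟨αʲ, x⟩`, `j ∈ I`. -/
def dualVec (A : Matrix (Fin p) (Fin n) ℕ) (I : Fin p ↪o Fin n) (j : Fin p) : Fin p → ℝ :=
  fun l => (colMatrix A I)⁻¹ l j

theorem col_apply {R : Type} [CommRing R] (A : Matrix (Fin p) (Fin n) ℕ) (k : Fin n)
    (x : Fin p → R) : col R A k x = ∑ i, (A i k : R) * x i := by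
  simp [col]

theorem isUnit_det_colMatrix {A : Matrix (Fin p) (Fin n) ℕ} {I : Fin p ↪o Fin n}
    (hΔ : minor A I ≠ 0) : IsUnit (colMatrix A I).det := by
  rw [isUnit_iff_ne_zero]
  have h : (colMatrix A I).det = ((minor A I : ℤ) : ℝ) := by
    rw [minor, ← Matrix.det_transpose, Int.cast_det]
    rfl
  rw [h]
  exact_mod_cast hΔ

theorem col_dualVec {A : Matrix (Fin p) (Fin n) ℕ} {I : Fin p ↪o Fin n}
    (hΔ : minor A I ≠ 0) (i j : Fin p) :
    col ℝ A (I i) (dualVec A I j) = if i = j then 1 else 0 := by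
  have h := congrFun (congrFun (Matrix.mul_nonsing_inv _ (isUnit_det_colMatrix hΔ)) i) j
  rw [Matrix.mul_apply, Matrix.one_apply] at h
  rw [col_apply, ← h]
  rfl

theorem sum_col_smul_dualVec {A : Matrix (Fin p) (Fin n) ℕ} {I : Fin p ↪o Fin n}
    (hΔ : minor A I ≠ 0) (x : Fin p → ℝ) :
    ∑ j, col ℝ A (I j) x • dualVec A I j = x := by
  have h := congrArg (fun M : Matrix (Fin p) (Fin p) ℝ => M.mulVec x)
    (Matrix.nonsing_inv_mul _ (isUnit_det_colMatrix hΔ))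
  simp only [← Matrix.mulVec_mulVec, Matrix.one_mulVec] at h
  conv_rhs => rw [← h]
  ext l
  simp only [Finset.sum_apply, Pi.smul_apply, smul_eq_mul, Matrix.mulVec, dotProduct, dualVec,
    col_apply]
  exact Finset.sum_congr rfl fun j _ => mul_comm _ _

/-- The coefficients of `x₁ + ⋯ + x_p` as a combination of the forms `⟨αʲ, x⟩`, `j ∈ I`. -/
def sumCoeff (A : Matrix (Fin p) (Fin n) ℕ) (I : Fin p ↪o Fin n) (j : Fin p) : ℝ :=
  ∑ l, dualVec A I j l

theorem sum_eq_sum_sumCoeff {A : Matrix (Fin p) (Fin n) ℕ} {I : Fin p ↪o Fin n}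
    (hΔ : minor A I ≠ 0) (x : Fin p → ℝ) :
    ∑ l, x l = ∑ j, sumCoeff A I j * col ℝ A (I j) x := by
  conv_lhs => rw [← sum_col_smul_dualVec hΔ x]
  simp only [Finset.sum_apply, Pi.smul_apply, smul_eq_mul]
  rw [Finset.sum_comm]
  refine Finset.sum_congr rfl fun j _ => ?_
  rw [sumCoeff, ← Finset.mul_sum, mul_comm]

theorem dualVec_mem_cone {A : Matrix (Fin p) (Fin n) ℕ} {I : Fin p ↪o Fin n}
    (hΔ : minor A I ≠ 0) (j : Fin p) : dualVec A I j ∈ cone A I := fun i => by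
  rw [col_dualVec hΔ]
  split_ifs <;> norm_num

theorem dualVec_mem_coneZero {A : Matrix (Fin p) (Fin n) ℕ} {I : Fin p ↪o Fin n}
    (hΔ : minor A I ≠ 0) {j : Fin p} (hj : sumCoeff A I j ≤ 0) :
    dualVec A I j ∈ coneZero A I :=
  ⟨dualVec_mem_cone hΔ j, hj⟩

theorem span_eq_top_of_dualVec {A : Matrix (Fin p) (Fin n) ℕ} {I : Fin p ↪o Fin n}
    (hΔ : minor A I ≠ 0) {S : Submodule ℝ (Fin p → ℝ)} (h : ∀ j, dualVec A I j ∈ S) : S = ⊤ := by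
  refine (Submodule.eq_top_iff').2 fun x => ?_
  rw [← sum_col_smul_dualVec hΔ x]
  exact S.sum_mem fun j _ => S.smul_mem _ (h j)

theorem linearIndependent_dualVec {A : Matrix (Fin p) (Fin n) ℕ} {I : Fin p ↪o Fin n}
    (hΔ : minor A I ≠ 0) : LinearIndependent ℝ (dualVec A I) := by
  rw [Fintype.linearIndependent_iff]
  intro c hc i
  have := congrArg (col ℝ A (I i)) hc
  simpa [map_sum, col_dualVec hΔ] using this

/-- If `c_j < 0`, a large multiple of the dual vector of `j` brings any other dual vector into the
half-space without leaving the cone. So `K₀^I` spans `ℝᵖ` and has codimension zero. -/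
theorem sumCoeff_nonneg {A : Matrix (Fin p) (Fin n) ℕ} {I : Fin p ↪o Fin n}
    (hΔ : minor A I ≠ 0) (hq : 1 ≤ codimZero A I) (j : Fin p) : 0 ≤ sumCoeff A I j := by
  by_contra! h
  have htop : Submodule.span ℝ (coneZero A I) = ⊤ := by
    refine span_eq_top_of_dualVec hΔ fun i => ?_
    have hj : dualVec A I j ∈ Submodule.span ℝ (coneZero A I) :=
      Submodule.subset_span (dualVec_mem_coneZero hΔ h.le)
    -- Chosen so that `c_i + t c_j = c_i - |c_i| ≤ 0`.
    set t : ℝ := |sumCoeff A I i| / (-sumCoeff A I j) with ht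
    have ht0 : 0 ≤ t := div_nonneg (abs_nonneg _) (by linarith)
    have hmem : dualVec A I i + t • dualVec A I j ∈ Submodule.span ℝ (coneZero A I) := by
      refine Submodule.subset_span ⟨fun k => ?_, ?_⟩
      · rw [map_add, map_smul, smul_eq_mul]
        exact add_nonneg (dualVec_mem_cone hΔ i k) (mul_nonneg ht0 (dualVec_mem_cone hΔ j k))
      · change ∑ k, (dualVec A I i + t • dualVec A I j) k ≤ 0
        simp only [Pi.add_apply, Pi.smul_apply, smul_eq_mul, Finset.sum_add_distrib,
          ← Finset.mul_sum]
        change sumCoeff A I i + t * sumCoeff A I j ≤ 0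
        have h1 : t * sumCoeff A I j = -|sumCoeff A I i| := by
          rw [ht]
          field_simp [h.ne]
        rw [h1]
        linarith [le_abs_self (sumCoeff A I i)]
    have := Submodule.sub_mem _ hmem (Submodule.smul_mem _ t hj)
    simpa using this
  rw [codimZero, htop, finrank_top, Module.finrank_fin_fun] at hq
  omega

/-- On the cone `∑ c_j λ_j` has only nonnegative terms, so it is `≤ 0` only if every term vanishes.
-/
theorem coneZero_eq {A : Matrix (Fin p) (Fin n) ℕ} {I : Fin p ↪o Fin n}
    (hΔ : minor A I ≠ 0) (hc : ∀ j, 0 ≤ sumCoeff A I j) :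
    coneZero A I = {x | (∀ j, 0 < sumCoeff A I j → col ℝ A (I j) x = 0) ∧
      ∀ j, 0 ≤ col ℝ A (I j) x} := by
  ext x
  constructor
  · rintro ⟨h1, h2⟩
    refine ⟨fun j hj => ?_, h1⟩
    change ∑ k, x k ≤ 0 at h2
    rw [sum_eq_sum_sumCoeff hΔ] at h2
    have h3 : ∀ i ∈ Finset.univ, 0 ≤ sumCoeff A I i * col ℝ A (I i) x :=
      fun i _ => mul_nonneg (hc i) (h1 i)
    have h4 := (Finset.sum_eq_zero_iff_of_nonneg h3).1
      (le_antisymm h2 (Finset.sum_nonneg h3)) j (Finset.mem_univ j)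
    exact (mul_eq_zero.1 h4).resolve_left hj.ne'
  · rintro ⟨h1, h2⟩
    refine ⟨h2, ?_⟩
    change ∑ k, x k ≤ 0
    rw [sum_eq_sum_sumCoeff hΔ]
    refine (Finset.sum_eq_zero fun j _ => ?_).le
    rcases (hc j).eq_or_lt with h | h
    · rw [← h, zero_mul]
    · rw [h1 j h, mul_zero]

/-- The positions with `c_j > 0` work: `K₀^I` is spanned by the remaining dual vectors, which are
independent, so the number of these positions is the codimension. -/
theorem exists_isFaceIndexing {A : Matrix (Fin p) (Fin n) ℕ} {I : Fin p ↪o Fin n}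
    (hΔ : minor A I ≠ 0) (hq : 1 ≤ codimZero A I) : ∃ J : List (Fin p), IsFaceIndexing A I J := by
  classical
  have hc := sumCoeff_nonneg hΔ hq
  set S : Finset (Fin p) := Finset.univ.filter fun j => 0 < sumCoeff A I j with hS
  have hmem : ∀ j, j ∈ S.toList ↔ 0 < sumCoeff A I j := fun j => by simp [hS]
  refine ⟨S.toList, S.nodup_toList, ?_, ?_⟩
  · have hspan : Submodule.span ℝ (coneZero A I)
        = Submodule.span ℝ (Set.range fun j : {j // j ∉ S} => dualVec A I j) := by
      refine le_antisymm (Submodule.span_le.2 fun x hx => ?_) (Submodule.span_le.2 ?_)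
      · rw [coneZero_eq hΔ hc] at hx
        rw [SetLike.mem_coe, ← sum_col_smul_dualVec hΔ x]
        refine Submodule.sum_mem _ fun j _ => ?_
        by_cases hj : j ∈ S
        · rw [hx.1 j (by simpa [hS] using hj), zero_smul]
          exact Submodule.zero_mem _
        · exact Submodule.smul_mem _ _ (Submodule.subset_span ⟨⟨j, hj⟩, rfl⟩)
      · rintro _ ⟨⟨j, hj⟩, rfl⟩
        exact Submodule.subset_span (dualVec_mem_coneZero hΔ (by simpa [hS] using hj))
    have hli : LinearIndependent ℝ fun j : {j // j ∉ S} => dualVec A I j :=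
      (linearIndependent_dualVec hΔ).comp _ Subtype.val_injective
    rw [codimZero, hspan, finrank_span_eq_card hli, Finset.length_toList,
      Fintype.card_subtype_compl, Fintype.card_fin, Fintype.card_coe]
    have := Finset.card_le_univ S
    rw [Fintype.card_fin] at this
    omega
  · rw [coneZero_eq hΔ hc]
    ext x
    simp only [hmem]
    constructor
    · exact fun h => ⟨h.1, fun k _ => h.2 k⟩
    · refine fun h => ⟨h.1, fun k => ?_⟩
      by_cases hk : 0 < sumCoeff A I k
      · exact (h.1 k hk).ge
      · exact h.2 k hk

/-- The dual vector of `j` lies in `K₀^I` precisely when `c_j ≤ 0`; testing the description of the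
face on it determines `J` up to order. -/
theorem IsFaceIndexing.mem_iff {A : Matrix (Fin p) (Fin n) ℕ} {I : Fin p ↪o Fin n}
    (hΔ : minor A I ≠ 0) {J : List (Fin p)} (hJ : IsFaceIndexing A I J) (j : Fin p) :
    j ∈ J ↔ 0 < sumCoeff A I j := by
  obtain ⟨-, -, h⟩ := hJ
  constructor
  · intro hj
    by_contra! hc
    have h1 := dualVec_mem_coneZero hΔ hc
    rw [h] at h1
    have h2 := h1.1 j hj
    rw [col_dualVec hΔ, if_pos rfl] at h2
    exact one_ne_zero h2
  · intro hc
    by_contra hj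
    have h1 : dualVec A I j ∈ coneZero A I := by
      rw [h]
      refine ⟨fun i hi => ?_, fun i _ => dualVec_mem_cone hΔ j i⟩
      rw [col_dualVec hΔ, if_neg]
      rintro rfl
      exact hj hi
    have h2 : sumCoeff A I j ≤ 0 := h1.2
    linarith

theorem col_pos_of_mem_interior {A : Matrix (Fin p) (Fin n) ℕ} {I : Fin p ↪o Fin n}
    (hΔ : minor A I ≠ 0) {x : Fin p → ℝ} (hx : x ∈ interior (cone A I)) (j : Fin p) :
    0 < col ℝ A (I j) x := by
  have hc : Continuous fun t : ℝ => x - t • dualVec A I j := by fun_prop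
  have h0 : Tendsto (fun t : ℝ => x - t • dualVec A I j) (𝓝[>] 0) (𝓝 x) := by
    have := hc.tendsto 0
    simp only [zero_smul, sub_zero] at this
    exact this.mono_left nhdsWithin_le_nhds
  obtain ⟨t, ht, ht0⟩ := ((h0.eventually (mem_interior_iff_mem_nhds.1 hx)).and
    self_mem_nhdsWithin).exists
  have h1 := ht j
  rw [map_sub, map_smul, col_dualVec hΔ, if_pos rfl, smul_eq_mul, mul_one] at h1
  have : (0 : ℝ) < t := ht0
  linarith

theorem continuous_col (A : Matrix (Fin p) (Fin n) ℕ) (k : Fin n) : Continuous (col ℝ A k) :=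
  LinearMap.continuous_of_finiteDimensional _

theorem mem_closure_admissible {A : Matrix (Fin p) (Fin n) ℕ} {I : Fin p ↪o Fin n}
    (hΔ : minor A I ≠ 0) {x : Fin p → ℝ} (hx : x ∈ cone A I) (hx1 : ∀ k, x k < 1) :
    x ∈ closure (admissible A I) := by
  have hopen : IsOpen {x : Fin p → ℝ | ∀ j, 0 < col ℝ A (I j) x} := by
    simp only [Set.ofPred_forall]
    exact isOpen_iInter_of_finite fun j => isOpen_lt continuous_const (continuous_col A (I j))
  have hsub : {x : Fin p → ℝ | ∀ j, 0 < col ℝ A (I j) x} ⊆ interior (cone A I) :=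
    interior_maximal (fun x hx j => (hx j).le) hopen
  set u : Fin p → ℝ := ∑ j, dualVec A I j with hu
  have hcu : ∀ j, col ℝ A (I j) u = 1 := fun j => by simp [hu, map_sum, col_dualVec hΔ]
  have hc : Continuous fun t : ℝ => x + t • u := by fun_prop
  have h0 : Tendsto (fun t : ℝ => x + t • u) (𝓝[>] 0) (𝓝 x) := by
    have := hc.tendsto 0
    simp only [zero_smul, add_zero] at this
    exact this.mono_left nhdsWithin_le_nhds
  refine mem_closure_of_tendsto h0 ?_
  have h1 : ∀ᶠ y : Fin p → ℝ in 𝓝 x, ∀ k, y k < 1 :=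
    eventually_all.2 fun k => (continuous_apply k).continuousAt.eventually (gt_mem_nhds (hx1 k))
  filter_upwards [h0.eventually h1, self_mem_nhdsWithin] with t ht ht0
  refine ⟨hsub fun j => ?_, ht⟩
  rw [map_add, map_smul, hcu, smul_eq_mul, mul_one]
  exact add_pos_of_nonneg_of_pos (hx j) ht0

/-- The line through `x` and `y` stays in the affine span, where `x` is an interior point. This
converts weak inequalities on `S` into strict ones at `x`. -/
theorem exists_add_smul_sub_mem_of_mem_intrinsicInterior {S : Set (Fin p → ℝ)} {x y : Fin p → ℝ}
    (hx : x ∈ intrinsicInterior ℝ S) (hy : y ∈ S) : ∃ t : ℝ, 0 < t ∧ x + t • (x - y) ∈ S := by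
  obtain ⟨x', hx', rfl⟩ := hx
  have hyS : y ∈ affineSpan ℝ S := subset_affineSpan ℝ S hy
  let f : ℝ → affineSpan ℝ S := fun t =>
    ⟨AffineMap.lineMap (x' : Fin p → ℝ) y (-t), AffineMap.lineMap_mem _ x'.2 hyS⟩
  have hf : Continuous f := by
    refine Continuous.subtype_mk ?_ _
    simp only [AffineMap.lineMap_apply]
    fun_prop
  have hf0 : f 0 = x' := by
    ext1
    simp [f]
  have h0 : Tendsto f (𝓝[>] 0) (𝓝 x') := by
    have := hf.tendsto 0
    rw [hf0] at this
    exact this.mono_left nhdsWithin_le_nhds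
  obtain ⟨t, ht, ht0⟩ := ((h0.eventually (mem_interior_iff_mem_nhds.1 hx')).and
    self_mem_nhdsWithin).exists
  refine ⟨t, ht0, ?_⟩
  have h1 : (f t : Fin p → ℝ) ∈ S := ht
  have h2 : (f t : Fin p → ℝ) = (x' : Fin p → ℝ) + t • ((x' : Fin p → ℝ) - y) := by
    ext k
    simp [f, AffineMap.lineMap_apply]
    ring
  rwa [h2] at h1

/-- Pushing `x` away from `0` gives `(1 + t) x_k ≤ 1`, hence `x_k < 1`. Pushing it away from a small
multiple of the dual vector of `j ∉ J`, which lies in the face, gives `λ_j(x) > 0`. -/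
theorem admissibleFace_pos {A : Matrix (Fin p) (Fin n) ℕ} {I : Fin p ↪o Fin n}
    (hΔ : minor A I ≠ 0) {J : List (Fin p)} (hJ : IsFaceIndexing A I J) {x : Fin p → ℝ}
    (hx : x ∈ admissibleFace A I) :
    (∀ k, x k < 1) ∧ ∀ j, j ∉ J → 0 < col ℝ A (I j) x := by
  have hle : ∀ y ∈ closure (admissible A I), ∀ k, y k ≤ 1 := by
    intro y hy k
    have hcl : IsClosed {y : Fin p → ℝ | y k ≤ 1} :=
      isClosed_le (continuous_apply k) continuous_const
    exact closure_minimal (fun z (hz : z ∈ admissible A I) => (hz.2 k).le) hcl hy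
  constructor
  · intro k
    have h0 : (0 : Fin p → ℝ) ∈ coneZero A I ∩ closure (admissible A I) := by
      refine ⟨⟨fun j => by simp, by simp⟩, mem_closure_admissible hΔ (fun j => by simp) ?_⟩
      intro k
      simp
    obtain ⟨t, ht, hmem⟩ := exists_add_smul_sub_mem_of_mem_intrinsicInterior hx h0
    have h1 := hle _ hmem.2 k
    simp only [sub_zero, Pi.add_apply, Pi.smul_apply, smul_eq_mul] at h1
    by_contra! h2
    nlinarith
  · intro j hj
    have hev : ∀ᶠ t : ℝ in 𝓝[>] 0, ∀ k, (t • dualVec A I j) k < 1 := by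
      refine eventually_all.2 fun k => ?_
      have hc : Continuous fun t : ℝ => (t • dualVec A I j) k := by
        simp only [Pi.smul_apply]
        fun_prop
      have := hc.tendsto 0
      simp only [zero_smul, Pi.zero_apply] at this
      exact (this.mono_left nhdsWithin_le_nhds).eventually (gt_mem_nhds one_pos)
    obtain ⟨t, ht, ht0⟩ := (hev.and self_mem_nhdsWithin).exists
    have ht0' : (0 : ℝ) < t := ht0
    have hc0 : sumCoeff A I j ≤ 0 := not_lt.1 fun h => hj ((hJ.mem_iff hΔ j).2 h)
    have hcone : t • dualVec A I j ∈ cone A I := fun i => by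
      rw [map_smul, smul_eq_mul]
      exact mul_nonneg ht0'.le (dualVec_mem_cone hΔ j i)
    have hy : t • dualVec A I j ∈ coneZero A I ∩ closure (admissible A I) := by
      refine ⟨⟨hcone, ?_⟩, mem_closure_admissible hΔ hcone ht⟩
      change ∑ k, (t • dualVec A I j) k ≤ 0
      simp only [Pi.smul_apply, smul_eq_mul, ← Finset.mul_sum]
      exact mul_nonpos_of_nonneg_of_nonpos ht0'.le hc0
    obtain ⟨e, he, hmem⟩ := exists_add_smul_sub_mem_of_mem_intrinsicInterior hx hy
    have h1 := hmem.1.1 j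
    simp only [map_add, map_smul, map_sub, smul_eq_mul, col_dualVec hΔ, if_true, mul_one] at h1
    by_contra! h2
    nlinarith [mul_pos he ht0']

/-- The contracting vectors occupy the first slots in the order of the list, as the covectors do in
`orientSign`; the cast only interchanges `m + q` and `q + m`. -/
theorem contract_apply {V ι : Type} [NormedAddCommGroup V] [NormedSpace ℂ V] (w : ι → V)
    (J : List ι) (m : ℕ) (ξ : V [⋀^Fin (m + J.length)]→ₗ[ℂ] ℂ) (v : Fin m → V) :
    contract w J m ξ v = ξ fun i =>
      Fin.append (fun a : Fin J.length => w (J.get a)) v (Fin.cast (Nat.add_comm _ _) i) := by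
  induction J with
  | nil =>
    change ξ v = _
    congr 1
    ext i
    simp [Fin.append, Fin.addCases]
  | cons j J ih =>
    rw [contract, ih, AlternatingMap.curryLeft_apply_apply]
    congr 1
    ext i
    refine Fin.cases ?_ (fun i => ?_) i
    · simp [Fin.append, Fin.addCases]
    · rw [Matrix.cons_val_succ]
      simp only [Fin.append, Fin.addCases, Fin.val_cast, Fin.val_succ, List.length_cons,
        eq_rec_constant]
      by_cases h : (i : ℕ) < J.length
      · simp [h]
      · rw [dif_neg h, dif_neg (by omega)]
        congr 1
        ext
        simp

end

/-! ### Determinants of frames -/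

/-- The product of the first matrix with the transpose of the second is block triangular, with an
identity block and the Gram matrix of `v`, whose determinant is positive. So covectors and dual
vectors induce the same orientation. -/
theorem frameMatrix_det_mul_pos {p q m : ℕ} (hp : q + m = p) {α w : Fin q → Fin p → ℝ}
    {v : Fin m → Fin p → ℝ} (hαw : ∀ a b, α a ⬝ᵥ w b = if a = b then 1 else 0)
    (hαv : ∀ a b, α a ⬝ᵥ v b = 0) (hv : LinearIndependent ℝ v) :
    0 < (frameMatrix hp α v).det * (frameMatrix hp w v).det := by
  subst hp
  have h1 : ((frameMatrix rfl α v * (frameMatrix rfl w v).transpose).submatrix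
      finSumFinEquiv finSumFinEquiv) = Matrix.fromBlocks (1 : Matrix (Fin q) (Fin q) ℝ) 0
        (Matrix.of fun b a => v b ⬝ᵥ w a) (Matrix.of v * (Matrix.of v).transpose) := by
    ext i j
    rcases i with i | i <;> rcases j with j | j <;>
      simp [frameMatrix, Matrix.mul_apply, Matrix.one_apply, ← hαw, dotProduct]
    · exact hαv i j
  have h2 : 0 < (Matrix.of v * (Matrix.of v).transpose).det := by
    have := Matrix.PosDef.mul_conjTranspose_self (Matrix.of v) (by
      exact Matrix.vecMul_injective_iff.2 hv)
    rw [Matrix.conjTranspose_eq_transpose_of_trivial] at this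
    exact this.det_pos
  have h3 := congrArg Matrix.det h1
  rw [Matrix.det_submatrix_equiv_self, Matrix.det_mul, Matrix.det_transpose,
    Matrix.det_fromBlocks_zero₁₂, Matrix.det_one, one_mul] at h3
  rwa [h3]

theorem frameMatrix_det_ofReal {p q m : ℕ} (hp : q + m = p) (w : Fin q → Fin p → ℝ)
    (v : Fin m → Fin p → ℝ) :
    (frameMatrix hp (fun a l => (w a l : ℂ)) fun b l => Complex.I * (v b l : ℂ)).det
      = Complex.I ^ m * ((frameMatrix hp w v).det : ℂ) := by
  subst hp
  have h : frameMatrix rfl (fun a l => (w a l : ℂ)) (fun b l => Complex.I * (v b l : ℂ))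
      = Matrix.of fun i j => Fin.append (fun _ : Fin q => (1 : ℂ)) (fun _ : Fin m => Complex.I) i
        * ((frameMatrix rfl w v).map Complex.ofReal) i j := by
    ext i j
    refine Fin.addCases (fun i => ?_) (fun i => ?_) i <;> simp [frameMatrix]
  rw [h, Matrix.det_mul_column, Fin.prod_univ_add]
  simp only [Fin.append_left, Fin.append_right, Finset.prod_const_one, one_mul,
    Finset.prod_const, Finset.card_univ, Fintype.card_fin]
  congr 1
  exact (Complex.ofRealHom.map_det _).symm

/-! ### Decay of Gamma functions and compact sets of base points -/

theorem norm_Gamma_le {z : ℂ} (hz : 0 < z.re) : ‖Complex.Gamma z‖ ≤ Real.Gamma z.re := by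
  rw [Complex.Gamma_eq_integral hz, Complex.GammaIntegral, Real.Gamma_eq_integral hz]
  refine (norm_integral_le_integral_norm _).trans (le_of_eq ?_)
  refine setIntegral_congr_fun measurableSet_Ioi fun x hx => ?_
  rw [norm_mul, Complex.norm_real, Real.norm_eq_abs, abs_of_pos (Real.exp_pos _),
    Complex.norm_cpow_eq_rpow_re_of_pos hx]
  simp

/-- Each use of `Γ(z) = Γ(z + 1)/z` gains one power of `1 + |Im z|` and shifts the strip by one; the
start is `|Γ(z)| ≤ Γ(Re z)`. Polynomial decay of every order suffices here, so Stirling's formula is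
not needed. -/
theorem exists_norm_Gamma_mul_pow_le {c₁ c₂ : ℝ} (hc : 0 < c₁) (N : ℕ) :
    ∃ C : ℝ, 0 ≤ C ∧ ∀ z : ℂ, c₁ ≤ z.re → z.re ≤ c₂ →
      ‖Complex.Gamma z‖ * (1 + |z.im|) ^ N ≤ C := by
  induction N generalizing c₁ c₂ with
  | zero =>
    have hcont : ContinuousOn Real.Gamma (Set.Icc c₁ c₂) := fun x hx =>
      (Real.differentiableAt_Gamma fun m => by
        have := hx.1
        have h0 : (0 : ℝ) ≤ m := Nat.cast_nonneg m
        intro h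
        linarith).continuousAt.continuousWithinAt
    obtain ⟨C, hC⟩ := isCompact_Icc.exists_bound_of_continuousOn hcont
    refine ⟨|C|, abs_nonneg _, fun z h1 h2 => ?_⟩
    rw [pow_zero, mul_one]
    exact (norm_Gamma_le (hc.trans_le h1)).trans ((le_abs_self _).trans
      ((hC z.re ⟨h1, h2⟩).trans (le_abs_self _)))
  | succ N ih =>
    obtain ⟨C, hC0, hC⟩ := ih (c₁ := c₁ + 1) (c₂ := c₂ + 1) (by linarith)
    refine ⟨(c₁⁻¹ + 1) * C, by positivity, fun z h1 h2 => ?_⟩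
    have hz : z ≠ 0 := by
      rintro rfl
      rw [Complex.zero_re] at h1
      linarith
    have h3 := hC (z + 1) (by simpa using h1) (by simpa using h2)
    rw [Complex.Gamma_add_one z hz, norm_mul] at h3
    simp only [Complex.add_im, Complex.one_im, add_zero] at h3
    have h4 : 1 + |z.im| ≤ (c₁⁻¹ + 1) * ‖z‖ := by
      have h5 : c₁ ≤ ‖z‖ := h1.trans (Complex.re_le_norm z)
      have h6 : c₁⁻¹ * c₁ ≤ c₁⁻¹ * ‖z‖ := by gcongr
      rw [inv_mul_cancel₀ hc.ne'] at h6
      linarith [Complex.abs_im_le_norm z]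
    calc ‖Complex.Gamma z‖ * (1 + |z.im|) ^ (N + 1)
        = ‖Complex.Gamma z‖ * ((1 + |z.im|) ^ N * (1 + |z.im|)) := by rw [pow_succ]
      _ ≤ ‖Complex.Gamma z‖ * ((1 + |z.im|) ^ N * ((c₁⁻¹ + 1) * ‖z‖)) := by gcongr
      _ = (c₁⁻¹ + 1) * (‖z‖ * ‖Complex.Gamma z‖ * (1 + |z.im|) ^ N) := by ring
      _ ≤ (c₁⁻¹ + 1) * C := by gcongr

theorem one_add_norm_le_prod {p : ℕ} (y : Fin p → ℝ) : 1 + ‖y‖ ≤ ∏ k, (1 + |y k|) := by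
  have h : ∀ k, 1 + |y k| ≤ ∏ i, (1 + |y i|) := fun k => by
    calc 1 + |y k| = ∏ i, if i = k then 1 + |y i| else 1 := by simp
      _ ≤ ∏ i, (1 + |y i|) := Finset.prod_le_prod
          (fun i _ => by split_ifs <;> positivity)
          (fun i _ => by split_ifs <;> linarith [abs_nonneg (y i)])
  have h1 : 1 ≤ ∏ k, (1 + |y k|) := by
    calc (1 : ℝ) = ∏ _i : Fin p, 1 := by simp
      _ ≤ _ := Finset.prod_le_prod (fun _ _ => zero_le_one) fun i _ => by
        linarith [abs_nonneg (y i)]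
  have h2 : ‖y‖ ≤ ∏ k, (1 + |y k|) - 1 :=
    (pi_norm_le_iff_of_nonneg (by linarith)).2 fun k => by
      rw [Real.norm_eq_abs]
      linarith [h k]
  linarith

theorem exists_norm_prod_Gamma_le {p : ℕ} {c₁ c₂ : Fin p → ℝ} (hc : ∀ k, 0 < c₁ k) :
    ∃ C : ℝ, 0 ≤ C ∧ ∀ x y : Fin p → ℝ, (∀ k, c₁ k ≤ 1 - x k ∧ 1 - x k ≤ c₂ k) →
      ‖∏ k, Complex.Gamma (1 - cpoint x y k)‖ ≤ C * decay y := by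
  choose C hC0 hC using fun k =>
    exists_norm_Gamma_mul_pow_le (c₁ := c₁ k) (c₂ := c₂ k) (hc k) (p + 1)
  refine ⟨∏ k, C k, Finset.prod_nonneg fun k _ => hC0 k, fun x y hx => ?_⟩
  have hpos : 0 < 1 + ‖y‖ := by positivity
  have h1 : decay y = ((1 + ‖y‖) ^ (p + 1))⁻¹ := by
    rw [decay, Real.rpow_neg hpos.le]
    norm_cast
  rw [h1, ← div_eq_mul_inv, le_div_iff₀ (by positivity), norm_prod]
  calc (∏ k, ‖Complex.Gamma (1 - cpoint x y k)‖) * (1 + ‖y‖) ^ (p + 1)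
      ≤ (∏ k, ‖Complex.Gamma (1 - cpoint x y k)‖) * (∏ k, (1 + |y k|)) ^ (p + 1) := by
        gcongr
        exact one_add_norm_le_prod y
    _ = ∏ k, ‖Complex.Gamma (1 - cpoint x y k)‖ * (1 + |y k|) ^ (p + 1) := by
        rw [← Finset.prod_pow, Finset.prod_mul_distrib]
    _ ≤ ∏ k, C k := by
        refine Finset.prod_le_prod (fun k _ => by positivity) fun k _ => ?_
        have := hC k (1 - cpoint x y k) (by simpa [cpoint] using (hx k).1)
          (by simpa [cpoint] using (hx k).2)
        simpa [cpoint] using this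

theorem exists_bounds_of_isCompact {E : Type*} [TopologicalSpace E] {K : Set E} (hK : IsCompact K)
    {f : E → ℝ} (hf : Continuous f) {d : ℝ} (hd : ∀ x ∈ K, 0 < f x + d) :
    ∃ c₁ c₂ : ℝ, c₁ ≤ c₂ ∧ 0 < c₁ + d ∧ ∀ x ∈ K, c₁ ≤ f x ∧ f x ≤ c₂ := by
  rcases K.eq_empty_or_nonempty with rfl | hne
  -- For empty `K` any constant with `0 < c₁ + d` will do.
  · exact ⟨1 - d, 1 - d, le_rfl, by simp, by simp⟩
  · obtain ⟨a, ha, hmin⟩ := hK.exists_isMinOn hne hf.continuousOn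
    obtain ⟨b, hb, hmax⟩ := hK.exists_isMaxOn hne hf.continuousOn
    exact ⟨f a, f b, hmin hb, hd a ha, fun x hx => ⟨hmin hx, hmax hx⟩⟩

/-- The set is the convex hull of `γ` and a small box about `x₀`, compact as the image of `[0, 1] ×
B` under convex combination with `γ`. Convexity serves the shift of base points, compactness the
uniform estimates, and the box provides bases on all sides of the hyperplanes. -/
theorem exists_isCompact_convex_box {p q : ℕ} {S : Set (Fin p → ℝ)} (hS : IsOpen S)
    (hSc : Convex ℝ S) {γ x₀ : Fin p → ℝ} (hγ : γ ∈ S) (hx₀ : x₀ ∈ S) (w : Fin q → Fin p → ℝ) :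
    ∃ K : Set (Fin p → ℝ), IsCompact K ∧ Convex ℝ K ∧ K ⊆ S ∧ γ ∈ K ∧
      ∃ η : ℝ, 0 < η ∧ ∀ ε : Fin q → ℝ, (∀ a, |ε a| ≤ η) → x₀ + ∑ a, ε a • w a ∈ K := by
  set f : (Fin q → ℝ) → Fin p → ℝ := fun ε => x₀ + ∑ a, ε a • w a with hf
  have hfc : Continuous f := by fun_prop
  have h0 : f ⁻¹' S ∈ 𝓝 (0 : Fin q → ℝ) :=
    (hS.preimage hfc).mem_nhds (by simpa [hf] using hx₀)
  obtain ⟨η, hη, hball⟩ := Metric.nhds_basis_closedBall.mem_iff.1 h0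
  set B : Set (Fin p → ℝ) := f '' Metric.closedBall 0 η with hB
  have hBcompact : IsCompact B := (isCompact_closedBall _ _).image hfc
  have hBconvex : Convex ℝ B := by
    rw [hB, hf, ← Set.image_image (fun z => x₀ + z) fun ε : Fin q → ℝ => ∑ a, ε a • w a]
    exact ((convex_closedBall 0 η).is_linear_image
      (f := fun ε : Fin q → ℝ => ∑ a, ε a • w a)
      ⟨fun x y => by simp [add_smul, Finset.sum_add_distrib],
        fun c x => by simp [mul_smul, Finset.smul_sum]⟩).vadd x₀
  have hBne : B.Nonempty := ⟨f 0, 0, by simp [hη.le], rfl⟩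
  have hK : IsCompact (convexHull ℝ (insert γ B)) := by
    have h1 : convexHull ℝ (insert γ B)
        = (fun z : ℝ × (Fin p → ℝ) => AffineMap.lineMap γ z.2 z.1) '' (Set.Icc (0 : ℝ) 1 ×ˢ B) := by
      rw [convexHull_insert hBne, hBconvex.convexHull_eq]
      ext x
      simp only [mem_convexJoin, Set.mem_singleton_iff, exists_eq_left, segment_eq_image_lineMap,
        Set.mem_image, Set.mem_prod, Prod.exists]
      constructor
      · rintro ⟨b, hb, t, ht, rfl⟩
        exact ⟨t, b, ⟨ht, hb⟩, rfl⟩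
      · rintro ⟨t, b, ⟨ht, hb⟩, rfl⟩
        exact ⟨b, hb, t, ht, rfl⟩
    rw [h1]
    refine (isCompact_Icc.prod hBcompact).image ?_
    simp only [AffineMap.lineMap_apply_module]
    fun_prop
  refine ⟨convexHull ℝ (insert γ B), hK,
    convex_convexHull ℝ _, convexHull_min ?_ hSc, subset_convexHull ℝ _ (Set.mem_insert _ _),
    η, hη, fun ε hε => subset_convexHull ℝ _ (Set.mem_insert_of_mem _ ⟨ε, ?_, rfl⟩)⟩
  · rintro x (rfl | ⟨ε, hε, rfl⟩)
    · exact hγ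
    · exact hball hε
  · rw [mem_closedBall_zero_iff]
    exact (pi_norm_le_iff_of_nonneg hη.le).2 hε

/-! ### Regularity and decay of the Barnes integrand -/

section

variable {p n : ℕ}

open Classical in
theorem mellinExp_re (A : Matrix (Fin p) (Fin n) ℕ) (I : Fin p ↪o Fin n) (x y : Fin p → ℝ)
    (k : Fin n) : (mellinExp A I (cpoint x y) k).re
      = col ℝ A k x + if k ∈ Set.range I then 0 else 1 := by
  rw [mellinExp, col_cpoint]
  split_ifs <;> simp

open Classical in
/-- The real parts of the points near which the Barnes integrand, multiplied by the linear forms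
`⟨αʲ, s⟩` for `j` in `J`, is regular. -/
def regularBase (A : Matrix (Fin p) (Fin n) ℕ) (I : Fin p ↪o Fin n) (J : List (Fin p)) :
    Set (Fin p → ℝ) :=
  {x | (∀ k, x k < 1) ∧ 0 < ∑ k, x k + 1 ∧
    ∀ k, 0 < (col ℝ A k x + if k ∈ Set.range I then 0 else 1) + listShift I J k}

theorem isOpen_regularBase (A : Matrix (Fin p) (Fin n) ℕ) (I : Fin p ↪o Fin n)
    (J : List (Fin p)) : IsOpen (regularBase A I J) := by
  simp only [regularBase, Set.ofPred_and, Set.ofPred_forall]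
  refine IsOpen.inter ?_ (IsOpen.inter ?_ ?_)
  · exact isOpen_iInter_of_finite fun k => isOpen_lt (continuous_apply k) continuous_const
  · exact isOpen_lt continuous_const (by fun_prop)
  · refine isOpen_iInter_of_finite fun k => isOpen_lt continuous_const ?_
    have := continuous_col A k
    fun_prop

theorem convex_regularBase (A : Matrix (Fin p) (Fin n) ℕ) (I : Fin p ↪o Fin n)
    (J : List (Fin p)) : Convex ℝ (regularBase A I J) := by
  rintro x ⟨hx1, hx2, hx3⟩ y ⟨hy1, hy2, hy3⟩ a b ha hb hab
  have key : ∀ c u v : ℝ, 0 < u + c → 0 < v + c → 0 < (a * u + b * v) + c := by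
    intro c u v hu hv
    have h : (a * u + b * v) + c = a * (u + c) + b * (v + c) := by
      linear_combination (-c) * hab
    rw [h]
    rcases ha.eq_or_lt with h0 | h0
    · have : b = 1 := by linarith
      rw [← h0, this]
      linarith
    · exact add_pos_of_pos_of_nonneg (mul_pos h0 hu) (mul_nonneg hb hv.le)
  refine ⟨fun k => ?_, ?_, fun k => ?_⟩
  · have := key 1 (-x k) (-y k) (by linarith [hx1 k]) (by linarith [hy1 k])
    simp only [Pi.add_apply, Pi.smul_apply, smul_eq_mul]
    linarith
  · have := key 1 _ _ hx2 hy2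
    simpa only [Pi.add_apply, Pi.smul_apply, smul_eq_mul, Finset.sum_add_distrib,
      ← Finset.mul_sum] using this
  · rw [add_assoc, map_add, map_smul, map_smul]
    refine key _ _ _ ?_ ?_
    · rw [← add_assoc]
      exact hx3 k
    · rw [← add_assoc]
      exact hy3 k

/-- The Barnes integrand without the factor `τ^{-|s|}`, multiplied by the linear forms
`⟨αʲ, s⟩` for `j` in `J`. -/
def barnesReg (A : Matrix (Fin p) (Fin n) ℕ) (I : Fin p ↪o Fin n) (φ : TestForm p n)
    (J : List (Fin p)) (s : Fin p → ℂ) : ℂ :=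
  Complex.Gamma ((∑ k, s k) + 1) * (∏ k, Complex.Gamma (1 - s k)) * mellinReg A I φ J s

theorem notMem_polarSet_of_mem_regularBase {A : Matrix (Fin p) (Fin n) ℕ} {I : Fin p ↪o Fin n}
    {J : List (Fin p)} {x : Fin p → ℝ} (hx : x ∈ regularBase A I J) (y : Fin p → ℝ) :
    cpoint x y ∉ polarSet A I J := by
  rw [mem_polarSet_iff]
  rintro ⟨k, hk⟩
  refine Complex.Gamma_ne_zero_of_re_pos ?_ hk
  have := hx.2.2 k
  rwa [Complex.add_re, mellinExp_re, Complex.natCast_re]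

theorem sum_cpoint (x y : Fin p → ℝ) :
    ∑ k, cpoint x y k = (∑ k, x k : ℝ) + Complex.I * (∑ k, y k : ℝ) := by
  simp [cpoint, Finset.sum_add_distrib, Finset.mul_sum]

theorem re_sum_cpoint (x y : Fin p → ℝ) : (∑ k, cpoint x y k).re = ∑ k, x k := by
  simp [cpoint]

theorem differentiableAt_Gamma_of_re_pos {z : ℂ} (hz : 0 < z.re) :
    DifferentiableAt ℂ Complex.Gamma z :=
  (analyticAt_Gamma_of_ne_zero (Complex.Gamma_ne_zero_of_re_pos hz)).differentiableAt

theorem differentiableAt_barnesReg {A : Matrix (Fin p) (Fin n) ℕ} {I : Fin p ↪o Fin n}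
    (φ : TestForm p n) {J : List (Fin p)} {x : Fin p → ℝ} (hx : x ∈ regularBase A I J)
    (y : Fin p → ℝ) : DifferentiableAt ℂ (barnesReg A I φ J) (cpoint x y) := by
  refine DifferentiableAt.mul (DifferentiableAt.mul ?_ ?_)
    (analyticAt_mellinReg A I φ J (notMem_polarSet_of_mem_regularBase hx y)).differentiableAt
  · refine DifferentiableAt.comp (g := Complex.Gamma) (f := fun s : Fin p → ℂ => ∑ k, s k + 1) _
      (differentiableAt_Gamma_of_re_pos ?_) (by fun_prop)
    rw [Complex.add_re, re_sum_cpoint]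
    exact hx.2.1
  · refine (Finset.analyticAt_fun_prod _ fun k _ => AnalyticAt.comp (g := Complex.Gamma)
      (f := fun s : Fin p → ℂ => 1 - s k) (analyticAt_Gamma_of_ne_zero
        (Complex.Gamma_ne_zero_of_re_pos ?_)) (analyticAt_const.sub
          (analyticAt_coord k _))).differentiableAt
    simpa [cpoint] using hx.1 k

/-- Only the factors `Γ(1 - s_k)` are used for decay; `Γ(|s| + 1)` and the Mellin factor merely have
to be bounded when the real parts range over a compact set. -/
theorem exists_norm_barnesReg_le {A : Matrix (Fin p) (Fin n) ℕ} {I : Fin p ↪o Fin n}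
    (φ : TestForm p n) {J : List (Fin p)} {K : Set (Fin p → ℝ)} (hK : IsCompact K)
    (hKS : K ⊆ regularBase A I J) :
    ∃ C : ℝ, ∀ x ∈ K, ∀ y, ‖barnesReg A I φ J (cpoint x y)‖ ≤ C * decay y := by
  classical
  choose a₁ a₂ _ ha0 ha using fun k => exists_bounds_of_isCompact hK
    (f := fun x : Fin p → ℝ => 1 - x k) (d := 0) (by fun_prop)
    (fun x hx => by linarith [(hKS hx).1 k])
  obtain ⟨b₁, b₂, -, hb0, hb⟩ := exists_bounds_of_isCompact hK
    (f := fun x : Fin p → ℝ => ∑ k, x k + 1) (d := 0) (by fun_prop)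
    (fun x hx => by linarith [(hKS hx).2.1])
  choose e₁ e₂ he he0 heb using fun k => exists_bounds_of_isCompact hK
    (f := fun x : Fin p → ℝ => col ℝ A k x + if k ∈ Set.range I then 0 else 1)
    (d := listShift I J k) ((continuous_col A k).add continuous_const)
    (fun x hx => (hKS hx).2.2 k)
  obtain ⟨C₁, hC₁0, hC₁⟩ := exists_norm_prod_Gamma_le (c₁ := a₁) (c₂ := a₂)
    (fun k => by simpa using ha0 k)
  obtain ⟨C₂, hC₂0, hC₂⟩ := exists_norm_Gamma_mul_pow_le (c₁ := b₁) (c₂ := b₂)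
    (by simpa using hb0) 0
  obtain ⟨C₃, hC₃0, hC₃⟩ := exists_norm_Gamma_mul_regMellin_le (φ.smooth I) (φ.compactSupport I)
    (entireMellin_eq A I φ) (listShift I J) he he0
  refine ⟨C₂ * C₁ * (‖mellinConst A I‖ * C₃), fun x hx y => ?_⟩
  have h1 := hC₁ x y fun k => ha k x hx
  have h2 := hC₂ (∑ k, cpoint x y k + 1)
    (by simpa [cpoint] using (hb x hx).1) (by simpa [cpoint] using (hb x hx).2)
  rw [pow_zero, mul_one] at h2
  have h3 := hC₃ (mellinExp A I (cpoint x y)) fun k => by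
    rw [mellinExp_re]
    exact heb k x hx
  rw [barnesReg, mellinReg, norm_mul, norm_mul, norm_mul (mellinConst A I)]
  calc _ ≤ C₂ * (C₁ * decay y) * (‖mellinConst A I‖ * C₃) := by
        have := decay_nonneg y
        gcongr
    _ = _ := by ring

end

/-! ### The Mellin–Barnes integral and the residue integral -/

section

variable {p n : ℕ}

theorem IsFaceIndexing.sum_eq {A : Matrix (Fin p) (Fin n) ℕ} {I : Fin p ↪o Fin n}
    (hΔ : minor A I ≠ 0) (hq : 1 ≤ codimZero A I) {J : List (Fin p)} (hJ : IsFaceIndexing A I J)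
    (x : Fin p → ℝ) : ∑ l, x l
      = ∑ a : Fin J.length, sumCoeff A I (J.get a) * col ℝ A (I (J.get a)) x := by
  have h1 := Fin.sum_univ_fun_getElem J fun j => sumCoeff A I j * col ℝ A (I j) x
  rw [← List.sum_toFinset _ hJ.1] at h1
  rw [sum_eq_sum_sumCoeff hΔ]
  refine Eq.trans ?_ h1.symm
  refine (Finset.sum_subset (Finset.subset_univ _) fun j _ hj => ?_).symm
  rw [List.mem_toFinset, hJ.mem_iff hΔ, not_lt] at hj
  rw [le_antisymm hj (sumCoeff_nonneg hΔ hq j), zero_mul]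

theorem IsFaceIndexing.sum_cpoint_eq {A : Matrix (Fin p) (Fin n) ℕ} {I : Fin p ↪o Fin n}
    (hΔ : minor A I ≠ 0) (hq : 1 ≤ codimZero A I) {J : List (Fin p)} (hJ : IsFaceIndexing A I J)
    (x y : Fin p → ℝ) : ∑ l, cpoint x y l
      = ∑ a : Fin J.length, (sumCoeff A I (J.get a) : ℂ) * col ℂ A (I (J.get a)) (cpoint x y) := by
  rw [sum_cpoint, hJ.sum_eq hΔ hq x, hJ.sum_eq hΔ hq y]
  simp only [col_cpoint, Complex.ofReal_sum, Complex.ofReal_mul, Finset.mul_sum,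
    ← Finset.sum_add_distrib]
  exact Finset.sum_congr rfl fun a _ => by ring

theorem mem_regularBase {A : Matrix (Fin p) (Fin n) ℕ} {I : Fin p ↪o Fin n} {J : List (Fin p)}
    {x : Fin p → ℝ} (h1 : ∀ k, x k < 1) (h2 : 0 ≤ ∑ k, x k) (h3 : ∀ j, 0 ≤ col ℝ A (I j) x)
    (h4 : ∀ j, j ∉ J → 0 < col ℝ A (I j) x) (h5 : PoleFree A I x) : x ∈ regularBase A I J := by
  refine ⟨h1, by linarith, fun k => ?_⟩
  by_cases hk : k ∈ Set.range I
  · obtain ⟨j, rfl⟩ := hk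
    rw [if_pos ⟨j, rfl⟩, listShift_apply]
    split_ifs with hj
    · have := h3 j
      push_cast
      linarith
    · simpa using h4 j hj
  · rw [if_neg hk, listShift_of_notMem I J hk]
    have := h5 k hk
    push_cast
    linarith

/-- Nonnegativity of the `c_j` also gives `|γ| ≥ 0`, so the poles of `Γ(|s| + 1)` are kept away. -/
theorem mem_regularBase_of_admissible {A : Matrix (Fin p) (Fin n) ℕ}
    {I : Fin p ↪o Fin n} (hΔ : minor A I ≠ 0) (hq : 1 ≤ codimZero A I) {J : List (Fin p)}
    {γ : Fin p → ℝ} (hγ : γ ∈ admissible A I) (hγp : PoleFree A I γ) :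
    γ ∈ regularBase A I J := by
  have h := col_pos_of_mem_interior hΔ hγ.1
  refine mem_regularBase hγ.2 ?_ (fun j => (h j).le) (fun j _ => h j) hγp
  rw [sum_eq_sum_sumCoeff hΔ]
  exact Finset.sum_nonneg fun j _ => mul_nonneg (sumCoeff_nonneg hΔ hq j) (h j).le

theorem sum_eq_zero_of_mem_realLeaf {A : Matrix (Fin p) (Fin n) ℕ} {I : Fin p ↪o Fin n}
    (hΔ : minor A I ≠ 0) (hq : 1 ≤ codimZero A I) {J : List (Fin p)} (hJ : IsFaceIndexing A I J)
    {x : Fin p → ℝ} (hx : x ∈ realLeaf A I J) : ∑ k, x k = 0 := by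
  rw [hJ.sum_eq hΔ hq]
  refine Finset.sum_eq_zero fun a _ => ?_
  rw [hx _ (J.get_mem a), mul_zero]

theorem IsFaceIndexing.mem_regularBase_of_admissibleFace {A : Matrix (Fin p) (Fin n) ℕ}
    {I : Fin p ↪o Fin n} (hΔ : minor A I ≠ 0) (hq : 1 ≤ codimZero A I) {J : List (Fin p)}
    (hJ : IsFaceIndexing A I J) {x : Fin p → ℝ} (hxL : x ∈ realLeaf A I J)
    (hx : x ∈ admissibleFace A I) (hxp : PoleFree A I x) : x ∈ regularBase A I J := by
  obtain ⟨h1, h2⟩ := admissibleFace_pos hΔ hJ hx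
  refine mem_regularBase h1 (sum_eq_zero_of_mem_realLeaf hΔ hq hJ hxL).ge (fun j => ?_) h2 hxp
  by_cases hj : j ∈ J
  · exact (hxL j hj).ge
  · exact (h2 j hj).le

/-- The integrand as an exponential times a regular function with simple polar factors. -/
theorem barnesIntegrand_eq {A : Matrix (Fin p) (Fin n) ℕ} {I : Fin p ↪o Fin n}
    (φ : TestForm p n) (hΔ : minor A I ≠ 0) (hq : 1 ≤ codimZero A I) {J : List (Fin p)}
    (hJ : IsFaceIndexing A I J) {γ : Fin p → ℝ} (hγ : γ ∈ admissible A I)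
    (hγp : PoleFree A I γ) {τ : ℝ} (hτ : 0 < τ) (y : Fin p → ℝ) :
    barnesIntegrand A I φ τ (cpoint γ y)
      = Complex.exp ((-Real.log τ : ℝ) * ∑ a : Fin J.length, (sumCoeff A I (J.get a) : ℂ)
          * col ℂ A (I (J.get a)) (cpoint γ y))
        * barnesReg A I φ J (cpoint γ y)
        * ∏ a : Fin J.length, (col ℂ A (I (J.get a)) (cpoint γ y))⁻¹ := by
  have hne : ∀ j ∈ J, col ℂ A (I j) (cpoint γ y) ≠ 0 := fun j _ h => by
    have h1 := congrArg Complex.re h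
    rw [col_cpoint] at h1
    simp only [Complex.add_re, Complex.ofReal_re, Complex.mul_re, Complex.I_re, zero_mul,
      Complex.I_im, Complex.ofReal_im, mul_zero, sub_self, add_zero, Complex.zero_re] at h1
    exact (col_pos_of_mem_interior hΔ hγ.1 j).ne' h1
  have hreg := notMem_polarSet_of_mem_regularBase
    (mem_regularBase_of_admissible hΔ hq (J := J) hγ hγp) y
  rw [barnesIntegrand, mellinGamma_eq hΔ φ (notMem_polarSet_nil A I hreg hne),
    mellinReg_nil_eq A I φ hJ.1 hne,
    ← Fin.prod_univ_fun_getElem J fun j => (col ℂ A (I j) (cpoint γ y))⁻¹,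
    ← hJ.sum_cpoint_eq hΔ hq, Complex.cpow_def_of_ne_zero (by exact_mod_cast hτ.ne'),
    ← Complex.ofReal_log hτ.le, barnesReg]
  have : (Real.log τ : ℂ) * -∑ k, cpoint γ y k
      = (-Real.log τ : ℝ) * ∑ k, cpoint γ y k := by push_cast; ring
  rw [this]
  simp only [List.get_eq_getElem]
  ring

theorem cpoint_zero_right (x : Fin p → ℝ) : cpoint x 0 = fun l => (x l : ℂ) := by
  ext l
  simp [cpoint]

theorem cpoint_zero_left (y : Fin p → ℝ) : cpoint 0 y = fun l => Complex.I * (y l : ℂ) := by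
  ext l
  simp [cpoint]

theorem mellinForm_eq {A : Matrix (Fin p) (Fin n) ℕ} {I : Fin p ↪o Fin n}
    (φ : TestForm p n) (hΔ : minor A I ≠ 0) {J : List (Fin p)} (hJ : J.Nodup) {m : ℕ}
    (hm : m + J.length = p) (z : (⊤ : Submodule ℂ (Fin p → ℂ)))
    (hz : (z : Fin p → ℂ) ∈ (polarSet A I J)ᶜ)
    (h0 : ∀ j ∈ J, col ℂ A (I j) (z : Fin p → ℂ) ≠ 0) :
    mellinForm A I φ hm z
      = (mellinReg A I φ J z * (J.map fun j => (col ℂ A (I j) (z : Fin p → ℂ))⁻¹).prod) •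
        (Matrix.detRowAlternating.domDomCongr (finCongr hm.symm)).compLinearMap
          (Submodule.subtype ⊤) := by
  rw [mellinForm, mellinGamma_eq hΔ φ (notMem_polarSet_nil A I hz h0),
    mellinReg_nil_eq A I φ hJ h0]
  rfl

theorem col_cpoint_dualVec {A : Matrix (Fin p) (Fin n) ℕ} {I : Fin p ↪o Fin n}
    (hΔ : minor A I ≠ 0) (i j : Fin p) :
    col ℂ A (I i) (cpoint (dualVec A I j) 0) = if i = j then 1 else 0 := by
  rw [col_cpoint, col_dualVec hΔ]
  split_ifs <;> simp

theorem exists_isMellinResidue {A : Matrix (Fin p) (Fin n) ℕ} {I : Fin p ↪o Fin n}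
    (φ : TestForm p n) (hΔ : minor A I ≠ 0) {J : List (Fin p)} (hJ : J.Nodup) {m : ℕ}
    (hm : m + J.length = p) : ∃ ρ : Form (leaf A I J) m, IsMellinResidue A I φ J hm ρ :=
  ⟨_, isCompositeResidue_smul_contract (w := fun j => cpoint (dualVec A I j) 0)
    (isClosed_polarSet A I J).isOpen_compl (fun _ hz => analyticAt_mellinReg A I φ J hz) hJ
    (fun _ _ => Submodule.mem_top) (fun i _ j _ => col_cpoint_dualVec hΔ i j)
    (by rw [finrank_top, Module.finrank_fin_fun, hm]) (mellinForm_eq φ hΔ hJ hm)⟩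

theorem IsMellinResidue.apply_eq {A : Matrix (Fin p) (Fin n) ℕ} {I : Fin p ↪o Fin n}
    {φ : TestForm p n} (hΔ : minor A I ≠ 0) {J : List (Fin p)} (hJ : J.Nodup) {m : ℕ}
    {hm : m + J.length = p} {ρ : Form (leaf A I J) m} (hρ : IsMellinResidue A I φ J hm ρ)
    {s : leaf A I J} (hs : (s : Fin p → ℂ) ∉ polarSet A I J) (v : Fin m → realLeaf A I J) :
    ρ s (fun a => leafPoint A I J 0 (v a)) = mellinReg A I φ J s * (Complex.I ^ m
      * ((frameMatrix ((Nat.add_comm J.length m).trans hm)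
        (fun a => dualVec A I (J.get a)) fun a => (v a : Fin p → ℝ)).det : ℂ)) := by
  rw [IsCompositeResidue.eq_smul_contract (w := fun j => cpoint (dualVec A I j) 0)
    (isClosed_polarSet A I J).isOpen_compl (fun _ hz => analyticAt_mellinReg A I φ J hz) hJ
    (fun _ _ => Submodule.mem_top) (fun i _ j _ => col_cpoint_dualVec hΔ i j)
    (mellinForm_eq φ hΔ hJ hm) hρ s hs, AlternatingMap.smul_apply,
    AlternatingMap.compLinearMap_apply, contract_apply, smul_eq_mul, ← frameMatrix_det_ofReal]
  congr 1
  simp only [AlternatingMap.domDomCongr_apply, cpoint_zero_right, Submodule.subtype_apply,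
    leafPoint, Submodule.coe_zero, cpoint_zero_left]
  rfl

/-- The sign is that of the determinant with the covectors `αʲ`, while the residue produces the
determinant with the dual vectors; by `frameMatrix_det_mul_pos` the two signs agree. -/
theorem orientSign_mul_det {A : Matrix (Fin p) (Fin n) ℕ} {I : Fin p ↪o Fin n}
    (hΔ : minor A I ≠ 0) {J : List (Fin p)} (hJ : J.Nodup) {m : ℕ} (hm : m + J.length = p)
    {v : Fin m → Fin p → ℝ} (hvL : ∀ b, v b ∈ realLeaf A I J) (hv : LinearIndependent ℝ v) :
    (frameMatrix ((Nat.add_comm J.length m).trans hm)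
        (fun a => dualVec A I (J.get a)) v).det ≠ 0 ∧
    orientSign A I J hm v * (frameMatrix ((Nat.add_comm J.length m).trans hm)
        (fun a => dualVec A I (J.get a)) v).det
      = |(frameMatrix ((Nat.add_comm J.length m).trans hm)
        (fun a => dualVec A I (J.get a)) v).det| := by
  have hcol : ∀ j (x : Fin p → ℝ), (fun l => (A l (I j) : ℝ)) ⬝ᵥ x = col ℝ A (I j) x :=
    fun j x => (col_apply A (I j) x).symm
  have h := frameMatrix_det_mul_pos ((Nat.add_comm J.length m).trans hm)
    (α := fun (a : Fin J.length) l => (A l (I (J.get a)) : ℝ))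
    (w := fun a => dualVec A I (J.get a)) (v := v)
    (fun a b => by simp only [hcol, col_dualVec hΔ, hJ.get_inj_iff])
    (fun a b => by simp only [hcol, hvL b _ (J.get_mem a)]) hv
  have hs : orientSign A I J hm v = Real.sign (frameMatrix ((Nat.add_comm J.length m).trans hm)
    (fun (a : Fin J.length) l => (A l (I (J.get a)) : ℝ)) v).det := rfl
  rw [hs]
  rcases mul_pos_iff.1 h with ⟨h1, h2⟩ | ⟨h1, h2⟩
  · exact ⟨h2.ne', by rw [Real.sign_of_pos h1, abs_of_pos h2, one_mul]⟩
  · exact ⟨h2.ne, by rw [Real.sign_of_neg h1, abs_of_neg h2, neg_one_mul]⟩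

/-- On `L^q` one has `|s| = 0` and `Γ(|s| + 1) = 1`, so the residue integrand is a constant times
the same function `barnesReg` that appears in the limit. -/
theorem leafIntegrand_eq {A : Matrix (Fin p) (Fin n) ℕ} {I : Fin p ↪o Fin n}
    {φ : TestForm p n} (hΔ : minor A I ≠ 0) (hq : 1 ≤ codimZero A I) {J : List (Fin p)}
    (hJ : IsFaceIndexing A I J) {m : ℕ}
    {hm : m + J.length = p} {ρ : Form (leaf A I J) m} (hρ : IsMellinResidue A I φ J hm ρ)
    {γ : realLeaf A I J} (hγ : (γ : Fin p → ℝ) ∈ regularBase A I J)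
    (v : Fin m → realLeaf A I J) (t : Fin m → ℝ) :
    leafIntegrand A I J ρ γ v t = Complex.I ^ m
      * ((frameMatrix ((Nat.add_comm J.length m).trans hm)
        (fun a => dualVec A I (J.get a)) fun a => (v a : Fin p → ℝ)).det : ℂ)
      * barnesReg A I φ J (cpoint γ (∑ b, t b • (v b : Fin p → ℝ))) := by
  have hv : ((∑ b, t b • v b : realLeaf A I J) : Fin p → ℝ) = ∑ b, t b • (v b : Fin p → ℝ) := by
    simp
  have hpt : (leafPoint A I J γ (∑ b, t b • v b) : Fin p → ℂ)
      = cpoint γ (∑ b, t b • (v b : Fin p → ℝ)) := by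
    rw [← hv]
    rfl
  have h1 : ∑ k, cpoint (γ : Fin p → ℝ) (∑ b, t b • (v b : Fin p → ℝ)) k = 0 := by
    rw [sum_cpoint, sum_eq_zero_of_mem_realLeaf hΔ hq hJ γ.2, ← hv,
      sum_eq_zero_of_mem_realLeaf hΔ hq hJ (∑ b, t b • v b : realLeaf A I J).2]
    simp
  rw [leafIntegrand, hρ.apply_eq hΔ hJ.1
    (by rw [hpt]; exact notMem_polarSet_of_mem_regularBase hγ _), hpt, barnesReg, h1, zero_add,
    Complex.Gamma_one]
  ring

end

end BochnerMartinelli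

end

open BochnerMartinelli in
theorem lemma2 {p n : ℕ} (A : Matrix (Fin p) (Fin n) ℕ) (I : Fin p ↪o Fin n)
    (φ : TestForm p n) (hΔ : minor A I ≠ 0) (hq : 1 ≤ codimZero A I) :
    IsMellinContinuation A I φ (mellinGamma A I φ) ∧
    (∃ J : List (Fin p), IsFaceIndexing A I J) ∧
    ∀ (J : List (Fin p)), IsFaceIndexing A I J → ∀ (m : ℕ) (hm : m + J.length = p),
      (∃ ρ : Form (leaf A I J) m, IsMellinResidue A I φ J hm ρ) ∧
      ∀ ρ : Form (leaf A I J) m, IsMellinResidue A I φ J hm ρ →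
        ∀ γ ∈ admissible A I, PoleFree A I γ →
        ∀ γq : realLeaf A I J, (γq : Fin p → ℝ) ∈ admissibleFace A I →
          PoleFree A I (γq : Fin p → ℝ) →
        ∀ v : Module.Basis (Fin m) ℝ (realLeaf A I J),
          (∀ τ : ℝ, 0 < τ →
            MeasureTheory.Integrable fun y : Fin p → ℝ =>
              barnesIntegrand A I φ τ (cpoint γ y)) ∧
          MeasureTheory.Integrable (leafIntegrand A I J ρ γq v) ∧
          Filter.Tendsto (barnesIntegral A I φ γ) (nhdsWithin 0 (Set.Ioi 0))
            (nhds (1 / (2 * Real.pi * Complex.I) ^ m * leafIntegral A I J hm ρ γq v)) := by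
  refine ⟨isMellinContinuation_mellinGamma hΔ φ, exists_isFaceIndexing hΔ hq,
    fun J hJ m hm => ⟨exists_isMellinResidue φ hΔ hJ.1 hm, fun ρ hρ γ hγ hγp γq hγq hγqp v => ?_⟩⟩
  have hγS : γ ∈ regularBase A I J := mem_regularBase_of_admissible hΔ hq hγ hγp
  have hγqS := hJ.mem_regularBase_of_admissibleFace hΔ hq γq.2 hγq hγqp
  obtain ⟨K, hKc, hKconv, hKS, hγK, η, hη, hbox⟩ := exists_isCompact_convex_box
    (isOpen_regularBase A I J) (convex_regularBase A I J) hγS hγqS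
    fun a : Fin J.length => dualVec A I (J.get a)
  obtain ⟨C, hC⟩ := exists_norm_barnesReg_le φ hKc hKS
  have hvli : LinearIndependent ℝ fun b => (v b : Fin p → ℝ) :=
    v.linearIndependent.map' (Submodule.subtype _) (Submodule.ker_subtype _)
  obtain ⟨hdet, hsign⟩ := orientSign_mul_det hΔ hJ.1 hm (fun b => (v b).2) hvli
  obtain ⟨hint, hleaf, hlim⟩ := tendsto_integral_exp_mul
    (l := fun a : Fin J.length => col ℝ A (I (J.get a)))
    (lc := fun a : Fin J.length => col ℂ A (I (J.get a)))
    (c := fun a => sumCoeff A I (J.get a)) (Φ := barnesReg A I φ J)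
    ((Nat.add_comm J.length m).trans hm) (fun a x y => col_cpoint A (I (J.get a)) x y) hdet
    (fun a b => by simp only [col_dualVec hΔ, hJ.1.get_inj_iff])
    (fun a b => (v b).2 _ (J.get_mem a)) (fun a => (hJ.mem_iff hΔ _).1 (J.get_mem a)) hKconv
    (fun x hx y => differentiableAt_barnesReg φ (hKS hx) y) hC hγK
    (fun a => col_pos_of_mem_interior hΔ hγ.1 _) (fun a => γq.2 _ (J.get_mem a)) hη hbox
  have hbarnes := fun {τ : ℝ} (hτ : 0 < τ) => barnesIntegrand_eq φ hΔ hq hJ hγ hγp hτ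
  have hleafeq : leafIntegrand A I J ρ γq v = _ := funext (leafIntegrand_eq hΔ hq hJ hρ hγqS v)
  refine ⟨fun τ hτ => ?_, ?_, ?_⟩
  · simp only [hbarnes hτ]
    exact hint _
  · rw [hleafeq]
    exact hleaf.const_mul _
  · rw [leafIntegral, hleafeq, MeasureTheory.integral_const_mul]
    -- The large parameter is `T = -log τ`, as `τ^(-|s|) = exp(T |s|)`.
    have hlog : Filter.Tendsto (fun τ : ℝ => -Real.log τ) (nhdsWithin 0 (Set.Ioi 0))
        Filter.atTop := Filter.tendsto_neg_atBot_atTop.comp Real.tendsto_log_nhdsGT_zero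
    have hlim' := ((hlim.comp hlog).const_mul (Complex.I ^ p)).const_mul
      (1 / (2 * Real.pi * Complex.I) ^ p)
    have hpow : ∀ z : ℂ, z ^ p = z ^ J.length * z ^ m := fun z => by
      rw [← pow_add, Nat.add_comm, hm]
    have hpi : (Real.pi : ℂ) ≠ 0 := by exact_mod_cast Real.pi_ne_zero
    refine (hlim'.congr' ?_).trans (le_of_eq (congrArg nhds ?_))
    · filter_upwards [self_mem_nhdsWithin] with τ hτ
      simp only [barnesIntegral, hbarnes hτ, Function.comp]
    -- The constants match because `i^p (2π)^q / (2πi)^p = i^m / (2πi)^m` for `p = q + m`.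
    · rw [← hsign, hpow, hpow]
      push_cast
      field_simp
      rw [mul_pow _ Complex.I]
      ring
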